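/- Let $S=\mathbb N\times\mathbb N\times\mathbb N^*$, and for $f,c:S\to\mathbb R$ write $\langle c,f\rangle=\sum_{p\in S}c(p)f(p)$; $a,b$ also denote the coordinate functions on $S$. For $p=(a,b,m)$ and $p'=(a',b',m')$ in $S$ put $p.p'=a'b+ab'$; write $p'\preceq p$ if $a'\le a+1$, $b'\le b+1$, $m'\le m-1$, and then $p\backslash p'=(a+1-a',b+1-b',m-m')$. A family $(c_t(p))_{p\in S,\,t\in[0,T)}$ of real functions differentiable in $t$ is a solution of Smoluchowski's equation on $[0,T)$ if $\langle |c_t|,a+b\rangle<\infty$ for all $t\in[0,T)$, $\langle |c_t|,a^2+b^2\rangle<\infty$ for $t$ in a neighbourhood of $0$, the functions $t\mapsto\langle c_t,a\rangle$ and $t\mapsto\langle c_t,b\rangle$ are integrable on compact subintervals of $[0,T)$, and for all $p\in S$, $t\in[0,T)$, $$\frac{\mathrm d}{\mathrm dt}c_t(p)=\frac12\sum_{p'\preceq p}p'.(p\backslash p')\,c_t(p')\,c_t(p\backslash p')-c_t(p)\sum_{p'\in S}p.p'\,c_t(p').$$ Let $c_0:S\to[0,\infty)$ satisfy $\langle c_0,1\rangle<\infty$,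 $\langle c_0,a\rangle=\langle c_0,b\rangle=1$ and $\langle c_0,a^2+b^2\rangle<\infty$. Let $M=\langle c_0,ab\rangle+\sqrt{\langle c_0,a^2-a\rangle\langle c_0,b^2-b\rangle}$, and let $T_c=+\infty$ if $M\le1$, $T_c=1/(M-1)$ if $M>1$. Let $g_0(x,y,z)=\sum_{(a,b,m)\in S}c_0(a,b,m)x^ay^bz^m$ on $[0,1]^3$ (partial derivatives are one-sided on the boundary). Assume $T_c=+\infty$, and let $(c_t)_{t\ge0}$ be a solution of Smoluchowski's equation on $[0,+\infty)$ with initial condition $c_0$. Then: (i) There exist limiting concentrations $(c_\infty(m))_{m\ge1}\in\ell^1$ such that, as $t\to+\infty$, $c_t(a,b,m)\to c_\infty(m)\mathbf 1_{\{a=b=0\}}$ in $\ell^1(S)$. (ii) For every $z\in[0,1)$ there is a unique $h_\infty(z)=(h^{(1)}_\infty(z),h^{(2)}_\infty(z))\in[0,1]^2$ with $$h^{(1)}_\infty(z)=\frac{\partial g_0}{\partial y}\big(h^{(1)}_\infty(z),h^{(2)}_\infty(z),z\big),\qquad h^{(2)}_\infty(z)=\frac{\partial g_0}{\partial x}\big(h^{(1)}_\infty(z),h^{(2)}_\infty(z),z\big),$$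 and on $[0,1)$ the generating function $g_\infty(z)=\sum_{m\ge1}c_\infty(m)z^m$ is the antiderivative vanishing at $0$ of $z\mapsto\frac{\partial g_0}{\partial z}\big(h^{(1)}_\infty(z),h^{(2)}_\infty(z),z\big)$. -/

import Mathlib

open Set Filter Topology MeasureTheory

namespace SexedSmoluchowski

/-- The set of particle types `(a, b, m)`: `a` male arms, `b` female arms, mass `m ≥ 1`. -/
abbrev PType : Type := ℕ × ℕ × ℕ+

/-- Number of male arms, as a real number. -/
def male (p : PType) : ℝ := (p.1 : ℝ)

/-- Number of female arms, as a real number. -/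
def female (p : PType) : ℝ := (p.2.1 : ℝ)

/-- The coagulation rate `p.p' = a' b + a b'`. -/
def rate (p p' : PType) : ℝ := male p' * female p + male p * female p'

/-- The finite set of the types `p' ≼ p`, i.e. `a' ≤ a + 1`, `b' ≤ b + 1`, `m' ≤ m - 1`. -/
def below (p : PType) : Finset PType :=
  Finset.Iic (p.1 + 1) ×ˢ Finset.Iic (p.2.1 + 1) ×ˢ Finset.Iio p.2.2

/-- The type `p \ p' = (a + 1 - a', b + 1 - b', m - m')`, used only for `p' ≼ p`, in which case
none of the subtractions is truncated. -/
def diff (p p' : PType) : PType :=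
  (p.1 + 1 - p'.1, p.2.1 + 1 - p'.2.1, p.2.2 - p'.2.2)

/-- The bracket `⟨c, f⟩`, the sum over all types of `c(p) f(p)`. -/
noncomputable def bracket (c f : PType → ℝ) : ℝ := ∑' p, c p * f p

/-- Right-hand side of Smoluchowski's equation with mating at the type `p`. -/
noncomputable def rhs (c : PType → ℝ) (p : PType) : ℝ :=
  (1 / 2) * ∑ p' ∈ below p, rate p' (diff p p') * c p' * c (diff p p')
    - c p * ∑' p', rate p p' * c p'

/-- `c` (where `c t p` is the concentration of `p`-particles at time `t`) is a solution of
Smoluchowski's equation with mating on the time interval `[0, T)`. Values of `c` at times outside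
`[0, T)` are irrelevant. -/
structure IsSolution (T : EReal) (c : ℝ → PType → ℝ) : Prop where
  /-- `⟨a + b, |c_t|⟩ < ∞` for all `t`. -/
  summable_arms : ∀ t : ℝ, 0 ≤ t → (t : EReal) < T →
    Summable fun p => |c t p| * (male p + female p)
  /-- `⟨a² + b², |c_t|⟩ < ∞` for `t` in a neighbourhood of `0` in `[0, T)`. -/
  summable_sq : ∀ᶠ t : ℝ in 𝓝[≥] 0,
    Summable fun p => |c t p| * (male p ^ 2 + female p ^ 2)
  /-- The loss rates `∑ p', p.p' c_t(p')` may be integrated over compact time intervals. -/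
  integrable_male : ∀ t : ℝ, 0 ≤ t → (t : EReal) < T →
    IntervalIntegrable (fun s => bracket (c s) male) volume 0 t
  integrable_female : ∀ t : ℝ, 0 ≤ t → (t : EReal) < T →
    IntervalIntegrable (fun s => bracket (c s) female) volume 0 t
  /-- Each `t ↦ c_t(p)` is differentiable (from the right at `0`) and solves the equation. -/
  deriv_eq : ∀ t : ℝ, 0 ≤ t → (t : EReal) < T → ∀ p : PType,
    HasDerivWithinAt (fun s => c s p) (rhs (c t) p) (Ici 0) t

/-- Admissible initial concentrations: nonnegative, `⟨1, c₀⟩ < ∞`, `⟨a, c₀⟩ = ⟨b, c₀⟩ = 1`,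
`⟨a² + b², c₀⟩ < ∞`. -/
structure IsInitial (c₀ : PType → ℝ) : Prop where
  nonneg : ∀ p, 0 ≤ c₀ p
  summable : Summable c₀
  male_one : HasSum (fun p => c₀ p * male p) 1
  female_one : HasSum (fun p => c₀ p * female p) 1
  summable_sq : Summable fun p => c₀ p * (male p ^ 2 + female p ^ 2)

/-- `M = ⟨ab, c₀⟩ + √(⟨a² - a, c₀⟩ ⟨b² - b, c₀⟩)`. -/
noncomputable def critM (c₀ : PType → ℝ) : ℝ :=
  bracket c₀ (fun p => male p * female p) +
    Real.sqrt (bracket c₀ (fun p => male p ^ 2 - male p) *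
      bracket c₀ (fun p => female p ^ 2 - female p))

open scoped Classical in
/-- The critical time: `+∞` if `M ≤ 1`, and `1 / (M - 1)` if `M > 1`. -/
noncomputable def criticalTime (c₀ : PType → ℝ) : EReal :=
  if critM c₀ ≤ 1 then ⊤ else ((1 / (critM c₀ - 1) : ℝ) : EReal)

/-- The generating function `g₀(x, y, z) = ∑ c₀(a, b, m) x^a y^b z^m`. -/
noncomputable def genFun (c₀ : PType → ℝ) (x y z : ℝ) : ℝ :=
  ∑' p : PType, c₀ p * (x ^ p.1 * y ^ p.2.1 * z ^ (p.2.2 : ℕ))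

/-- The partial derivative `∂g₀/∂x` on `[0, 1]³` (one-sided on the boundary). -/
noncomputable def genFunX (c₀ : PType → ℝ) (x y z : ℝ) : ℝ :=
  derivWithin (fun u => genFun c₀ u y z) (Icc 0 1) x

/-- The partial derivative `∂g₀/∂y` on `[0, 1]³` (one-sided on the boundary). -/
noncomputable def genFunY (c₀ : PType → ℝ) (x y z : ℝ) : ℝ :=
  derivWithin (fun u => genFun c₀ x u z) (Icc 0 1) y

/-- The partial derivative `∂g₀/∂z` on `[0, 1]² × [0, 1)` (one-sided at `z = 0`). -/
noncomputable def genFunZ (c₀ : PType → ℝ) (x y z : ℝ) : ℝ :=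
  derivWithin (fun u => genFun c₀ x y u) (Icc 0 1) z

/-- `h ∈ [0, 1]²` is a fixed point of `(x, y) ↦ (∂g₀/∂y (x, y, z), ∂g₀/∂x (x, y, z))`. -/
def IsFixedPt (c₀ : PType → ℝ) (z : ℝ) (h : ℝ × ℝ) : Prop :=
  h.1 ∈ Icc (0 : ℝ) 1 ∧ h.2 ∈ Icc (0 : ℝ) 1 ∧
    h.1 = genFunY c₀ h.1 h.2 z ∧ h.2 = genFunX c₀ h.1 h.2 z

/-- The state `(a, b, m) ↦ c_∞(m) 1_{a = b = 0}`. -/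
def armless (cInf : ℕ+ → ℝ) (p : PType) : ℝ :=
  if p.1 = 0 ∧ p.2.1 = 0 then cInf p.2.2 else 0

/-- The generating function `g_∞(z) = ∑ c_∞(m) z^m`. -/
noncomputable def limitGenFun (cInf : ℕ+ → ℝ) (z : ℝ) : ℝ :=
  ∑' m : ℕ+, cInf m * z ^ (m : ℕ)

end SexedSmoluchowski

namespace SexedSmoluchowski

/-! ### Weak form of the equation and differential inequalities for truncated moments -/

section

/-! Write `Z = ⟨c, ab⟩`, `X = ⟨c, a² - a⟩`, `Y = ⟨c, b² - b⟩`. The number `M = Z + √(XY)`, taken at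
time 0, is the spectral radius of the matrix with rows `(Z, Y)` and `(X, Z)`. The condition `M ≤ 1`
is used twice: it prevents gelation, and it makes the fixed point map a contraction in a weighted
norm for `z < 1`.

No gelation. For a weight `l` with `Z + l X` and `Z + Y / l` at most `1 + ε` at time 0, the moment
`μ = Z + (l X + Y / l) / 2` satisfies `μ' ≤ μ² - 2 β μ` whenever both arm concentrations are at
least `β`. This is proved on finite truncations (`sum_trunc_rhs_quadWeight_le`), so no second moment
has to be assumed finite. If both arm concentrations equal `1 / (1 + t)`, comparison keeps `μ ≤ 2`.
Conversely, a bounded second moment justifies the weak form with `f = a` and `f = b`, and forces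
these concentrations to be `1 / (1 + t)`. A continuation by time steps of fixed length closes the
loop on every `[0, T]` (`IsSolution.arms_eq_and_momentBound`).

Convergence. Particles without arms never react, so their concentrations increase to a limit; all
other particles have total concentration at most `2 / (1 + t)` (`IsSolution.tendsto_armless`).

Limit. The generating function satisfies `∂ₜ g = g_x g_y - (x g_x + y g_y) / (1 + t)`. A solution
`(x, y)` of the fixed point equation is a stationary characteristic: along it `g_y = x / (1 + t)`
and `g_x = y / (1 + t)` for all times, hence `∂ₜ g = -x y / (1 + t)²` (`IsSolution.genFun_fixedPt`).
Letting `t → ∞` gives `g_∞(z) = g₀(h(z), z) - h₁(z) h₂(z)`. The fixed point equation says that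
`h(z)` is critical for `(x, y) ↦ g₀(x, y, z) - x y`, so only the explicit dependence on `z`
contributes to the derivative (`IsInitial.hasDerivWithinAt_envelope`). Existence of `h` comes from
monotonicity; uniqueness and Lipschitz dependence come from the contraction estimate. -/

lemma male_nonneg (p : PType) : 0 ≤ male p := Nat.cast_nonneg _

lemma female_nonneg (p : PType) : 0 ≤ female p := Nat.cast_nonneg _

lemma rate_nonneg (p q : PType) : 0 ≤ rate p q :=
  add_nonneg (mul_nonneg (male_nonneg _) (female_nonneg _))
    (mul_nonneg (male_nonneg _) (female_nonneg _))

/-- The type of the particle created when `p` and `q` coagulate. -/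
def merge (p q : PType) : PType := (p.1 + q.1 - 1, p.2.1 + q.2.1 - 1, p.2.2 + q.2.2)

lemma merge_comm (p q : PType) : merge p q = merge q p := by
  simp [merge, add_comm]

/-- The weight of an ordered pair joined by a male arm of the first and a female arm of the
second particle. -/
def pairWeight (c : PType → ℝ) (x : PType × PType) : ℝ :=
  (c x.1 * male x.1) * (c x.2 * female x.2)

lemma pairWeight_nonneg {c : PType → ℝ} (h : ∀ p, 0 ≤ c p) (x : PType × PType) :
    0 ≤ pairWeight c x :=
  mul_nonneg (mul_nonneg (h _) (male_nonneg _)) (mul_nonneg (h _) (female_nonneg _))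

lemma hasSum_pair {u v : PType → ℝ} {U V : ℝ} (hu : HasSum u U) (hv : HasSum v V) :
    HasSum (fun x : PType × PType => u x.1 * v x.2) (U * V) := by
  refine hu.mul hv ?_
  exact summable_mul_of_summable_norm hu.summable.norm hv.summable.norm

lemma HasSum.of_eq {ι : Type*} {f g : ι → ℝ} {a : ℝ} (h : HasSum f a) (hfg : ∀ i, g i = f i) :
    HasSum g a := by
  rwa [show g = f from funext hfg]

/-- The gain term of Smoluchowski's equation. -/
noncomputable def gain (c : PType → ℝ) (p : PType) : ℝ :=
  (1 / 2) * ∑ p' ∈ below p, rate p' (diff p p') * c p' * c (diff p p')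

lemma gain_nonneg {c : PType → ℝ} (h : ∀ p, 0 ≤ c p) (p : PType) : 0 ≤ gain c p :=
  mul_nonneg (by norm_num) (Finset.sum_nonneg fun q _ =>
    mul_nonneg (mul_nonneg (rate_nonneg _ _) (h _)) (h _))

lemma mem_below {p q : PType} : q ∈ below p ↔ q.1 ≤ p.1 + 1 ∧ q.2.1 ≤ p.2.1 + 1 ∧ q.2.2 < p.2.2 := by
  simp [below, Finset.mem_product]

lemma merge_diff {p q : PType} (h : q ∈ below p) : merge q (diff p q) = p := by
  obtain ⟨h1, h2, h3⟩ := mem_below.1 h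
  obtain ⟨a, b, m⟩ := p
  obtain ⟨a', b', m'⟩ := q
  simp only [merge, diff] at *
  refine Prod.ext (by simp; omega) (Prod.ext (by simp; omega) ?_)
  simpa using PNat.add_sub_of_lt h3

lemma diff_merge {p q : PType} (h1 : 1 ≤ p.1 + q.1) (h2 : 1 ≤ p.2.1 + q.2.1) :
    p ∈ below (merge p q) ∧ diff (merge p q) p = q := by
  obtain ⟨a, b, m⟩ := p
  obtain ⟨a', b', m'⟩ := q
  simp only [merge, diff, mem_below] at *
  refine ⟨⟨by omega, by omega, PNat.lt_add_right _ _⟩, ?_⟩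
  refine Prod.ext (by simp; omega) (Prod.ext (by simp; omega) ?_)
  refine PNat.coe_injective ?_
  simp [PNat.sub_coe, PNat.lt_add_right]

/-- The fibre of `merge` may contain extra pairs in which a natural subtraction is truncated. Such a
pair has no male arm at all or no female arm at all, so its rate vanishes. -/
lemma tsum_merge_fiber (F : PType → PType → ℝ) (p : PType) :
    ∑' x : (fun x : PType × PType => merge x.1 x.2) ⁻¹' {p},
      rate (x : PType × PType).1 (x : PType × PType).2 * F (x : PType × PType).1 (x : PType × PType).2
      = ∑ q ∈ below p, rate q (diff p q) * F q (diff p q) := by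
  classical
  rw [tsum_subtype ((fun x : PType × PType => merge x.1 x.2) ⁻¹' {p})
    (fun x : PType × PType => rate x.1 x.2 * F x.1 x.2)]
  rw [tsum_eq_sum (s := (below p).image fun q => (q, diff p q))]
  · rw [Finset.sum_image (by intro q _ r _ h; exact (Prod.ext_iff.1 h).1)]
    refine Finset.sum_congr rfl fun q hq => ?_
    rw [indicator_of_mem]
    exact merge_diff hq
  · rintro ⟨q, r⟩ hx
    by_cases hm : merge q r = p
    · rw [indicator_of_mem (by exact hm)]
      have : rate q r = 0 := by
        by_contra hr
        apply hx
        have h1 : 1 ≤ q.1 + r.1 := by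
          by_contra h
          apply hr
          have h1 : q.1 = 0 := by omega
          have h2 : r.1 = 0 := by omega
          simp [rate, male, h1, h2]
        have h2 : 1 ≤ q.2.1 + r.2.1 := by
          by_contra h
          apply hr
          have h1 : q.2.1 = 0 := by omega
          have h2 : r.2.1 = 0 := by omega
          simp [rate, female, h1, h2]
        have := diff_merge h1 h2
        rw [hm] at this
        exact Finset.mem_image.2 ⟨q, this.1, by rw [this.2]⟩
      simp [this]
    · rw [indicator_of_notMem (by exact hm)]

/-- Symmetrising the male-female weight of an ordered pair produces half the coagulation rate;
regrouping the pairs along the fibres of `merge` then gives the gain term. -/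
lemma hasSum_gain {c f : PType → ℝ} {S : ℝ}
    (h : HasSum (fun x : PType × PType => pairWeight c x * f (merge x.1 x.2)) S) :
    HasSum (fun p => f p * gain c p) S := by
  have h' := (Equiv.prodComm PType PType).hasSum_iff.2 h
  have h2 := (h.add h').mul_left (1 / 2)
  rw [show (1 / 2) * (S + S) = S by ring] at h2
  have h3 := h2.tsum_fiberwise (fun x : PType × PType => merge x.1 x.2)
  refine HasSum.of_eq h3 fun p => ?_
  have := tsum_merge_fiber (fun q r => (1 / 2) * c q * c r * f (merge q r)) p
  rw [gain, Finset.mul_sum, Finset.mul_sum]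
  calc _ = ∑ q ∈ below p, rate q (diff p q) * ((1 / 2) * c q * c (diff p q) * f (merge q (diff p q))) := by
        refine Finset.sum_congr rfl fun q hq => ?_
        rw [merge_diff hq]; ring
    _ = _ := by
        rw [← this]
        refine tsum_congr fun x => ?_
        simp only [Function.comp, Equiv.prodComm_apply, Prod.fst_swap, Prod.snd_swap, pairWeight, rate]
        rw [merge_comm (x : PType × PType).2]
        ring

lemma hasSum_loss_rate {c : PType → ℝ} {A B : ℝ} (hA : HasSum (fun p => c p * male p) A)
    (hB : HasSum (fun p => c p * female p) B) (p : PType) :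
    ∑' q, rate p q * c q = A * female p + male p * B := by
  refine HasSum.tsum_eq ?_
  refine HasSum.of_eq ((hA.mul_right (female p)).add (hB.mul_left (male p))) fun q => ?_
  simp only [rate]; ring

lemma rhs_eq {c : PType → ℝ} {A B : ℝ} (hA : HasSum (fun p => c p * male p) A)
    (hB : HasSum (fun p => c p * female p) B) (p : PType) :
    rhs c p = gain c p - c p * (A * female p + male p * B) := by
  rw [rhs, hasSum_loss_rate hA hB, gain]

lemma hasSum_loss {c f : PType → ℝ} {A B F G : ℝ} (hF : HasSum (fun p => c p * male p * f p) F)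
    (hG : HasSum (fun p => c p * female p * f p) G) :
    HasSum (fun p => f p * (c p * (A * female p + male p * B))) (A * G + F * B) := by
  refine HasSum.of_eq ((hG.mul_left A).add (hF.mul_right B)) fun p => ?_
  ring

/-- The weak form of Smoluchowski's equation. -/
lemma hasSum_mul_rhs {c f : PType → ℝ} {S A B F G : ℝ} (hA : HasSum (fun p => c p * male p) A)
    (hB : HasSum (fun p => c p * female p) B)
    (h : HasSum (fun x : PType × PType => pairWeight c x * f (merge x.1 x.2)) S)
    (hF : HasSum (fun p => c p * male p * f p) F)
    (hG : HasSum (fun p => c p * female p * f p) G) :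
    HasSum (fun p => f p * rhs c p) (S - (A * G + F * B)) := by
  refine HasSum.of_eq ((hasSum_gain h).sub (hasSum_loss (A := A) (B := B) hF hG)) fun p => ?_
  rw [rhs_eq hA hB]; ring

lemma hasSum_pair_weak {c f : PType → ℝ} {S A B F G : ℝ} (hA : HasSum (fun p => c p * male p) A)
    (hB : HasSum (fun p => c p * female p) B)
    (h : HasSum (fun x : PType × PType => pairWeight c x * f (merge x.1 x.2)) S)
    (hF : HasSum (fun p => c p * male p * f p) F)
    (hG : HasSum (fun p => c p * female p * f p) G) :
    HasSum (fun x : PType × PType => pairWeight c x * (f (merge x.1 x.2) - f x.1 - f x.2))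
      (S - (A * G + F * B)) := by
  refine HasSum.of_eq (h.sub ((hasSum_pair hA hG).add (hasSum_pair hF hB))) fun x => ?_
  simp only [pairWeight]; ring

lemma sum_abs_mul_rhs_le {c f : PType → ℝ} {S A B F G : ℝ} (hc : ∀ p, 0 ≤ c p)
    (hA : HasSum (fun p => c p * male p) A)
    (hB : HasSum (fun p => c p * female p) B)
    (h : HasSum (fun x : PType × PType => pairWeight c x * |f (merge x.1 x.2)|) S)
    (hF : HasSum (fun p => c p * male p * |f p|) F)
    (hG : HasSum (fun p => c p * female p * |f p|) G) (s : Finset PType) :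
    ∑ p ∈ s, |f p * rhs c p| ≤ S + (A * G + F * B) := by
  have hA0 : 0 ≤ A := hA.nonneg fun p => mul_nonneg (hc p) (male_nonneg p)
  have hB0 : 0 ≤ B := hB.nonneg fun p => mul_nonneg (hc p) (female_nonneg p)
  have hl : ∀ p, 0 ≤ c p * (A * female p + male p * B) := fun p =>
    mul_nonneg (hc p) (add_nonneg (mul_nonneg hA0 (female_nonneg p))
      (mul_nonneg (male_nonneg p) hB0))
  have key := (hasSum_gain (f := fun p => |f p|) h).add (hasSum_loss (f := fun p => |f p|) (A := A) (B := B) hF hG)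
  refine (Finset.sum_le_sum fun p _ => ?_).trans (sum_le_hasSum s (fun p _ => ?_) key)
  · rw [rhs_eq hA hB, abs_mul, ← mul_add]
    refine mul_le_mul_of_nonneg_left ?_ (abs_nonneg _)
    rw [abs_le]
    constructor <;> linarith [gain_nonneg hc p, hl p]
  · exact add_nonneg (mul_nonneg (abs_nonneg _) (gain_nonneg hc p))
      (mul_nonneg (abs_nonneg _) (hl p))

/-- An exhaustion of the set of types by finite sets whose complements are stable under
coagulation. -/
def trunc (n : ℕ) : Finset PType :=
  (Finset.Iic n ×ˢ Finset.Iic n ×ˢ Finset.Iic n.succPNat).filter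
    fun p => p.1 + (p.2.2 : ℕ) ≤ n ∧ p.2.1 + (p.2.2 : ℕ) ≤ n

lemma mem_trunc {n : ℕ} {p : PType} :
    p ∈ trunc n ↔ p.1 + (p.2.2 : ℕ) ≤ n ∧ p.2.1 + (p.2.2 : ℕ) ≤ n := by
  obtain ⟨a, b, m⟩ := p
  simp only [trunc, Finset.mem_filter, Finset.mem_product, Finset.mem_Iic, and_iff_right_iff_imp]
  intro h
  refine ⟨by omega, by omega, ?_⟩
  rw [← PNat.coe_le_coe, Nat.succPNat_coe]
  omega

lemma exists_subset_trunc (s : Finset PType) : ∃ n, s ⊆ trunc n := by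
  refine ⟨s.sup fun p => p.1 + p.2.1 + (p.2.2 : ℕ), fun p hp => ?_⟩
  have := Finset.le_sup (f := fun p : PType => p.1 + p.2.1 + (p.2.2 : ℕ)) hp
  rw [mem_trunc]
  omega

lemma summable_of_sum_trunc_le {f : PType → ℝ} {K : ℝ} (h0 : ∀ p, 0 ≤ f p)
    (h : ∀ n, ∑ p ∈ trunc n, f p ≤ K) : Summable f ∧ ∑' p, f p ≤ K := by
  have key : ∀ s : Finset PType, ∑ p ∈ s, f p ≤ K := fun s => by
    obtain ⟨n, hn⟩ := exists_subset_trunc s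
    exact (Finset.sum_le_sum_of_subset_of_nonneg hn fun p _ _ => h0 p).trans (h n)
  exact ⟨summable_of_sum_le h0 key, Real.tsum_le_of_sum_le h0 key⟩

/-- Restriction of a function to `trunc n`. -/
noncomputable def cut (n : ℕ) (f : PType → ℝ) (p : PType) : ℝ := by
  classical exact if p ∈ trunc n then f p else 0

lemma cut_of_mem {n : ℕ} {p : PType} (f : PType → ℝ) (h : p ∈ trunc n) : cut n f p = f p := by
  simp [cut, h]

lemma cut_of_notMem {n : ℕ} {p : PType} (f : PType → ℝ) (h : p ∉ trunc n) : cut n f p = 0 := by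
  simp [cut, h]

lemma hasSum_cut (n : ℕ) (u f : PType → ℝ) :
    HasSum (fun p => u p * cut n f p) (∑ p ∈ trunc n, u p * f p) := by
  have : ∑ p ∈ trunc n, u p * f p = ∑ p ∈ trunc n, u p * cut n f p :=
    Finset.sum_congr rfl fun p hp => by rw [cut_of_mem f hp]
  rw [this]
  exact hasSum_sum_of_ne_finset_zero fun p hp => by rw [cut_of_notMem f hp, mul_zero]

lemma exists_abs_cut_le (n : ℕ) (f : PType → ℝ) : ∃ C, ∀ p, |cut n f p| ≤ C := by
  refine ⟨∑ p ∈ trunc n, |f p|, fun p => ?_⟩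
  by_cases h : p ∈ trunc n
  · rw [cut_of_mem f h]
    exact Finset.single_le_sum (f := fun p => |f p|) (fun q _ => abs_nonneg _) h
  · rw [cut_of_notMem f h, abs_zero]
    exact Finset.sum_nonneg fun q _ => abs_nonneg _

/-- If the first particle has a male arm and the second one a female arm, truncation is monotone
under coagulation. -/
lemma mem_trunc_of_merge {n : ℕ} {p q : PType} (hp : 1 ≤ p.1) (hq : 1 ≤ q.2.1)
    (h : merge p q ∈ trunc n) : p ∈ trunc n ∧ q ∈ trunc n := by
  simp only [mem_trunc, merge, PNat.add_coe] at *
  -- Each mass is at least 1, which makes up for the arm lost in the merger.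
  have := p.2.2.pos
  have := q.2.2.pos
  omega

lemma male_merge {p q : PType} (hp : 1 ≤ p.1) : male (merge p q) = male p + male q - 1 := by
  simp only [male, merge]
  rw [Nat.cast_sub (by omega)]; push_cast; ring

lemma female_merge {p q : PType} (hq : 1 ≤ q.2.1) :
    female (merge p q) = female p + female q - 1 := by
  simp only [female, merge]
  rw [Nat.cast_sub (by omega)]; push_cast; ring

/-- An upper bound for the derivative of a truncated moment. -/
lemma sum_trunc_rhs_le {c : PType → ℝ} {A B r : ℝ} (hc : ∀ p, 0 ≤ c p)
    (hA : HasSum (fun p => c p * male p) A) (hB : HasSum (fun p => c p * female p) B)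
    (n : ℕ) (f : PType → ℝ) {R : PType × PType → ℝ}
    (hR : HasSum (fun x => pairWeight c x * R x) r)
    (h : ∀ p q : PType, 1 ≤ p.1 → 1 ≤ q.2.1 →
      cut n f (merge p q) - cut n f p - cut n f q ≤ R (p, q)) :
    ∑ p ∈ trunc n, rhs c p * f p ≤ r := by
  obtain ⟨C, hC⟩ := exists_abs_cut_le n f
  -- The truncated function is bounded, so first moments of `c` suffice for the weak form.
  have hS : Summable fun x : PType × PType => pairWeight c x * cut n f (merge x.1 x.2) := by
    refine Summable.of_norm_bounded (g := fun x => pairWeight c x * C)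
      ((hasSum_pair hA hB).summable.mul_right C) fun x => ?_
    rw [norm_mul, Real.norm_of_nonneg (pairWeight_nonneg hc x)]
    exact mul_le_mul_of_nonneg_left (hC _) (pairWeight_nonneg hc x)
  have hF := hasSum_cut n (fun p => c p * male p) f
  have hG := hasSum_cut n (fun p => c p * female p) f
  have h1 := hasSum_mul_rhs hA hB hS.hasSum hF hG
  have h2 := hasSum_pair_weak hA hB hS.hasSum hF hG
  have h3 := hasSum_cut n (rhs c) f
  have h4 : (fun p => cut n f p * rhs c p) = fun p => rhs c p * cut n f p :=
    funext fun p => mul_comm _ _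
  rw [h4] at h1
  rw [h3.unique h1]
  refine hasSum_le (fun x => ?_) h2 hR
  by_cases hp : 1 ≤ x.1.1
  · by_cases hq : 1 ≤ x.2.2.1
    · exact mul_le_mul_of_nonneg_left (h _ _ hp hq) (pairWeight_nonneg hc x)
    · have : female x.2 = 0 := by simp [female]; omega
      simp [pairWeight, this]
  · have : male x.1 = 0 := by simp [male]; omega
    simp [pairWeight, this]

/-- A reacting pair can leave the truncation set but never enter it, so truncation preserves
subadditivity of a nonnegative function along reactions. -/
lemma sum_trunc_rhs_nonpos {c : PType → ℝ} {A B : ℝ} (hc : ∀ p, 0 ≤ c p)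
    (hA : HasSum (fun p => c p * male p) A) (hB : HasSum (fun p => c p * female p) B)
    (n : ℕ) {f : PType → ℝ} (hf : ∀ p, 0 ≤ f p)
    (h : ∀ p q : PType, 1 ≤ p.1 → 1 ≤ q.2.1 → f (merge p q) ≤ f p + f q) :
    ∑ p ∈ trunc n, rhs c p * f p ≤ 0 := by
  refine sum_trunc_rhs_le hc hA hB n f (R := fun _ => 0) (by simp [hasSum_zero])
    fun p q hp hq => ?_
  have h0 : ∀ p, 0 ≤ cut n f p := fun p => by
    by_cases hp : p ∈ trunc n
    · rw [cut_of_mem f hp]; exact hf p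
    · rw [cut_of_notMem f hp]
  by_cases hm : merge p q ∈ trunc n
  · obtain ⟨h1, h2⟩ := mem_trunc_of_merge hp hq hm
    rw [cut_of_mem f hm, cut_of_mem f h1, cut_of_mem f h2]
    linarith [h p q hp hq]
  · rw [cut_of_notMem f hm]
    linarith [h0 p, h0 q]

lemma male_sq_sub_nonneg (p : PType) : 0 ≤ male p ^ 2 - male p := by
  have : (p.1 : ℝ) ≤ (p.1 : ℝ) ^ 2 := by exact_mod_cast Nat.le_self_pow two_ne_zero _
  simpa [male] using this

lemma female_sq_sub_nonneg (p : PType) : 0 ≤ female p ^ 2 - female p := by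
  have : (p.2.1 : ℝ) ≤ (p.2.1 : ℝ) ^ 2 := by exact_mod_cast Nat.le_self_pow two_ne_zero _
  simpa [female] using this

lemma one_le_male {p : PType} (h : 1 ≤ p.1) : 1 ≤ male p := by
  simp [male, h]

lemma one_le_female {p : PType} (h : 1 ≤ p.2.1) : 1 ≤ female p := by
  simp [female, h]

lemma male_pred_nonneg {p : PType} (h : 1 ≤ p.1) : 0 ≤ (male p - 1) * (male p - 2) := by
  have := male_sq_sub_nonneg (p.1 - 1, p.2.1, p.2.2)
  simp only [male, Nat.cast_sub h] at *
  push_cast at this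
  nlinarith

lemma female_pred_nonneg {p : PType} (h : 1 ≤ p.2.1) :
    0 ≤ (female p - 1) * (female p - 2) := by
  have := female_sq_sub_nonneg (p.1, p.2.1 - 1, p.2.2)
  simp only [female, Nat.cast_sub h] at *
  push_cast at this
  nlinarith

/-- Without truncation, a merger changes `a² - a` by exactly `2 (a - 1)(a' - 1)`. Leaving the `-1`
of the second factor untruncated produces the full arm concentration `B`, whose value is needed
later. -/
lemma sum_trunc_rhs_male_le {c : PType → ℝ} {A B : ℝ} (hc : ∀ p, 0 ≤ c p)
    (hA : HasSum (fun p => c p * male p) A) (hB : HasSum (fun p => c p * female p) B) (n : ℕ) :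
    ∑ p ∈ trunc n, rhs c p * (male p ^ 2 - male p) ≤
      2 * (∑ p ∈ trunc n, c p * (male p ^ 2 - male p)) *
        ((∑ p ∈ trunc n, c p * (male p * female p)) - B) := by
  have hR := (hasSum_pair (hasSum_cut n c fun p => male p ^ 2 - male p)
    ((hasSum_cut n c fun p => male p * female p).sub hB)).mul_left 2
  rw [← mul_assoc] at hR
  refine sum_trunc_rhs_le hc hA hB n (fun p => male p ^ 2 - male p)
    (R := fun x => 2 * cut n (fun p => male p - 1) x.1 * (cut n (fun p => male p) x.2 - 1))
    (HasSum.of_eq hR fun x => ?_) fun p q hp hq => ?_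
  · by_cases h1 : x.1 ∈ trunc n <;> by_cases h2 : x.2 ∈ trunc n <;>
      simp only [pairWeight, cut_of_mem, cut_of_notMem, h1, h2, not_false_eq_true] <;> ring
  · have hp' := one_le_male hp
    have hq' := one_le_female hq
    have h1 := male_sq_sub_nonneg p
    have h2 := male_sq_sub_nonneg q
    have h3 := male_nonneg q
    have h6 := male_pred_nonneg hp
    have h7 := male_sq_sub_nonneg (merge p q)
    -- Nonnegativity of `a² - a` at the merged particle settles the case in which both particles are
    -- kept but their merger is cut off.
    rw [male_merge hp] at h7
    by_cases hm : merge p q ∈ trunc n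
    · obtain ⟨h1, h2⟩ := mem_trunc_of_merge hp hq hm
      simp only [cut_of_mem, hm, h1, h2, male_merge hp]
      nlinarith
    · by_cases h4 : p ∈ trunc n <;> by_cases h5 : q ∈ trunc n <;>
        simp only [cut_of_mem, cut_of_notMem, hm, h4, h5, not_false_eq_true] <;> nlinarith

lemma sum_trunc_rhs_female_le {c : PType → ℝ} {A B : ℝ} (hc : ∀ p, 0 ≤ c p)
    (hA : HasSum (fun p => c p * male p) A) (hB : HasSum (fun p => c p * female p) B) (n : ℕ) :
    ∑ p ∈ trunc n, rhs c p * (female p ^ 2 - female p) ≤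
      2 * (∑ p ∈ trunc n, c p * (female p ^ 2 - female p)) *
        ((∑ p ∈ trunc n, c p * (male p * female p)) - A) := by
  have hR := (hasSum_pair ((hasSum_cut n c fun p => male p * female p).sub hA)
    (hasSum_cut n c fun p => female p ^ 2 - female p)).mul_left 2
  rw [mul_comm (_ - A), ← mul_assoc] at hR
  refine sum_trunc_rhs_le hc hA hB n (fun p => female p ^ 2 - female p)
    (R := fun x => 2 * cut n (fun p => female p - 1) x.2 * (cut n (fun p => female p) x.1 - 1))
    (HasSum.of_eq hR fun x => ?_) fun p q hp hq => ?_
  · by_cases h1 : x.1 ∈ trunc n <;> by_cases h2 : x.2 ∈ trunc n <;>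
      simp only [pairWeight, cut_of_mem, cut_of_notMem, h1, h2, not_false_eq_true] <;> ring
  · have hp' := one_le_male hp
    have hq' := one_le_female hq
    have h1 := female_sq_sub_nonneg p
    have h2 := female_sq_sub_nonneg q
    have h3 := female_nonneg p
    have h6 := female_pred_nonneg hq
    have h7 := female_sq_sub_nonneg (merge p q)
    rw [female_merge hq] at h7
    by_cases hm : merge p q ∈ trunc n
    · obtain ⟨h1, h2⟩ := mem_trunc_of_merge hp hq hm
      simp only [cut_of_mem, hm, h1, h2, female_merge hq]
      nlinarith
    · by_cases h4 : p ∈ trunc n <;> by_cases h5 : q ∈ trunc n <;>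
        simp only [cut_of_mem, cut_of_notMem, hm, h4, h5, not_false_eq_true] <;> nlinarith

/-- Without truncation, the change of `ab` in a merger is `(a - 1)(b' - 1) + b a' - a' - b`; its
four terms give the four products on the right. -/
lemma sum_trunc_rhs_mixed_le {c : PType → ℝ} {A B : ℝ} (hc : ∀ p, 0 ≤ c p)
    (hA : HasSum (fun p => c p * male p) A) (hB : HasSum (fun p => c p * female p) B) (n : ℕ) :
    ∑ p ∈ trunc n, rhs c p * (male p * female p) ≤
      (∑ p ∈ trunc n, c p * (male p ^ 2 - male p)) *
        (∑ p ∈ trunc n, c p * (female p ^ 2 - female p)) +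
      (∑ p ∈ trunc n, c p * (male p * female p)) * (∑ p ∈ trunc n, c p * (male p * female p)) -
      A * (∑ p ∈ trunc n, c p * (male p * female p)) -
      (∑ p ∈ trunc n, c p * (male p * female p)) * B := by
  have hX := hasSum_cut n c fun p => male p ^ 2 - male p
  have hY := hasSum_cut n c fun p => female p ^ 2 - female p
  have hZ := hasSum_cut n c fun p => male p * female p
  have hR := (((hasSum_pair hX hY).add (hasSum_pair hZ hZ)).sub (hasSum_pair hA hZ)).sub
    (hasSum_pair hZ hB)
  refine sum_trunc_rhs_le hc hA hB n (fun p => male p * female p)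
    (R := fun x => cut n (fun p => male p - 1) x.1 * cut n (fun p => female p - 1) x.2 +
      cut n (fun p => female p) x.1 * cut n (fun p => male p) x.2 -
      cut n (fun p => male p) x.2 - cut n (fun p => female p) x.1)
    (HasSum.of_eq hR fun x => ?_) fun p q hp hq => ?_
  · by_cases h1 : x.1 ∈ trunc n <;> by_cases h2 : x.2 ∈ trunc n <;>
      simp only [pairWeight, cut_of_mem, cut_of_notMem, h1, h2, not_false_eq_true] <;> ring
  · have hp' := one_le_male hp
    have hq' := one_le_female hq
    have h1 := male_nonneg q
    have h2 := female_nonneg p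
    by_cases hm : merge p q ∈ trunc n
    · obtain ⟨h1, h2⟩ := mem_trunc_of_merge hp hq hm
      simp only [cut_of_mem, hm, h1, h2, male_merge hp, female_merge hq]
      nlinarith
    · by_cases h4 : p ∈ trunc n <;> by_cases h5 : q ∈ trunc n <;>
        simp only [cut_of_mem, cut_of_notMem, hm, h4, h5, not_false_eq_true]
      · nlinarith [mul_nonneg (add_nonneg (sub_nonneg.2 hp') h1)
          (add_nonneg (sub_nonneg.2 hq') h2)]
      · nlinarith
      · nlinarith
      · simp

/-- The weight `ab + (l (a² - a) + l⁻¹ (b² - b)) / 2`, whose mean controls all second moments. -/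
noncomputable def quadWeight (l : ℝ) (p : PType) : ℝ :=
  male p * female p + (l * (male p ^ 2 - male p) + l⁻¹ * (female p ^ 2 - female p)) / 2

lemma quadWeight_nonneg {l : ℝ} (hl : 0 < l) (p : PType) : 0 ≤ quadWeight l p := by
  have := male_sq_sub_nonneg p
  have := female_sq_sub_nonneg p
  have := male_nonneg p
  have := female_nonneg p
  unfold quadWeight
  positivity

lemma sum_trunc_quadWeight (l : ℝ) (n : ℕ) (c : PType → ℝ) :
    ∑ p ∈ trunc n, c p * quadWeight l p = (∑ p ∈ trunc n, c p * (male p * female p)) +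
      (l * (∑ p ∈ trunc n, c p * (male p ^ 2 - male p)) +
        l⁻¹ * (∑ p ∈ trunc n, c p * (female p ^ 2 - female p))) / 2 := by
  rw [Finset.mul_sum, Finset.mul_sum, ← Finset.sum_add_distrib, Finset.sum_div,
    ← Finset.sum_add_distrib]
  exact Finset.sum_congr rfl fun p _ => by rw [quadWeight]; ring

/-- The only product not already part of a square is `XY = (l X)(l⁻¹ Y)`. By the inequality of
arithmetic and geometric means it is at most `((l X + l⁻¹ Y) / 2)²`, and the three estimates combine
into a closed Riccati inequality. -/
lemma sum_trunc_rhs_quadWeight_le {c : PType → ℝ} {A B β l : ℝ} (hc : ∀ p, 0 ≤ c p)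
    (hA : HasSum (fun p => c p * male p) A) (hB : HasSum (fun p => c p * female p) B) (n : ℕ)
    (hl : 0 < l) (h1 : β ≤ A) (h2 : β ≤ B) :
    ∑ p ∈ trunc n, rhs c p * quadWeight l p ≤
      (∑ p ∈ trunc n, c p * quadWeight l p) ^ 2 -
        2 * β * ∑ p ∈ trunc n, c p * quadWeight l p := by
  have hX := sum_trunc_rhs_male_le hc hA hB n
  have hY := sum_trunc_rhs_female_le hc hA hB n
  have hZ := sum_trunc_rhs_mixed_le hc hA hB n
  rw [sum_trunc_quadWeight, sum_trunc_quadWeight]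
  have hX0 : 0 ≤ ∑ p ∈ trunc n, c p * (male p ^ 2 - male p) :=
    Finset.sum_nonneg fun p _ => mul_nonneg (hc p) (male_sq_sub_nonneg p)
  have hY0 : 0 ≤ ∑ p ∈ trunc n, c p * (female p ^ 2 - female p) :=
    Finset.sum_nonneg fun p _ => mul_nonneg (hc p) (female_sq_sub_nonneg p)
  have hZ0 : 0 ≤ ∑ p ∈ trunc n, c p * (male p * female p) :=
    Finset.sum_nonneg fun p _ => mul_nonneg (hc p) (mul_nonneg (male_nonneg p) (female_nonneg p))
  generalize (∑ p ∈ trunc n, c p * (male p ^ 2 - male p)) = X at *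
  generalize (∑ p ∈ trunc n, c p * (female p ^ 2 - female p)) = Y at *
  generalize (∑ p ∈ trunc n, c p * (male p * female p)) = Z at *
  have hl' : l * l⁻¹ = 1 := mul_inv_cancel₀ hl.ne'
  have hl0 : 0 < l⁻¹ := inv_pos.2 hl
  have hX' : ∑ p ∈ trunc n, rhs c p * (male p ^ 2 - male p) ≤ 2 * X * (Z - β) :=
    hX.trans (mul_le_mul_of_nonneg_left (by linarith) (by positivity))
  have hY' : ∑ p ∈ trunc n, rhs c p * (female p ^ 2 - female p) ≤ 2 * Y * (Z - β) :=
    hY.trans (mul_le_mul_of_nonneg_left (by linarith) (by positivity))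
  have hZ' : ∑ p ∈ trunc n, rhs c p * (male p * female p) ≤ X * Y + Z * Z - 2 * β * Z := by
    nlinarith [mul_nonneg hZ0 (sub_nonneg.2 h1), mul_nonneg hZ0 (sub_nonneg.2 h2)]
  have e1 := mul_le_mul_of_nonneg_left hX' hl.le
  have e2 := mul_le_mul_of_nonneg_left hY' hl0.le
  have e3 : X * Y = (l * X) * (l⁻¹ * Y) := by
    calc X * Y = (l * l⁻¹) * (X * Y) := by rw [hl', one_mul]
      _ = _ := by ring
  nlinarith [sq_nonneg (l * X - l⁻¹ * Y)]

/-- The left side equals `2 (a + b) + (a² - a) + (b² - b) + 2ab`, and `quadWeight` controls each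
quadratic term up to a factor depending on `l`. -/
lemma sq_le_of_quadWeight {l : ℝ} (hl : 0 < l) (p : PType) :
    (male p + female p) * (1 + male p + female p) ≤
      2 * (male p + female p) + 2 * (1 + l⁻¹ + l) * quadWeight l p := by
  have hX := male_sq_sub_nonneg p
  have hY := female_sq_sub_nonneg p
  have h1 := male_nonneg p
  have h2 := female_nonneg p
  have hl0 : 0 < l⁻¹ := inv_pos.2 hl
  have hl' : l * l⁻¹ = 1 := mul_inv_cancel₀ hl.ne'
  unfold quadWeight
  have e1 : male p ^ 2 - male p = l⁻¹ * (l * (male p ^ 2 - male p)) := by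
    rw [← mul_assoc, mul_comm l⁻¹, hl', one_mul]
  have e2 : female p ^ 2 - female p = l * (l⁻¹ * (female p ^ 2 - female p)) := by
    rw [← mul_assoc, hl', one_mul]
  have hX' := mul_nonneg hl.le hX
  have hY' := mul_nonneg hl0.le hY
  have hZ := mul_nonneg h1 h2
  generalize l * (male p ^ 2 - male p) = x at *
  generalize l⁻¹ * (female p ^ 2 - female p) = y at *
  have e4 := mul_nonneg hl0.le hY'
  have e5 := mul_nonneg hl.le hX'
  have e6 := mul_nonneg hl0.le hZ
  have e7 := mul_nonneg hl.le hZ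
  nlinarith

end

/-! ### Positivity, a priori bounds and the Riccati comparison -/

section

/-- After the last time `t₀` at which `φ` is nonnegative, `log (-φ)` has derivative at most `|L|`.
Since `L` is integrable, `-φ` cannot grow from a limit at most 0 at `t₀` to a positive value.
Working with the logarithm requires only integrability of `L`, not continuity. -/
lemma nonneg_of_hasDerivWithinAt {φ G L : ℝ → ℝ} (h0 : 0 ≤ φ 0)
    (hφ : ∀ t, 0 ≤ t → HasDerivWithinAt φ (G t - φ t * L t) (Ici 0) t)
    (hG : ∀ t, 0 ≤ t → 0 ≤ G t) (hL : ∀ t, 0 ≤ t → IntervalIntegrable L volume 0 t)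
    {t : ℝ} (ht : 0 ≤ t) : 0 ≤ φ t := by
  by_contra! hneg
  have hcont : ContinuousOn φ (Ici 0) := fun s hs => (hφ s hs).continuousWithinAt
  have hcont' : ContinuousOn φ (Icc 0 t) := hcont.mono Icc_subset_Ici_self
  have hclosed : IsClosed (Icc 0 t ∩ φ ⁻¹' Ici 0) :=
    hcont'.preimage_isClosed_of_isClosed isClosed_Icc isClosed_Ici
  have hcomp : IsCompact (Icc 0 t ∩ φ ⁻¹' Ici 0) :=
    isCompact_Icc.of_isClosed_subset hclosed inter_subset_left
  obtain ⟨t₀, ⟨⟨ht0, ht1⟩, hφ0⟩, hmax⟩ := hcomp.exists_isGreatest ⟨0, ⟨⟨le_rfl, ht⟩, h0⟩⟩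
  have hφ0 : 0 ≤ φ t₀ := hφ0
  have hlt : t₀ < t := lt_of_le_of_ne ht1 fun h => by rw [h] at hφ0; linarith
  have hneg' : ∀ s ∈ Ioc t₀ t, φ s < 0 := fun s hs => by
    by_contra! h
    exact absurd (hmax ⟨⟨ht0.trans hs.1.le, hs.2⟩, h⟩) (not_le.2 hs.1)
  set K := ∫ s in (0 : ℝ)..t, |L s| with hK
  have hLt := hL t ht
  have key : ∀ s ∈ Ioo t₀ t, -φ t ≤ Real.exp K * (-φ s) := by
    intro s hs
    have hs0 : 0 ≤ s := ht0.trans hs.1.le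
    have hsub : Icc s t ⊆ Icc 0 t := Icc_subset_Icc_left hs0
    have hLs : IntervalIntegrable L volume s t :=
      hLt.mono_set (by rw [uIcc_of_le hs.2.le, uIcc_of_le ht]; exact hsub)
    have h1 := intervalIntegral.sub_le_integral_of_hasDeriv_right_of_le (a := s) (b := t)
      (g := fun s => Real.log (-φ s)) (g' := fun r => -(G r - φ r * L r) / (-φ r))
      (φ := fun r => |L r|) hs.2.le
      (ContinuousOn.log (hcont'.mono hsub).neg fun r hr =>
        (neg_pos.2 (hneg' r ⟨hs.1.trans_le hr.1, hr.2⟩)).ne')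
      (fun r hr => by
        have := hneg' r ⟨hs.1.trans hr.1, hr.2.le⟩
        exact (((hφ r (hs0.trans hr.1.le)).mono fun x hx =>
          (hs0.trans (hr.1.trans hx).le)).neg).log (neg_pos.2 this).ne')
      ((intervalIntegrable_iff_integrableOn_Icc_of_le hs.2.le).1 hLs.abs)
      (fun r hr => by
        have := hneg' r ⟨hs.1.trans hr.1, hr.2.le⟩
        have hg := hG r (hs0.trans hr.1.le)
        rw [div_le_iff₀ (neg_pos.2 this)]
        nlinarith [neg_abs_le (L r), le_abs_self (L r)])
    have h2 : ∫ r in s..t, |L r| ≤ K := by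
      rw [hK]
      refine intervalIntegral.integral_mono_interval hs0 hs.2.le le_rfl
        (Eventually.of_forall fun r => abs_nonneg _) hLt.abs
    have h3 : Real.log (-φ t) ≤ K + Real.log (-φ s) := by linarith
    have hp : 0 < -φ s := neg_pos.2 (hneg' s ⟨hs.1, hs.2.le⟩)
    have hp' : 0 < -φ t := neg_pos.2 hneg
    calc -φ t = Real.exp (Real.log (-φ t)) := (Real.exp_log hp').symm
      _ ≤ Real.exp (K + Real.log (-φ s)) := Real.exp_le_exp.2 h3
      _ = _ := by rw [Real.exp_add, Real.exp_log hp]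
  have htend : Tendsto (fun s => Real.exp K * (-φ s)) (𝓝[>] t₀) (𝓝 (Real.exp K * (-φ t₀))) :=
    (((hcont t₀ ht0).mono fun x hx => ht0.trans (le_of_lt hx)).neg.tendsto).const_mul _
  have hge := ge_of_tendsto htend
    (by filter_upwards [Ioo_mem_nhdsGT hlt] with s hs using key s hs)
  nlinarith [Real.exp_pos K]

section

variable {c : ℝ → PType → ℝ}

/-- The concentration of male arms. -/
noncomputable def maleSum (c : ℝ → PType → ℝ) (t : ℝ) : ℝ := bracket (c t) male

/-- The concentration of female arms. -/
noncomputable def femaleSum (c : ℝ → PType → ℝ) (t : ℝ) : ℝ := bracket (c t) female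

lemma IsSolution.hasSum_male (hc : IsSolution ⊤ c) {t : ℝ} (ht : 0 ≤ t) :
    HasSum (fun p => c t p * male p) (maleSum c t) :=
  (Summable.of_norm_bounded (hc.summable_arms t ht (EReal.coe_lt_top t)) fun p => by
    rw [norm_mul, Real.norm_eq_abs, Real.norm_of_nonneg (male_nonneg p)]
    exact mul_le_mul_of_nonneg_left (by linarith [female_nonneg p]) (abs_nonneg _)).hasSum

lemma IsSolution.hasSum_female (hc : IsSolution ⊤ c) {t : ℝ} (ht : 0 ≤ t) :
    HasSum (fun p => c t p * female p) (femaleSum c t) :=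
  (Summable.of_norm_bounded (hc.summable_arms t ht (EReal.coe_lt_top t)) fun p => by
    rw [norm_mul, Real.norm_eq_abs, Real.norm_of_nonneg (female_nonneg p)]
    exact mul_le_mul_of_nonneg_left (by linarith [male_nonneg p]) (abs_nonneg _)).hasSum

lemma IsSolution.hasDeriv (hc : IsSolution ⊤ c) {t : ℝ} (ht : 0 ≤ t) (p : PType) :
    HasDerivWithinAt (fun s => c s p) (rhs (c t) p) (Ici 0) t :=
  hc.deriv_eq t ht (EReal.coe_lt_top t) p

lemma IsSolution.intervalIntegrable_loss_rate (hc : IsSolution ⊤ c) {t : ℝ} (ht : 0 ≤ t)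
    (p : PType) : IntervalIntegrable
      (fun s => maleSum c s * female p + male p * femaleSum c s) volume 0 t :=
  ((hc.integrable_male t ht (EReal.coe_lt_top t)).mul_const _).add
    ((hc.integrable_female t ht (EReal.coe_lt_top t)).const_mul _)

/-- Induction on the mass: the gain term at `p` involves only strictly lighter particles, so it is
already known to be nonnegative. -/
lemma IsSolution.nonneg (hc : IsSolution ⊤ c) (h0 : IsInitial (c 0)) {t : ℝ} (ht : 0 ≤ t)
    (p : PType) : 0 ≤ c t p := by
  suffices ∀ n : ℕ, ∀ p : PType, (p.2.2 : ℕ) ≤ n → ∀ t, 0 ≤ t → 0 ≤ c t p from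
    this _ p le_rfl t ht
  intro n
  induction n with
  | zero => intro p hp; exact absurd hp (not_le.2 p.2.2.pos)
  | succ n ih =>
    intro p hp t ht
    refine nonneg_of_hasDerivWithinAt (φ := fun s => c s p) (G := fun s => gain (c s) p)
      (h0.nonneg p) (fun s hs => ?_) (fun s hs => ?_)
      (fun s hs => hc.intervalIntegrable_loss_rate hs p) ht
    · rw [← rhs_eq (hc.hasSum_male hs) (hc.hasSum_female hs)]
      exact hc.hasDeriv hs p
    · refine mul_nonneg (by norm_num) (Finset.sum_nonneg fun q hq => ?_)
      have hlt := (mem_below.1 hq).2.2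
      have hm := congrArg (fun p : PType => (p.2.2 : ℕ)) (merge_diff hq)
      simp only [merge, PNat.add_coe] at hm
      have := (diff p q).2.2.pos
      have := q.2.2.pos
      exact mul_nonneg (mul_nonneg (rate_nonneg _ _) (ih q (by omega) s hs))
        (ih _ (by omega) s hs)

lemma IsSolution.hasDeriv_trunc (hc : IsSolution ⊤ c) {t : ℝ} (ht : 0 ≤ t) (n : ℕ)
    (f : PType → ℝ) : HasDerivWithinAt (fun s => ∑ p ∈ trunc n, c s p * f p)
      (∑ p ∈ trunc n, rhs (c t) p * f p) (Ici 0) t :=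
  HasDerivWithinAt.fun_sum fun p _ => (hc.hasDeriv ht p).mul_const _

lemma monotoneOn_of_hasDerivWithinAt {φ φ' : ℝ → ℝ} {a b : ℝ}
    (hφ : ∀ t ∈ Icc a b, HasDerivWithinAt φ (φ' t) (Icc a b) t)
    (h : ∀ t ∈ Icc a b, 0 ≤ φ' t) : MonotoneOn φ (Icc a b) := by
  refine monotoneOn_of_hasDerivWithinAt_nonneg (convex_Icc a b) (f' := φ')
    (fun t ht => (hφ t ht).continuousWithinAt) (fun t ht => ?_) fun t ht => ?_
  · exact (hφ t (interior_subset ht)).mono interior_subset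
  · exact h t (interior_subset ht)

/-- This monotonicity, used with `f = 1, a, b`, yields the bounds on total and arm concentrations
before any second moment is available. -/
lemma IsSolution.sum_trunc_le (hc : IsSolution ⊤ c) (h0 : IsInitial (c 0)) {t : ℝ} (ht : 0 ≤ t)
    (n : ℕ) {f : PType → ℝ} (hf : ∀ p, 0 ≤ f p)
    (h : ∀ p q : PType, 1 ≤ p.1 → 1 ≤ q.2.1 → f (merge p q) ≤ f p + f q) :
    ∑ p ∈ trunc n, c t p * f p ≤ ∑ p ∈ trunc n, c 0 p * f p := by
  have := monotoneOn_of_hasDerivWithinAt (a := 0) (b := t)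
    (φ := fun s => -∑ p ∈ trunc n, c s p * f p)
    (fun s hs => ((hc.hasDeriv_trunc hs.1 n f).mono Icc_subset_Ici_self).neg)
    (fun s hs => neg_nonneg.2 (sum_trunc_rhs_nonpos (fun p => hc.nonneg h0 hs.1 p)
      (hc.hasSum_male hs.1) (hc.hasSum_female hs.1) n hf h))
    ⟨le_rfl, ht⟩ ⟨ht, le_rfl⟩ ht
  simpa using this

lemma IsSolution.summable_of_subadditive (hc : IsSolution ⊤ c) (h0 : IsInitial (c 0)) {t : ℝ}
    (ht : 0 ≤ t) {f : PType → ℝ} (hf : ∀ p, 0 ≤ f p)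
    (h : ∀ p q : PType, 1 ≤ p.1 → 1 ≤ q.2.1 → f (merge p q) ≤ f p + f q) {S : ℝ}
    (hS : HasSum (fun p => c 0 p * f p) S) :
    (Summable fun p => c t p * f p) ∧ ∑' p, c t p * f p ≤ S :=
  summable_of_sum_trunc_le (fun p => mul_nonneg (hc.nonneg h0 ht p) (hf p)) fun n =>
    (hc.sum_trunc_le h0 ht n hf h).trans
      (sum_le_hasSum _ (fun p _ => mul_nonneg (h0.nonneg p) (hf p)) hS)

lemma IsSolution.maleSum_le_one (hc : IsSolution ⊤ c) (h0 : IsInitial (c 0)) {t : ℝ}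
    (ht : 0 ≤ t) : maleSum c t ≤ 1 :=
  (hc.summable_of_subadditive h0 ht male_nonneg
    (fun p q hp _ => by rw [male_merge hp]; linarith) h0.male_one).2

lemma IsSolution.femaleSum_le_one (hc : IsSolution ⊤ c) (h0 : IsInitial (c 0)) {t : ℝ}
    (ht : 0 ≤ t) : femaleSum c t ≤ 1 :=
  (hc.summable_of_subadditive h0 ht female_nonneg
    (fun p q _ hq => by rw [female_merge hq]; linarith) h0.female_one).2

lemma IsSolution.maleSum_nonneg (hc : IsSolution ⊤ c) (h0 : IsInitial (c 0)) {t : ℝ}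
    (ht : 0 ≤ t) : 0 ≤ maleSum c t :=
  (hc.hasSum_male ht).nonneg fun p => mul_nonneg (hc.nonneg h0 ht p) (male_nonneg p)

lemma IsSolution.femaleSum_nonneg (hc : IsSolution ⊤ c) (h0 : IsInitial (c 0)) {t : ℝ}
    (ht : 0 ≤ t) : 0 ≤ femaleSum c t :=
  (hc.hasSum_female ht).nonneg fun p => mul_nonneg (hc.nonneg h0 ht p) (female_nonneg p)

lemma IsSolution.summable (hc : IsSolution ⊤ c) (h0 : IsInitial (c 0)) {t : ℝ} (ht : 0 ≤ t) :
    Summable (c t) ∧ ∑' p, c t p ≤ ∑' p, c 0 p := by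
  simpa using hc.summable_of_subadditive h0 ht (f := fun _ => 1) (fun _ => zero_le_one)
    (fun _ _ _ _ => by norm_num) (by simpa using h0.summable.hasSum)

end

/-- Comparison principle for the differential inequality `w' ≤ w² ρ'`. -/
lemma inv_add_le_of_riccati {w w' ρ ρ' : ℝ → ℝ} {a b δ : ℝ} (hδ : 0 < δ)
    (hw0 : ∀ t ∈ Icc a b, 0 ≤ w t)
    (hw : ∀ t ∈ Icc a b, HasDerivWithinAt w (w' t) (Icc a b) t)
    (hρ : ∀ t ∈ Icc a b, HasDerivWithinAt ρ (ρ' t) (Icc a b) t)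
    (hρ0 : ∀ t ∈ Icc a b, 0 ≤ ρ' t)
    (h : ∀ t ∈ Icc a b, w' t ≤ w t ^ 2 * ρ' t) {t : ℝ} (ht : t ∈ Icc a b) :
    (w a + δ)⁻¹ + ρ a ≤ (w t + δ)⁻¹ + ρ t := by
  have hpos : ∀ t ∈ Icc a b, 0 < w t + δ := fun t ht => by linarith [hw0 t ht]
  -- The shift by `δ` keeps the inverse regular where `w` vanishes; it costs nothing because `w² ≤
  -- (w + δ)²`.
  refine monotoneOn_of_hasDerivWithinAt (φ := fun t => (w t + δ)⁻¹ + ρ t)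
    (fun t ht => (((hw t ht).add_const δ).fun_inv (hpos t ht).ne').add (hρ t ht))
    (fun t ht => ?_) ⟨le_rfl, ht.1.trans ht.2⟩ ht ht.1
  have h1 := hpos t ht
  have h2 := hw0 t ht
  have h3 := hρ0 t ht
  have : w' t / (w t + δ) ^ 2 ≤ ρ' t := by
    rw [div_le_iff₀ (by positivity)]
    nlinarith [h t ht, mul_nonneg h2 h3, mul_nonneg (mul_nonneg h2 h3) hδ.le, mul_nonneg h3 (sq_nonneg δ)]
  rw [neg_div]
  linarith

end

/-! ### Time-integrated weak form under a second moment bound -/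

section

/-- The total number of arms. -/
def arms (p : PType) : ℝ := male p + female p

lemma arms_nonneg (p : PType) : 0 ≤ arms p := add_nonneg (male_nonneg p) (female_nonneg p)

/-- Summability of the three series behind the weak form, for `f` of at most linear growth. -/
lemma exists_hasSum_weak {c f : PType → ℝ} {A B C K : ℝ} (hc : ∀ p, 0 ≤ c p)
    (hA : HasSum (fun p => c p * male p) A) (hB : HasSum (fun p => c p * female p) B)
    (hA1 : A ≤ 1) (hB1 : B ≤ 1) (hK : Summable fun p => c p * (arms p * (1 + arms p)))
    (hK' : ∑' p, c p * (arms p * (1 + arms p)) ≤ K) (hC : 0 ≤ C)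
    (hf : ∀ p, |f p| ≤ C * (1 + arms p)) :
    ∃ S F G, HasSum (fun x : PType × PType => pairWeight c x * |f (merge x.1 x.2)|) S ∧
      HasSum (fun p => c p * male p * |f p|) F ∧ HasSum (fun p => c p * female p * |f p|) G ∧
      S + (A * G + F * B) ≤ 4 * C * K := by
  have hA0 : 0 ≤ A := hA.nonneg fun p => mul_nonneg (hc p) (male_nonneg p)
  have hB0 : 0 ≤ B := hB.nonneg fun p => mul_nonneg (hc p) (female_nonneg p)
  have bound : ∀ g : PType → ℝ, (∀ p, 0 ≤ g p) → (∀ p, g p ≤ arms p) →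
      ∃ F, HasSum (fun p => c p * g p * (C * (1 + arms p))) F ∧ F ≤ C * K ∧
        ∀ p, c p * g p * |f p| ≤ c p * g p * (C * (1 + arms p)) := by
    intro g hg hga
    have hle : ∀ p, c p * g p * (C * (1 + arms p)) ≤ C * (c p * (arms p * (1 + arms p))) := by
      intro p
      have := arms_nonneg p
      have h1 := mul_le_mul_of_nonneg_right (hga p) (by linarith : 0 ≤ 1 + arms p)
      nlinarith [mul_le_mul_of_nonneg_left h1 (mul_nonneg hC (hc p))]
    have h0 : ∀ p, 0 ≤ c p * g p * (C * (1 + arms p)) := fun p =>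
      mul_nonneg (mul_nonneg (hc p) (hg p)) (mul_nonneg hC (by linarith [arms_nonneg p]))
    have hs := Summable.of_nonneg_of_le h0 hle (hK.mul_left C)
    refine ⟨_, hs.hasSum, ?_, fun p => mul_le_mul_of_nonneg_left (hf p) (mul_nonneg (hc p) (hg p))⟩
    refine (hs.tsum_le_tsum hle (hK.mul_left C)).trans ?_
    rw [tsum_mul_left]
    exact mul_le_mul_of_nonneg_left hK' hC
  obtain ⟨F, hF, hFK, hFle⟩ := bound male male_nonneg fun p => by
    simp [arms, female_nonneg]
  obtain ⟨G, hG, hGK, hGle⟩ := bound female female_nonneg fun p => by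
    simp [arms, male_nonneg]
  have hF0 : ∀ p, 0 ≤ c p * male p * |f p| := fun p =>
    mul_nonneg (mul_nonneg (hc p) (male_nonneg p)) (abs_nonneg _)
  have hG0 : ∀ p, 0 ≤ c p * female p * |f p| := fun p =>
    mul_nonneg (mul_nonneg (hc p) (female_nonneg p)) (abs_nonneg _)
  have sF := Summable.of_nonneg_of_le hF0 hFle hF.summable
  have sG := Summable.of_nonneg_of_le hG0 hGle hG.summable
  have hFF := hasSum_le hFle sF.hasSum hF
  have hGG := hasSum_le hGle sG.hasSum hG
  have hp := (hasSum_pair hF hB).add (hasSum_pair hA hG)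
  have hle : ∀ x : PType × PType, pairWeight c x * |f (merge x.1 x.2)| ≤
      c x.1 * male x.1 * (C * (1 + arms x.1)) * (c x.2 * female x.2) +
        c x.1 * male x.1 * (c x.2 * female x.2 * (C * (1 + arms x.2))) := by
    intro x
    by_cases h1 : 1 ≤ x.1.1
    · by_cases h2 : 1 ≤ x.2.2.1
      · have : |f (merge x.1 x.2)| ≤ C * (1 + arms x.1) + C * (1 + arms x.2) := by
          refine (hf _).trans ?_
          rw [← mul_add]
          refine mul_le_mul_of_nonneg_left ?_ hC
          simp only [arms, male_merge h1, female_merge h2]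
          linarith
        refine (mul_le_mul_of_nonneg_left this (pairWeight_nonneg hc x)).trans (le_of_eq ?_)
        simp only [pairWeight]; ring
      · have : female x.2 = 0 := by simp [female]; omega
        simp [pairWeight, this]
    · have : male x.1 = 0 := by simp [male]; omega
      simp [pairWeight, this]
  have sS := Summable.of_nonneg_of_le
    (fun x => mul_nonneg (pairWeight_nonneg hc x) (abs_nonneg _)) hle hp.summable
  have hSS := hasSum_le hle sS.hasSum hp
  have hF00 := sF.hasSum.nonneg hF0
  have hG00 := sG.hasSum.nonneg hG0
  refine ⟨_, _, _, sS.hasSum, sF.hasSum, sG.hasSum, ?_⟩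
  nlinarith

lemma tsum_mul_rhs {c f : PType → ℝ} {A B C : ℝ} (hc : ∀ p, 0 ≤ c p)
    (hA : HasSum (fun p => c p * male p) A) (hB : HasSum (fun p => c p * female p) B)
    (hA1 : A ≤ 1) (hB1 : B ≤ 1) (hK : Summable fun p => c p * (arms p * (1 + arms p)))
    (hC : 0 ≤ C) (hf : ∀ p, |f p| ≤ C * (1 + arms p)) :
    (Summable fun p => f p * rhs c p) ∧ ∑' p, f p * rhs c p =
      ∑' x : PType × PType, pairWeight c x * (f (merge x.1 x.2) - f x.1 - f x.2) := by
  obtain ⟨S, F, G, hS, hF, hG, -⟩ := exists_hasSum_weak hc hA hB hA1 hB1 hK le_rfl hC hf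
  have hS' : Summable fun x : PType × PType => pairWeight c x * f (merge x.1 x.2) :=
    Summable.of_norm_bounded hS.summable fun x => by
      rw [norm_mul, Real.norm_of_nonneg (pairWeight_nonneg hc x), Real.norm_eq_abs]
  have hF' : Summable fun p => c p * male p * f p :=
    Summable.of_norm_bounded hF.summable fun p => by
      rw [norm_mul, Real.norm_of_nonneg (mul_nonneg (hc p) (male_nonneg p)), Real.norm_eq_abs]
  have hG' : Summable fun p => c p * female p * f p :=
    Summable.of_norm_bounded hG.summable fun p => by
      rw [norm_mul, Real.norm_of_nonneg (mul_nonneg (hc p) (female_nonneg p)), Real.norm_eq_abs]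
  have h1 := hasSum_mul_rhs hA hB hS'.hasSum hF'.hasSum hG'.hasSum
  have h2 := hasSum_pair_weak hA hB hS'.hasSum hF'.hasSum hG'.hasSum
  exact ⟨h1.summable, by rw [h1.tsum_eq, h2.tsum_eq]⟩

variable {c : ℝ → PType → ℝ}

lemma IsSolution.continuousOn (hc : IsSolution ⊤ c) (p : PType) :
    ContinuousOn (fun s => c s p) (Ici 0) := fun _ hs => (hc.hasDeriv hs p).continuousWithinAt

/-- The gain is a finite sum of continuous functions; the loss is a continuous function times a rate
that is integrable by assumption. -/
lemma IsSolution.intervalIntegrable_rhs (hc : IsSolution ⊤ c) (p : PType) {t : ℝ} (ht : 0 ≤ t) :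
    IntervalIntegrable (fun s => rhs (c s) p) volume 0 t := by
  have hsub : uIcc 0 t ⊆ Ici 0 := by rw [uIcc_of_le ht]; exact Icc_subset_Ici_self
  have hg : ContinuousOn (fun s => gain (c s) p) (uIcc 0 t) :=
    (continuousOn_const.mul (continuousOn_finsetSum _ fun q _ =>
      (continuousOn_const.mul (hc.continuousOn q)).mul (hc.continuousOn _))).mono hsub
  refine (hg.intervalIntegrable.sub ((hc.intervalIntegrable_loss_rate ht p).continuousOn_mul
    ((hc.continuousOn p).mono hsub))).congr fun s hs => ?_
  rw [uIoc_of_le ht] at hs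
  exact (rhs_eq (hc.hasSum_male hs.1.le) (hc.hasSum_female hs.1.le) p).symm

lemma IsSolution.integral_rhs (hc : IsSolution ⊤ c) (p : PType) {t : ℝ} (ht : 0 ≤ t) :
    ∫ s in (0 : ℝ)..t, rhs (c s) p = c t p - c 0 p :=
  intervalIntegral.integral_eq_sub_of_hasDerivAt_of_le ht
    ((hc.continuousOn p).mono Icc_subset_Ici_self)
    (fun _ hs => (hc.hasDeriv hs.1.le p).hasDerivAt (Ici_mem_nhds hs.1))
    (hc.intervalIntegrable_rhs p ht)

/-- The second moments of `c` are bounded by `K` on `[0, T]`. -/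
def MomentBound (c : ℝ → PType → ℝ) (T K : ℝ) : Prop := ∀ t ∈ Icc 0 T,
  (Summable fun p => c t p * (arms p * (1 + arms p))) ∧ ∑' p, c t p * (arms p * (1 + arms p)) ≤ K

lemma IsSolution.summable_mul (hc : IsSolution ⊤ c) (h0 : IsInitial (c 0)) {f : PType → ℝ} {C : ℝ}
    (hf : ∀ p, |f p| ≤ C * (1 + arms p)) {t : ℝ} (ht : 0 ≤ t) :
    Summable fun p => c t p * f p := by
  refine Summable.of_norm_bounded (g := fun p => C * (c t p + (c t p * male p + c t p * female p)))
    (((hc.summable h0 ht).1.add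
      ((hc.hasSum_male ht).summable.add (hc.hasSum_female ht).summable)).mul_left C) fun p => ?_
  rw [norm_mul, Real.norm_of_nonneg (hc.nonneg h0 ht p), Real.norm_eq_abs]
  refine (mul_le_mul_of_nonneg_left (hf p) (hc.nonneg h0 ht p)).trans (le_of_eq ?_)
  simp only [arms]; ring

/-- Weak form of the equation, integrated in time. -/
lemma IsSolution.integral_weak (hc : IsSolution ⊤ c) (h0 : IsInitial (c 0)) {T K C : ℝ}
    (hK : MomentBound c T K) (hC : 0 ≤ C) {f : PType → ℝ} (hf : ∀ p, |f p| ≤ C * (1 + arms p))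
    {t : ℝ} (ht : t ∈ Icc 0 T) :
    IntervalIntegrable (fun s => ∑' p, f p * rhs (c s) p) volume 0 t ∧
      ∫ s in (0 : ℝ)..t, ∑' p, f p * rhs (c s) p = ∑' p, c t p * f p - ∑' p, c 0 p * f p := by
  have hmem : ∀ s ∈ uIoc 0 t, s ∈ Icc 0 T := fun s hs => by
    rw [uIoc_of_le ht.1] at hs; exact ⟨hs.1.le, hs.2.trans ht.2⟩
  -- A bound uniform in both the finite set and the time: gain and loss contribute `2 C K` each. It
  -- is the dominating constant when integral and series are exchanged.
  have hbound : ∀ u : Finset PType, ∀ s ∈ uIoc 0 t, ‖∑ p ∈ u, f p * rhs (c s) p‖ ≤ 4 * C * K := by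
    intro u s hs
    have hs := hmem s hs
    have hn := fun p => hc.nonneg h0 hs.1 p
    obtain ⟨S, F, G, hS, hF, hG, hle⟩ := exists_hasSum_weak hn (hc.hasSum_male hs.1)
      (hc.hasSum_female hs.1) (hc.maleSum_le_one h0 hs.1) (hc.femaleSum_le_one h0 hs.1)
      (hK s hs).1 (hK s hs).2 hC hf
    exact (norm_sum_le _ _).trans ((sum_abs_mul_rhs_le hn (hc.hasSum_male hs.1)
      (hc.hasSum_female hs.1) hS hF hG u).trans hle)
  have hlim : ∀ s ∈ uIoc 0 t, Tendsto (fun u : Finset PType => ∑ p ∈ u, f p * rhs (c s) p) atTop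
      (𝓝 (∑' p, f p * rhs (c s) p)) := by
    intro s hs
    have hs := hmem s hs
    exact (tsum_mul_rhs (fun p => hc.nonneg h0 hs.1 p) (hc.hasSum_male hs.1)
      (hc.hasSum_female hs.1) (hc.maleSum_le_one h0 hs.1) (hc.femaleSum_le_one h0 hs.1)
      (hK s hs).1 hC hf).1.hasSum
  have hmeas : ∀ u : Finset PType, IntervalIntegrable (fun s => ∑ p ∈ u, f p * rhs (c s) p)
      volume 0 t := fun u => by
    have := IntervalIntegrable.sum u (f := fun p s => f p * rhs (c s) p)
      (fun p _ => (hc.intervalIntegrable_rhs p ht.1).const_mul (f p))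
    exact this.congr fun _ _ => by simp
  have hm : ∀ u : Finset PType, AEStronglyMeasurable (fun s => ∑ p ∈ u, f p * rhs (c s) p)
      (volume.restrict (uIoc 0 t)) := fun u => (intervalIntegrable_iff.1 (hmeas u)).aestronglyMeasurable
  have hm' : AEStronglyMeasurable (fun s => ∑' p, f p * rhs (c s) p)
      (volume.restrict (uIoc 0 t)) :=
    aestronglyMeasurable_of_tendsto_ae atTop hm
      ((ae_restrict_iff' measurableSet_uIoc).2 (Eventually.of_forall hlim))
  refine ⟨?_, ?_⟩
  · rw [intervalIntegrable_iff]
    refine IntegrableOn.of_bound (by simp [uIoc_of_le ht.1]) hm' (4 * C * K)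
      ((ae_restrict_iff' measurableSet_uIoc).2 (Eventually.of_forall fun s hs => ?_))
    exact le_of_tendsto (hlim s hs).norm (Eventually.of_forall fun u => hbound u s hs)
  · refine tendsto_nhds_unique
      (intervalIntegral.tendsto_integral_filter_of_dominated_convergence (fun _ => 4 * C * K)
        (Eventually.of_forall hm)
        (Eventually.of_forall fun u => Eventually.of_forall fun s hs => hbound u s hs)
        intervalIntegrable_const (Eventually.of_forall hlim)) ?_
    have h1 := ((hc.summable_mul h0 hf ht.1).hasSum.sub (hc.summable_mul h0 hf le_rfl).hasSum)
    refine h1.congr fun u => ?_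
    rw [intervalIntegral.integral_finsetSum
      fun p _ => (hc.intervalIntegrable_rhs p ht.1).const_mul (f p)]
    refine Finset.sum_congr rfl fun p _ => ?_
    rw [intervalIntegral.integral_const_mul, hc.integral_rhs p ht.1]
    ring

lemma IsSolution.continuousOn_tsum (hc : IsSolution ⊤ c) (h0 : IsInitial (c 0)) {T K C : ℝ}
    (hT : 0 ≤ T) (hK : MomentBound c T K) (hC : 0 ≤ C) {f : PType → ℝ}
    (hf : ∀ p, |f p| ≤ C * (1 + arms p)) :
    ContinuousOn (fun t => ∑' p, c t p * f p) (Icc 0 T) := by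
  have h := (hc.integral_weak h0 hK hC hf ⟨hT, le_rfl⟩).1
  have h1 := intervalIntegral.continuousOn_primitive_interval (a := 0) (b := T)
    (f := fun s => ∑' p, f p * rhs (c s) p) (μ := volume)
    (by rw [uIcc_of_le hT]; exact (intervalIntegrable_iff_integrableOn_Icc_of_le hT).1 h)
  rw [uIcc_of_le hT] at h1
  refine (h1.add (continuousOn_const (c := ∑' p, c 0 p * f p))).congr fun t ht => ?_
  rw [Pi.add_apply, (hc.integral_weak h0 hK hC hf ht).2]
  exact (sub_add_cancel _ (∑' p, c 0 p * f p)).symm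

/-- The moment is the primitive of its weak right-hand side, so differentiability follows once this
side is identified with a continuous function of time. Extending it constantly beyond `[0, T]`
covers the endpoints. -/
lemma IsSolution.hasDeriv_tsum (hc : IsSolution ⊤ c) (h0 : IsInitial (c 0)) {T K C : ℝ}
    (hT : 0 ≤ T) (hK : MomentBound c T K) (hC : 0 ≤ C) {f : PType → ℝ}
    (hf : ∀ p, |f p| ≤ C * (1 + arms p)) {Λ : ℝ → ℝ} (hΛ : ContinuousOn Λ (Icc 0 T))
    (h : ∀ t ∈ Icc 0 T, ∑' x : PType × PType,
      pairWeight (c t) x * (f (merge x.1 x.2) - f x.1 - f x.2) = Λ t) {t : ℝ} (ht : t ∈ Icc 0 T) :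
    HasDerivWithinAt (fun t => ∑' p, c t p * f p) (Λ t) (Icc 0 T) t := by
  have hΛ' : ∀ s ∈ Icc 0 T, ∑' p, f p * rhs (c s) p = Λ s := fun s hs => by
    rw [(tsum_mul_rhs (fun p => hc.nonneg h0 hs.1 p) (hc.hasSum_male hs.1)
      (hc.hasSum_female hs.1) (hc.maleSum_le_one h0 hs.1) (hc.femaleSum_le_one h0 hs.1)
      (hK s hs).1 hC hf).2, h s hs]
  have hcont : Continuous (IccExtend hT ((Icc 0 T).domRestrict Λ)) :=
    (continuousOn_iff_continuous_domRestrict.1 hΛ).Icc_extend'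
  have key : ∀ s ∈ Icc 0 T, ∑' p, c s p * f p =
      (∫ r in (0 : ℝ)..s, IccExtend hT ((Icc 0 T).domRestrict Λ) r) + ∑' p, c 0 p * f p := by
    intro s hs
    rw [← sub_eq_iff_eq_add, ← (hc.integral_weak h0 hK hC hf hs).2]
    refine intervalIntegral.integral_congr fun r hr => ?_
    rw [uIcc_of_le hs.1] at hr
    have hr' : r ∈ Icc 0 T := ⟨hr.1, hr.2.trans hs.2⟩
    simp only [IccExtend_of_mem hT _ hr', domRestrict_apply]
    exact hΛ' r hr'
  have hd := ((hcont.integral_hasStrictDerivAt 0 t).hasDerivAt.add_const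
    (∑' p, c 0 p * f p)).hasDerivWithinAt (s := Icc 0 T)
  rw [IccExtend_of_mem hT _ ht, domRestrict_apply] at hd
  exact hd.congr key (key t ht)

end

/-! ### Absence of gelation: exact arm concentrations and second moments -/

section

/-- For positive `X` and `Y` the weight `√Y / √X` equalises both quantities at `√(XY)`. The slack
`ε` is there for the degenerate cases `X = 0` or `Y = 0`, where the ideal weight would be infinite
or zero. -/
lemma exists_balanced_weight {X Y ε : ℝ} (hX : 0 ≤ X) (hY : 0 ≤ Y) (hε : 0 < ε) :
    ∃ l : ℝ, 0 < l ∧ l * X ≤ Real.sqrt (X * Y) + ε ∧ l⁻¹ * Y ≤ Real.sqrt (X * Y) + ε := by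
  rcases hX.eq_or_lt with rfl | hX
  · refine ⟨Y / ε + 1, by positivity, by simp [hε.le], ?_⟩
    rw [zero_mul, Real.sqrt_zero, zero_add, inv_mul_le_iff₀ (by positivity)]
    have : Y / ε * ε = Y := div_mul_cancel₀ _ hε.ne'
    nlinarith
  rcases hY.eq_or_lt with rfl | hY
  · refine ⟨ε / X, by positivity, ?_, by simp [hε.le]⟩
    rw [div_mul_cancel₀ _ hX.ne']
    simp
  have hx := Real.sq_sqrt hX.le
  have hy := Real.sq_sqrt hY.le
  have hx0 := Real.sqrt_pos.2 hX
  have hy0 := Real.sqrt_pos.2 hY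
  refine ⟨Real.sqrt Y / Real.sqrt X, by positivity, ?_, ?_⟩
  · rw [Real.sqrt_mul hX.le, div_mul_eq_mul_div, div_le_iff₀ hx0]
    nlinarith [mul_pos hε hx0]
  · rw [Real.sqrt_mul hX.le, inv_div, div_mul_eq_mul_div, div_le_iff₀ hy0]
    nlinarith [mul_pos hε hy0]

section Initial

variable {c₀ : PType → ℝ}

lemma IsInitial.summable_male_sq (h0 : IsInitial c₀) : Summable fun p => c₀ p * male p ^ 2 :=
  Summable.of_nonneg_of_le (fun p => mul_nonneg (h0.nonneg p) (sq_nonneg _))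
    (fun p => mul_le_mul_of_nonneg_left (by linarith [sq_nonneg (female p)]) (h0.nonneg p))
    h0.summable_sq

lemma IsInitial.summable_female_sq (h0 : IsInitial c₀) : Summable fun p => c₀ p * female p ^ 2 :=
  Summable.of_nonneg_of_le (fun p => mul_nonneg (h0.nonneg p) (sq_nonneg _))
    (fun p => mul_le_mul_of_nonneg_left (by linarith [sq_nonneg (male p)]) (h0.nonneg p))
    h0.summable_sq

lemma IsInitial.summable_mixed (h0 : IsInitial c₀) :
    Summable fun p => c₀ p * (male p * female p) :=
  Summable.of_nonneg_of_le
    (fun p => mul_nonneg (h0.nonneg p) (mul_nonneg (male_nonneg p) (female_nonneg p)))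
    (fun p => mul_le_mul_of_nonneg_left
      (by nlinarith [sq_nonneg (male p - female p), sq_nonneg (male p + female p)]) (h0.nonneg p))
    h0.summable_sq

lemma IsInitial.summable_male_sq_sub (h0 : IsInitial c₀) :
    Summable fun p => c₀ p * (male p ^ 2 - male p) :=
  (h0.summable_male_sq.sub h0.male_one.summable).congr fun p => by ring

lemma IsInitial.summable_female_sq_sub (h0 : IsInitial c₀) :
    Summable fun p => c₀ p * (female p ^ 2 - female p) :=
  (h0.summable_female_sq.sub h0.female_one.summable).congr fun p => by ring

lemma IsInitial.exists_weight (h0 : IsInitial c₀) (hM : critM c₀ ≤ 1) {ε : ℝ} (hε : 0 < ε) :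
    ∃ l : ℝ, 0 < l ∧
      bracket c₀ (fun p => male p * female p) + l * bracket c₀ (fun p => male p ^ 2 - male p)
        ≤ 1 + ε ∧
      bracket c₀ (fun p => male p * female p) + l⁻¹ * bracket c₀ (fun p => female p ^ 2 - female p)
        ≤ 1 + ε := by
  obtain ⟨l, hl, h1, h2⟩ := exists_balanced_weight
    (X := bracket c₀ (fun p => male p ^ 2 - male p))
    (Y := bracket c₀ (fun p => female p ^ 2 - female p))
    (tsum_nonneg fun p => mul_nonneg (h0.nonneg p) (male_sq_sub_nonneg p))
    (tsum_nonneg fun p => mul_nonneg (h0.nonneg p) (female_sq_sub_nonneg p)) hε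
  rw [critM] at hM
  exact ⟨l, hl, by linarith, by linarith⟩

lemma IsInitial.sum_trunc_quadWeight_le (h0 : IsInitial c₀) {l ε : ℝ} (hl : 0 < l)
    (h1 : bracket c₀ (fun p => male p * female p) + l * bracket c₀ (fun p => male p ^ 2 - male p)
      ≤ 1 + ε)
    (h2 : bracket c₀ (fun p => male p * female p) +
      l⁻¹ * bracket c₀ (fun p => female p ^ 2 - female p) ≤ 1 + ε) (n : ℕ) :
    ∑ p ∈ trunc n, c₀ p * quadWeight l p ≤ 1 + ε := by
  have hX : ∑ p ∈ trunc n, c₀ p * (male p ^ 2 - male p) ≤ bracket c₀ fun p => male p ^ 2 - male p :=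
    h0.summable_male_sq_sub.sum_le_tsum _
      fun p _ => mul_nonneg (h0.nonneg p) (male_sq_sub_nonneg p)
  have hY : ∑ p ∈ trunc n, c₀ p * (female p ^ 2 - female p) ≤
      bracket c₀ fun p => female p ^ 2 - female p :=
    h0.summable_female_sq_sub.sum_le_tsum _
      fun p _ => mul_nonneg (h0.nonneg p) (female_sq_sub_nonneg p)
  have hZ : ∑ p ∈ trunc n, c₀ p * (male p * female p) ≤ bracket c₀ fun p => male p * female p :=
    h0.summable_mixed.sum_le_tsum _
      fun p _ => mul_nonneg (h0.nonneg p) (mul_nonneg (male_nonneg p) (female_nonneg p))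
  rw [sum_trunc_quadWeight]
  have := mul_le_mul_of_nonneg_left hX hl.le
  have := mul_le_mul_of_nonneg_left hY (inv_pos.2 hl).le
  linarith

lemma critM_le_one (hT : criticalTime c₀ = ⊤) : critM c₀ ≤ 1 := by
  by_contra h
  rw [criticalTime, if_neg h] at hT
  exact EReal.coe_ne_top _ hT

end Initial

variable {c : ℝ → PType → ℝ}

lemma abs_male_le (p : PType) : |male p| ≤ 1 * (1 + arms p) := by
  rw [abs_of_nonneg (male_nonneg p), arms]
  linarith [female_nonneg p]

lemma abs_female_le (p : PType) : |female p| ≤ 1 * (1 + arms p) := by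
  rw [abs_of_nonneg (female_nonneg p), arms]
  linarith [male_nonneg p]

/-- The square of `(1 + t) A - 1` has derivative `-2 A ((1 + t) A - 1)² ≤ 0` and starts at 0. This
avoids dividing by `A`. -/
lemma eq_inv_of_deriv_eq_neg_sq {A : ℝ → ℝ} {T : ℝ} (h0 : A 0 = 1) (hA : ∀ t ∈ Icc 0 T, 0 ≤ A t)
    (h : ∀ t ∈ Icc 0 T, HasDerivWithinAt A (-(A t * A t)) (Icc 0 T) t) {t : ℝ}
    (ht : t ∈ Icc 0 T) : A t = (1 + t)⁻¹ := by
  have hd : ∀ t ∈ Icc 0 T, HasDerivWithinAt (fun t => ((1 + t) * A t - 1) ^ 2)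
      (2 * ((1 + t) * A t - 1) ^ 1 * (1 * A t + (1 + t) * -(A t * A t))) (Icc 0 T) t :=
    fun t ht => by
      simpa using ((((hasDerivWithinAt_id t _).const_add 1).mul (h t ht)).sub_const 1).fun_pow 2
  have := monotoneOn_of_hasDerivWithinAt (fun t ht => (hd t ht).fun_neg)
    (fun t ht => by nlinarith [mul_nonneg (hA t ht) (sq_nonneg ((1 + t) * A t - 1))])
    ⟨le_rfl, ht.1.trans ht.2⟩ ht ht.1
  simp only [h0] at this
  have h2 : ((1 + t) * A t - 1) ^ 2 = 0 := le_antisymm (by linarith) (sq_nonneg _)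
  have h3 : (1 + t) * A t = 1 := by linarith [pow_eq_zero_iff (two_ne_zero) |>.1 h2]
  exact eq_inv_of_mul_eq_one_right h3

lemma eq_of_hasDerivWithinAt_eq {A B D : ℝ → ℝ} {T : ℝ} (h0 : A 0 = B 0)
    (hA : ∀ t ∈ Icc 0 T, HasDerivWithinAt A (D t) (Icc 0 T) t)
    (hB : ∀ t ∈ Icc 0 T, HasDerivWithinAt B (D t) (Icc 0 T) t) {t : ℝ} (ht : t ∈ Icc 0 T) :
    A t = B t := by
  have h1 := monotoneOn_of_hasDerivWithinAt (fun t ht => (hA t ht).sub (hB t ht))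
    (fun t _ => (sub_self (D t)).ge) ⟨le_rfl, ht.1.trans ht.2⟩ ht ht.1
  have h2 := monotoneOn_of_hasDerivWithinAt (fun t ht => (hB t ht).sub (hA t ht))
    (fun t _ => (sub_self (D t)).ge) ⟨le_rfl, ht.1.trans ht.2⟩ ht ht.1
  simp only [Pi.sub_apply] at h1 h2
  linarith

/-- Every merger destroys one male and one female arm, so both concentrations have derivative `-AB`.
They start equal, hence remain equal, and the equation becomes `A' = -A²`. -/
lemma IsSolution.arms_eq_of_momentBound (hc : IsSolution ⊤ c) (h0 : IsInitial (c 0)) {T K : ℝ}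
    (hK : MomentBound c T K) {t : ℝ} (ht : t ∈ Icc 0 T) :
    maleSum c t = (1 + t)⁻¹ ∧ femaleSum c t = (1 + t)⁻¹ := by
  have hT : 0 ≤ T := ht.1.trans ht.2
  have cA : ContinuousOn (maleSum c) (Icc 0 T) :=
    hc.continuousOn_tsum h0 hT hK zero_le_one abs_male_le
  have cB : ContinuousOn (femaleSum c) (Icc 0 T) :=
    hc.continuousOn_tsum h0 hT hK zero_le_one abs_female_le
  have hpair : ∀ t ∈ Icc 0 T, HasSum (fun x : PType × PType => -pairWeight (c t) x)
      (-(maleSum c t * femaleSum c t)) := fun t ht =>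
    (hasSum_pair (hc.hasSum_male ht.1) (hc.hasSum_female ht.1)).neg
  have dA : ∀ t ∈ Icc 0 T,
      HasDerivWithinAt (maleSum c) (-(maleSum c t * femaleSum c t)) (Icc 0 T) t := fun t ht =>
    hc.hasDeriv_tsum (Λ := fun t => -(maleSum c t * femaleSum c t)) h0 hT hK zero_le_one
      abs_male_le (cA.mul cB).neg (fun t ht => (HasSum.of_eq (hpair t ht) fun x => by
        by_cases h1 : 1 ≤ x.1.1
        · rw [male_merge h1]; ring
        · have : male x.1 = 0 := by simp [male]; omega
          simp [pairWeight, this]).tsum_eq) ht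
  have dB : ∀ t ∈ Icc 0 T,
      HasDerivWithinAt (femaleSum c) (-(maleSum c t * femaleSum c t)) (Icc 0 T) t := fun t ht =>
    hc.hasDeriv_tsum (Λ := fun t => -(maleSum c t * femaleSum c t)) h0 hT hK zero_le_one
      abs_female_le (cA.mul cB).neg (fun t ht => (HasSum.of_eq (hpair t ht) fun x => by
        by_cases h1 : 1 ≤ x.2.2.1
        · rw [female_merge h1]; ring
        · have : female x.2 = 0 := by simp [female]; omega
          simp [pairWeight, this]).tsum_eq) ht
  have hA0 : maleSum c 0 = 1 := h0.male_one.tsum_eq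
  have hB0 : femaleSum c 0 = 1 := h0.female_one.tsum_eq
  have hAB : ∀ t ∈ Icc 0 T, maleSum c t = femaleSum c t := fun t ht =>
    eq_of_hasDerivWithinAt_eq (hA0.trans hB0.symm) dA dB ht
  have hA := eq_inv_of_deriv_eq_neg_sq hA0 (fun t ht => hc.maleSum_nonneg h0 ht.1)
    (fun t ht => by have := dA t ht; rwa [← hAB t ht] at this) ht
  exact ⟨hA, by rw [← hAB t ht, hA]⟩

/-- The 4 is twice the bound 2 on the total number of arms; the rest is `sq_le_of_quadWeight`. A
bound uniform in the truncation becomes a bound on the whole series. -/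
lemma IsSolution.momentBound_of_sum_trunc_le (hc : IsSolution ⊤ c) (h0 : IsInitial (c 0))
    {T N l : ℝ} (hl : 0 < l)
    (h : ∀ t ∈ Icc 0 T, ∀ n, ∑ p ∈ trunc n, c t p * quadWeight l p ≤ N) :
    MomentBound c T (4 + 2 * (1 + l⁻¹ + l) * N) := by
  intro t ht
  have hn := fun p => hc.nonneg h0 ht.1 p
  refine summable_of_sum_trunc_le (fun p => mul_nonneg (hn p)
    (mul_nonneg (arms_nonneg p) (by linarith [arms_nonneg p]))) fun n => ?_
  have h1 : ∑ p ∈ trunc n, c t p * male p ≤ 1 :=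
    (sum_le_hasSum _ (fun p _ => mul_nonneg (hn p) (male_nonneg p)) (hc.hasSum_male ht.1)).trans
      (hc.maleSum_le_one h0 ht.1)
  have h2 : ∑ p ∈ trunc n, c t p * female p ≤ 1 :=
    (sum_le_hasSum _ (fun p _ => mul_nonneg (hn p) (female_nonneg p))
      (hc.hasSum_female ht.1)).trans (hc.femaleSum_le_one h0 ht.1)
  have hl0 : 0 < l⁻¹ := inv_pos.2 hl
  calc ∑ p ∈ trunc n, c t p * (arms p * (1 + arms p))
      ≤ ∑ p ∈ trunc n, (2 * (c t p * male p) + 2 * (c t p * female p) +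
          2 * (1 + l⁻¹ + l) * (c t p * quadWeight l p)) := Finset.sum_le_sum fun p _ => by
        have := mul_le_mul_of_nonneg_left (sq_le_of_quadWeight hl p) (hn p)
        simp only [arms]
        rw [← add_assoc]
        linarith
    _ = 2 * (∑ p ∈ trunc n, c t p * male p) + 2 * (∑ p ∈ trunc n, c t p * female p) +
          2 * (1 + l⁻¹ + l) * ∑ p ∈ trunc n, c t p * quadWeight l p := by
        rw [Finset.sum_add_distrib, Finset.sum_add_distrib, Finset.mul_sum, Finset.mul_sum,
          Finset.mul_sum]
    _ ≤ _ := by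
        have := mul_le_mul_of_nonneg_left (h t ht n) (by positivity : 0 ≤ 2 * (1 + l⁻¹ + l))
        linarith

/-- As long as the number of arms follows its expected decay, the quadratic moment stays bounded. -/
lemma IsSolution.sum_trunc_quadWeight_le_two (hc : IsSolution ⊤ c) (h0 : IsInitial (c 0))
    {T ε l : ℝ} (hl : 0 < l) (hε : 0 < ε) (hεT : 4 * ε * (1 + T) ≤ 1) {n : ℕ}
    (hinit : ∑ p ∈ trunc n, c 0 p * quadWeight l p ≤ 1 + ε)
    (h : ∀ t ∈ Icc 0 T, maleSum c t = (1 + t)⁻¹ ∧ femaleSum c t = (1 + t)⁻¹) {t : ℝ}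
    (ht : t ∈ Icc 0 T) : ∑ p ∈ trunc n, c t p * quadWeight l p ≤ 2 := by
  set μ : ℝ → ℝ := fun t => ∑ p ∈ trunc n, c t p * quadWeight l p with hμ
  have hμ0 : ∀ t ∈ Icc 0 T, 0 ≤ μ t := fun t ht => Finset.sum_nonneg fun p _ =>
    mul_nonneg (hc.nonneg h0 ht.1 p) (quadWeight_nonneg hl p)
  have hder : ∀ t ∈ Icc 0 T, ∑ p ∈ trunc n, rhs (c t) p * quadWeight l p ≤
      μ t ^ 2 - 2 * (1 + t)⁻¹ * μ t := fun t ht =>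
    sum_trunc_rhs_quadWeight_le (fun p => hc.nonneg h0 ht.1 p) (hc.hasSum_male ht.1)
      (hc.hasSum_female ht.1) n hl (h t ht).1.ge (h t ht).2.ge
  -- The factor `(1 + t)²` absorbs the linear term: `w = (1 + t)² μ` satisfies `w' ≤ w² / (1 + t)²`,
  -- and `-1 / (1 + t)` is a primitive of the coefficient.
  have key := inv_add_le_of_riccati (w := fun t => (1 + t) ^ 2 * μ t)
    (w' := fun t => 2 * (1 + t) ^ 1 * 1 * μ t +
      (1 + t) ^ 2 * ∑ p ∈ trunc n, rhs (c t) p * quadWeight l p)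
    (ρ := fun t => -(1 + t)⁻¹) (ρ' := fun t => -(-1 / (1 + t) ^ 2)) (a := 0) (b := T) hε
    (fun t ht => mul_nonneg (sq_nonneg _) (hμ0 t ht))
    (fun t ht => by
      simpa using (((hasDerivWithinAt_id t (Icc 0 T)).const_add 1).fun_pow 2).fun_mul
        ((hc.hasDeriv_trunc ht.1 n (quadWeight l)).mono Icc_subset_Ici_self))
    (fun t ht => (((hasDerivWithinAt_id t (Icc 0 T)).const_add 1).fun_inv
      (by have := ht.1; simp only [id]; positivity)).fun_neg)
    (fun t ht => by rw [neg_div, neg_neg]; positivity)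
    (fun t ht => by
      have h1 : 0 < 1 + t := by linarith [ht.1]
      have h2 := mul_le_mul_of_nonneg_left (hder t ht) (sq_nonneg (1 + t))
      have e1 : (1 + t) ^ 2 * (μ t ^ 2 - 2 * (1 + t)⁻¹ * μ t) =
        (1 + t) ^ 2 * μ t ^ 2 - 2 * (1 + t) * μ t := by field_simp
      have e2 : ((1 + t) ^ 2 * μ t) ^ 2 * -(-1 / (1 + t) ^ 2) = (1 + t) ^ 2 * μ t ^ 2 := by
        field_simp
      rw [e2]
      linarith) ht
  have h1 : 0 < 1 + t := by linarith [ht.1]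
  have h3 : 4 * ε * (1 + t) ≤ 1 := by nlinarith [ht.2]
  have h2 : (1 + 2 * ε)⁻¹ ≤ ((1 + 0) ^ 2 * μ 0 + ε)⁻¹ := by
    have : 0 ≤ μ 0 := hμ0 0 ⟨le_rfl, ht.1.trans ht.2⟩
    exact inv_anti₀ (by positivity) (by simp only [hμ]; linarith)
  have h4 : 1 - 2 * ε ≤ (1 + 2 * ε)⁻¹ := by
    rw [← one_div, le_div_iff₀ (by positivity)]; nlinarith [sq_nonneg ε]
  -- The comparison leaves `1 / (1 + t) - 2 ε` as a lower bound for the inverse; the smallness of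
  -- `ε` relative to `T` preserves half of it, whence `(1 + t) μ ≤ 2`.
  have h5 : 2 * ε ≤ (1 + t)⁻¹ / 2 := by
    rw [← one_div, div_div, le_div_iff₀ (by positivity)]; linarith
  have h6 : (1 + t)⁻¹ / 2 ≤ ((1 + t) ^ 2 * μ t + ε)⁻¹ := by
    simp only [add_zero, inv_one] at key
    simp only [add_zero] at h2
    linarith
  have h7 : (1 + t) ^ 2 * μ t + ε ≤ 2 * (1 + t) := by
    have hp : 0 < (1 + t) ^ 2 * μ t + ε := by have := hμ0 t ht; positivity
    have h8 : (2 * (1 + t))⁻¹ ≤ ((1 + t) ^ 2 * μ t + ε)⁻¹ := by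
      rw [mul_inv]; linarith
    exact (inv_le_inv₀ (by positivity) hp).1 h8
  have h9 : (1 + t) * μ t ≤ 2 := by
    have : (1 + t) * ((1 + t) * μ t) ≤ (1 + t) * 2 := by nlinarith
    exact le_of_mul_le_mul_left this h1
  nlinarith [hμ0 t ht, mul_nonneg ht.1 (hμ0 t ht)]

/-- Crude short-time propagation of the bound on the quadratic moment. -/
lemma IsSolution.sum_trunc_quadWeight_le_of_le_two (hc : IsSolution ⊤ c) (h0 : IsInitial (c 0))
    {s l : ℝ} (hl : 0 < l) (hs : 0 ≤ s) {n : ℕ}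
    (hinit : ∑ p ∈ trunc n, c s p * quadWeight l p ≤ 2) {t : ℝ} (ht : t ∈ Icc s (s + 1 / 4)) :
    ∑ p ∈ trunc n, c t p * quadWeight l p ≤ 11 := by
  set μ : ℝ → ℝ := fun t => ∑ p ∈ trunc n, c t p * quadWeight l p with hμ
  have hμ0 : ∀ t ∈ Icc s (s + 1 / 4), 0 ≤ μ t := fun t ht => Finset.sum_nonneg fun p _ =>
    mul_nonneg (hc.nonneg h0 (hs.trans ht.1) p) (quadWeight_nonneg hl p)
  have key := inv_add_le_of_riccati (w := μ)
    (w' := fun t => ∑ p ∈ trunc n, rhs (c t) p * quadWeight l p)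
    (ρ := fun t => t) (ρ' := fun _ => 1) (a := s) (b := s + 1 / 4) one_pos hμ0
    (fun t ht => (hc.hasDeriv_trunc (hs.trans ht.1) n (quadWeight l)).mono
      fun x hx => hs.trans hx.1)
    (fun t ht => hasDerivWithinAt_id _ _) (fun t ht => zero_le_one)
    (fun t ht => by
      have ht0 := hs.trans ht.1
      have := sum_trunc_rhs_quadWeight_le (β := 0) (fun p => hc.nonneg h0 ht0 p)
        (hc.hasSum_male ht0) (hc.hasSum_female ht0) n hl (hc.maleSum_nonneg h0 ht0)
        (hc.femaleSum_nonneg h0 ht0)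
      simp only [hμ]
      linarith) ht
  -- With `δ = 1` and a time step of at most `1/4`, the inverse stays above `1/3 - 1/4 = 1/12`,
  -- which gives the bound 11.
  have h1 : (3 : ℝ)⁻¹ ≤ (μ s + 1)⁻¹ := by
    have := hμ0 s ⟨le_rfl, by linarith⟩
    exact inv_anti₀ (by positivity) (by simp only [hμ]; linarith)
  have h2 : (12 : ℝ)⁻¹ ≤ (μ t + 1)⁻¹ := by
    have := ht.2
    norm_num at *
    linarith
  have := hμ0 t ht
  have := (inv_le_inv₀ (by norm_num) (by positivity)).1 h2
  linarith

/-- Continuation argument. Exact arm concentrations on an interval bound the quadratic moment by 2.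
The crude estimate extends this to the bound 11 over one more step of length `1/4`, which suffices
to obtain the exact concentrations there and so to restore the bound 2. The step length does not
shrink, so `[0, T]` is exhausted. -/
lemma IsSolution.arms_eq_and_momentBound (hc : IsSolution ⊤ c) (h0 : IsInitial (c 0))
    (hM : critM (c 0) ≤ 1) {T : ℝ} (hT : 0 ≤ T) :
    (maleSum c T = (1 + T)⁻¹ ∧ femaleSum c T = (1 + T)⁻¹) ∧ ∃ K, MomentBound c T K := by
  set ε : ℝ := (4 * (1 + T))⁻¹ with hε
  have hε0 : 0 < ε := by positivity
  have hεT : 4 * ε * (1 + T) = 1 := by rw [hε]; field_simp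
  obtain ⟨l, hl, h1, h2⟩ := h0.exists_weight hM hε0
  have hinit := fun n => h0.sum_trunc_quadWeight_le hl h1 h2 n
  have step : ∀ k : ℕ, ∀ t ∈ Icc (0 : ℝ) (min ((k : ℝ) * (1 / 4)) T),
      maleSum c t = (1 + t)⁻¹ ∧ femaleSum c t = (1 + t)⁻¹ := by
    intro k
    induction k with
    | zero =>
      intro t ht
      have h : t = 0 := le_antisymm (ht.2.trans (by simp [hT])) ht.1
      subst h
      rw [add_zero, inv_one]
      exact ⟨h0.male_one.tsum_eq, h0.female_one.tsum_eq⟩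
    | succ k ih =>
      set s : ℝ := min (k * (1 / 4)) T with hs
      have hs0 : 0 ≤ s := le_min (by positivity) hT
      have hsT : s ≤ T := min_le_right _ _
      have hb : ∀ t ∈ Icc 0 s, ∀ n, ∑ p ∈ trunc n, c t p * quadWeight l p ≤ 2 := fun t ht n =>
        hc.sum_trunc_quadWeight_le_two h0 hl hε0 (by nlinarith) (hinit n) ih ht
      have hb' : ∀ t ∈ Icc (0 : ℝ) (min (((k + 1 : ℕ) : ℝ) * (1 / 4)) T), ∀ n,
          ∑ p ∈ trunc n, c t p * quadWeight l p ≤ 11 := by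
        intro t ht n
        rcases le_total t s with hts | hts
        · linarith [hb t ⟨ht.1, hts⟩ n]
        · refine hc.sum_trunc_quadWeight_le_of_le_two h0 hl hs0 (hb s ⟨hs0, le_rfl⟩ n) ⟨hts, ?_⟩
          rw [hs]
          rcases le_total ((k : ℝ) * (1 / 4)) T with h | h
          · rw [min_eq_left h]
            refine ht.2.trans ((min_le_left _ _).trans ?_)
            push_cast
            linarith
          · rw [min_eq_right h]
            linarith [ht.2.trans (min_le_right _ _)]
      exact fun t ht => hc.arms_eq_of_momentBound h0 (hc.momentBound_of_sum_trunc_le h0 hl hb') ht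
  obtain ⟨k, hk⟩ := exists_nat_ge (4 * T)
  have hall : ∀ t ∈ Icc 0 T, maleSum c t = (1 + t)⁻¹ ∧ femaleSum c t = (1 + t)⁻¹ :=
    fun t ht => step k t ⟨ht.1, le_min (by linarith [ht.2]) ht.2⟩
  exact ⟨hall T ⟨hT, le_rfl⟩, _, hc.momentBound_of_sum_trunc_le h0 hl fun t ht n =>
    hc.sum_trunc_quadWeight_le_two h0 hl hε0 hεT.le (hinit n) hall ht⟩

end

/-! ### Convergence in ℓ¹ to the armless state -/

section

/-- The particles of mass `m` without arms. -/
def bare (m : ℕ+) : PType := (0, 0, m)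

lemma bare_injective : Function.Injective bare := fun _ _ h => (Prod.ext_iff.1 (Prod.ext_iff.1 h).2).2

lemma armless_bare (u : ℕ+ → ℝ) (m : ℕ+) : armless u (bare m) = u m := by simp [armless, bare]

lemma eq_bare {p : PType} (h : p.1 = 0 ∧ p.2.1 = 0) : p = bare p.2.2 :=
  Prod.ext h.1 (Prod.ext h.2 rfl)

lemma armless_of_notMem_range (u : ℕ+ → ℝ) {p : PType} (hp : p ∉ range bare) :
    armless u p = 0 := by
  rw [armless, if_neg fun h => hp ⟨p.2.2, (eq_bare h).symm⟩]

lemma summable_armless {u : ℕ+ → ℝ} (hu : Summable u) : Summable (armless u) := by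
  rw [← bare_injective.summable_iff fun p hp => armless_of_notMem_range u hp]
  exact hu.congr fun m => (armless_bare u m).symm

variable {c : ℝ → PType → ℝ}

/-- A particle without arms has zero loss rate, so only the nonnegative gain term remains. -/
lemma IsSolution.bare_mono (hc : IsSolution ⊤ c) (h0 : IsInitial (c 0)) (m : ℕ+) {s t : ℝ}
    (hs : 0 ≤ s) (hst : s ≤ t) : c s (bare m) ≤ c t (bare m) := by
  refine monotoneOn_of_hasDerivWithinAt (a := s) (b := t) (φ := fun s => c s (bare m))
    (fun r hr => (hc.hasDeriv (hs.trans hr.1) _).mono fun x hx => hs.trans hx.1)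
    (fun r hr => ?_) ⟨le_rfl, hst⟩ ⟨hst, le_rfl⟩ hst
  have hr0 := hs.trans hr.1
  rw [rhs_eq (hc.hasSum_male hr0) (hc.hasSum_female hr0)]
  simpa [bare, male, female] using gain_nonneg (fun p => hc.nonneg h0 hr0 p) (0, 0, m)

lemma IsSolution.sum_bare_le (hc : IsSolution ⊤ c) (h0 : IsInitial (c 0)) (s : Finset ℕ+) {t : ℝ}
    (ht : 0 ≤ t) : ∑ m ∈ s, c t (bare m) ≤ ∑' p, c 0 p := by
  exact (Finset.sum_map s ⟨bare, bare_injective⟩ (c t)).symm.trans_le <|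
    ((hc.summable h0 ht).1.sum_le_tsum _ fun p _ => hc.nonneg h0 ht p).trans
    (hc.summable h0 ht).2

lemma IsSolution.exists_tendsto_bare (hc : IsSolution ⊤ c) (h0 : IsInitial (c 0)) :
    ∃ u : ℕ+ → ℝ, Summable u ∧ (∀ m t, 0 ≤ t → c t (bare m) ≤ u m) ∧
      ∀ m, Tendsto (fun t => c t (bare m)) atTop (𝓝 (u m)) := by
  have hle : ∀ m t, 0 ≤ t → c t (bare m) ≤ ∑' p, c 0 p := fun m t ht => by
    simpa using hc.sum_bare_le h0 {m} ht
  -- Freezing negative times at 0 turns monotonicity on the half-line into monotonicity on all of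
  -- `ℝ`.
  have hmono : ∀ m, Monotone fun t => c (max t 0) (bare m) := fun m s t hst =>
    hc.bare_mono h0 m (le_max_right _ _) (max_le_max_right 0 hst)
  have hbdd : ∀ m, BddAbove (range fun t => c (max t 0) (bare m)) := fun m =>
    ⟨_, by rintro _ ⟨t, rfl⟩; exact hle m _ (le_max_right _ _)⟩
  have hev : ∀ m, (fun t => c (max t 0) (bare m)) =ᶠ[atTop] fun t => c t (bare m) := fun m => by
    filter_upwards [eventually_ge_atTop 0] with t ht
    rw [max_eq_left ht]
  have hlim : ∀ m, Tendsto (fun t => c t (bare m)) atTop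
      (𝓝 (⨆ t, c (max t 0) (bare m))) := fun m =>
    (tendsto_atTop_ciSup (hmono m) (hbdd m)).congr' (hev m)
  have hub : ∀ m t, 0 ≤ t → c t (bare m) ≤ ⨆ t, c (max t 0) (bare m) := fun m t ht => by
    have := le_ciSup (hbdd m) t
    simpa only [max_eq_left ht] using this
  refine ⟨fun m => ⨆ t, c (max t 0) (bare m), ?_, hub, hlim⟩
  refine summable_of_sum_le (c := ∑' p, c 0 p)
    (fun m => (hc.nonneg h0 le_rfl _).trans (hub m 0 le_rfl)) fun s => ?_
  refine le_of_tendsto (tendsto_finsetSum s fun m _ => hlim m) ?_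
  filter_upwards [eventually_ge_atTop 0] with t ht using hc.sum_bare_le h0 s ht

/-- A particle that is not bare carries at least one arm, so such particles contribute at most the
total arm concentration `2 / (1 + t)`. The bare ones are handled by dominated convergence, with the
summable limit itself as the bound. -/
lemma IsSolution.tendsto_armless (hc : IsSolution ⊤ c) (h0 : IsInitial (c 0))
    (hM : critM (c 0) ≤ 1) {u : ℕ+ → ℝ} (hu : Summable u)
    (hle : ∀ m t, 0 ≤ t → c t (bare m) ≤ u m)
    (hlim : ∀ m, Tendsto (fun t => c t (bare m)) atTop (𝓝 (u m))) :
    Tendsto (fun t => ∑' p, |c t p - armless u p|) atTop (𝓝 0) := by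
  have hd : Tendsto (fun t => ∑' m, |c t (bare m) - u m|) atTop (𝓝 (∑' _ : ℕ+, (0 : ℝ))) := by
    refine tendsto_tsum_of_dominated_convergence (bound := u) hu (fun m => ?_) ?_
    · simpa using ((hlim m).sub_const (u m)).abs
    · filter_upwards [eventually_ge_atTop 0] with t ht m
      rw [Real.norm_eq_abs, abs_abs, abs_le]
      constructor <;> linarith [hc.nonneg h0 ht (bare m), hle m t ht]
  rw [tsum_zero] at hd
  have hdecay : Tendsto (fun t : ℝ => (1 + t)⁻¹) atTop (𝓝 0) :=
    tendsto_inv_atTop_zero.comp (tendsto_atTop_add_const_left _ _ tendsto_id)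
  have hb := (hdecay.add hdecay).add hd
  rw [add_zero, add_zero] at hb
  refine squeeze_zero' (Eventually.of_forall fun t => tsum_nonneg fun p => abs_nonneg _) ?_ hb
  filter_upwards [eventually_ge_atTop 0] with t ht
  have hA := hc.hasSum_male ht
  have hB := hc.hasSum_female ht
  rw [(hc.arms_eq_and_momentBound h0 hM ht).1.1] at hA
  rw [(hc.arms_eq_and_momentBound h0 hM ht).1.2] at hB
  have hs : Summable fun m => |c t (bare m) - u m| :=
    (((hc.summable h0 ht).1.comp_injective bare_injective).sub hu).abs
  have hD : HasSum (armless fun m => |c t (bare m) - u m|) (∑' m, |c t (bare m) - u m|) := by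
    rw [← bare_injective.hasSum_iff fun p hp => armless_of_notMem_range _ hp]
    exact HasSum.of_eq hs.hasSum fun m => armless_bare (fun m => |c t (bare m) - u m|) m
  refine hasSum_le (fun p => ?_)
    ((hc.summable h0 ht).1.sub (summable_armless hu)).abs.hasSum ((hA.add hB).add hD)
  have hn := hc.nonneg h0 ht p
  by_cases hp : p.1 = 0 ∧ p.2.1 = 0
  · rw [eq_bare hp, armless_bare, armless_bare]
    simp [bare, male, female]
  · have h1 : 1 ≤ male p + female p := by
      have : 1 ≤ p.1 + p.2.1 := by omega
      simp only [male, female]; exact_mod_cast this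
    simp only [armless, if_neg hp, sub_zero, add_zero, abs_of_nonneg hn]
    nlinarith

end

/-! ### Power series estimates and the partial derivatives of g₀ -/

section

/-- The derivative of `x ↦ x ^ n`. -/
noncomputable def dpow (x : ℝ) (n : ℕ) : ℝ := n * x ^ (n - 1)

/-- The second derivative of `x ↦ x ^ n`. -/
noncomputable def ddpow (x : ℝ) (n : ℕ) : ℝ := n * (n - 1 : ℕ) * x ^ (n - 2)

lemma dpow_nonneg {x : ℝ} (hx : 0 ≤ x) (n : ℕ) : 0 ≤ dpow x n := by unfold dpow; positivity

lemma ddpow_nonneg {x : ℝ} (hx : 0 ≤ x) (n : ℕ) : 0 ≤ ddpow x n := by unfold ddpow; positivity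

lemma dpow_mono {x y : ℝ} (hx : 0 ≤ x) (hxy : x ≤ y) (n : ℕ) : dpow x n ≤ dpow y n := by
  unfold dpow; gcongr

lemma ddpow_mono {x y : ℝ} (hx : 0 ≤ x) (hxy : x ≤ y) (n : ℕ) : ddpow x n ≤ ddpow y n := by
  unfold ddpow; gcongr

lemma dpow_one (n : ℕ) : dpow 1 n = n := by simp [dpow]

lemma ddpow_one (n : ℕ) : ddpow 1 n = (n : ℝ) ^ 2 - n := by
  rcases n with _ | n
  · simp [ddpow]
  · simp [ddpow]; ring

lemma dpow_succ (x : ℝ) (n : ℕ) : dpow x (n + 1) = x * dpow x n + x ^ n := by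
  rcases n with _ | n
  · simp [dpow]
  · simp only [dpow, Nat.add_sub_cancel]; push_cast; ring

lemma ddpow_succ (x : ℝ) (n : ℕ) : ddpow x (n + 1) = x * ddpow x n + 2 * dpow x n := by
  rcases n with _ | _ | n
  · simp [ddpow, dpow]
  · simp [ddpow, dpow]
  · simp only [ddpow, dpow, Nat.add_sub_cancel, show n + 1 + 1 + 1 - 2 = n + 1 from rfl]
    push_cast; ring

lemma mul_pow_eq_dpow (x : ℝ) (n : ℕ) : n * x ^ n = x * dpow x n := by
  rcases n with _ | n
  · simp [dpow]
  · simp only [dpow, Nat.add_sub_cancel]; ring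

lemma mul_dpow_eq (x : ℝ) (n : ℕ) : n * dpow x n = x * ddpow x n + dpow x n := by
  rcases n with _ | _ | n
  · simp [dpow, ddpow]
  · simp [dpow, ddpow]
  · simp only [dpow, ddpow, Nat.add_sub_cancel]; push_cast; ring

lemma mul_pow_merge (x : ℝ) (m n : ℕ) : m * x ^ (m + n - 1) = dpow x m * x ^ n := by
  rcases m with _ | m
  · simp [dpow]
  · rw [dpow, show m + 1 + n - 1 = m + n by omega, Nat.add_sub_cancel, pow_add]; ring

lemma dpow_add (x : ℝ) (m n : ℕ) : dpow x (m + n) = dpow x m * x ^ n + x ^ m * dpow x n := by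
  induction n with
  | zero => simp [dpow]
  | succ n ih => rw [← add_assoc, dpow_succ, ih, dpow_succ, pow_succ, pow_add]; ring

lemma mul_dpow_merge (x : ℝ) (m n : ℕ) :
    m * dpow x (m + n - 1) = ddpow x m * x ^ n + dpow x m * dpow x n := by
  rcases m with _ | m
  · simp [dpow, ddpow]
  · rw [show m + 1 + n - 1 = m + n by omega, dpow_add, mul_add, ← mul_assoc, ← mul_assoc]
    simp only [ddpow, dpow, Nat.add_sub_cancel, show m + 1 - 2 = m - 1 by omega]
    ring

lemma abs_pow_sub_pow_le {x y r : ℝ} (hx : x ∈ Icc 0 r) (hy : y ∈ Icc 0 r) (n : ℕ) :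
    |x ^ n - y ^ n| ≤ dpow r n * |x - y| := by
  have hr := hx.1.trans hx.2
  induction n with
  | zero => simp [dpow]
  | succ n ih =>
    rw [show x ^ (n + 1) - y ^ (n + 1) = x * (x ^ n - y ^ n) + y ^ n * (x - y) by ring]
    refine (abs_add_le _ _).trans ?_
    rw [abs_mul, abs_mul, abs_of_nonneg hx.1, abs_of_nonneg (pow_nonneg hy.1 n), dpow_succ, add_mul,
      mul_assoc]
    exact add_le_add (mul_le_mul hx.2 ih (abs_nonneg _) hr)
      (mul_le_mul_of_nonneg_right (pow_le_pow_left₀ hy.1 hy.2 n) (abs_nonneg _))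

lemma abs_dpow_sub_le {x y r : ℝ} (hx : x ∈ Icc 0 r) (hy : y ∈ Icc 0 r) (n : ℕ) :
    |dpow x n - dpow y n| ≤ ddpow r n * |x - y| := by
  have h := mul_le_mul_of_nonneg_left (abs_pow_sub_pow_le hx hy (n - 1))
    (Nat.cast_nonneg n : (0 : ℝ) ≤ n)
  rw [dpow, dpow, ← mul_sub, abs_mul, Nat.abs_cast]
  refine h.trans (le_of_eq ?_)
  rw [dpow, ddpow, Nat.sub_sub]; ring

/-- The constant is not sharp, but at `r = 1` it is `n² - n`, exactly the weight whose mean under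
`c₀` is finite. -/
lemma abs_pow_taylor_le {x y r : ℝ} (hx : x ∈ Icc 0 r) (hy : y ∈ Icc 0 r) (n : ℕ) :
    |x ^ n - y ^ n - (x - y) * dpow y n| ≤ ddpow r n * (x - y) ^ 2 := by
  have hr := hx.1.trans hx.2
  induction n with
  | zero => simp [dpow, ddpow]
  | succ n ih =>
    have e : x ^ (n + 1) - y ^ (n + 1) - (x - y) * dpow y (n + 1) =
        x * (x ^ n - y ^ n - (x - y) * dpow y n) + dpow y n * (x - y) ^ 2 := by
      rw [dpow_succ]; ring
    rw [e, ddpow_succ, add_mul, mul_assoc]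
    refine (abs_add_le _ _).trans ?_
    rw [abs_mul, abs_mul, abs_of_nonneg hx.1, abs_of_nonneg (dpow_nonneg hy.1 n),
      abs_of_nonneg (sq_nonneg (x - y))]
    refine add_le_add (mul_le_mul hx.2 ih (abs_nonneg _) hr)
      (mul_le_mul_of_nonneg_right ?_ (sq_nonneg _))
    linarith [dpow_mono hy.1 hy.2 n, dpow_nonneg hr n]

/-- Geometric decay beats the polynomial factors uniformly in `n`. This replaces moments in the
mass, about which nothing is assumed, and is the reason for staying below `z = 1`. -/
lemma exists_dpow_bound {r : ℝ} (h0 : 0 < r) (h1 : r < 1) :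
    ∃ C, 1 ≤ C ∧ ∀ n, dpow r n ≤ C ∧ ddpow r n ≤ C := by
  have hs := summable_pow_mul_geometric_of_norm_lt_one (R := ℝ) 2 (r := r)
    (by rwa [Real.norm_of_nonneg h0.le])
  set S := ∑' n : ℕ, (n : ℝ) ^ 2 * r ^ n with hS
  have hle : ∀ n : ℕ, (n : ℝ) ^ 2 * r ^ n ≤ S := fun n =>
    hs.le_tsum n fun m _ => by positivity
  have hS0 : 0 ≤ S := tsum_nonneg fun n => by positivity
  have hr2 : 0 < r ^ 2 := by positivity
  refine ⟨S / r ^ 2 + 1, by have : 0 ≤ S / r ^ 2 := by positivity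
                            linarith, fun n => ?_⟩
  have key : (n : ℝ) ^ 2 * r ^ (n - 2) ≤ S / r ^ 2 := by
    rw [le_div_iff₀ hr2, mul_assoc, ← pow_add]
    refine le_trans ?_ (hle n)
    exact mul_le_mul_of_nonneg_left (pow_le_pow_of_le_one h0.le h1.le (by omega)) (by positivity)
  have hn : (n : ℝ) ≤ (n : ℝ) ^ 2 := by exact_mod_cast Nat.le_self_pow two_ne_zero n
  constructor
  · have : dpow r n ≤ (n : ℝ) ^ 2 * r ^ (n - 2) := by
      rw [dpow]
      exact mul_le_mul hn (pow_le_pow_of_le_one h0.le h1.le (by omega)) (by positivity)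
        (by positivity)
    linarith
  · have : ddpow r n ≤ (n : ℝ) ^ 2 * r ^ (n - 2) := by
      rw [ddpow, sq]
      have : ((n - 1 : ℕ) : ℝ) ≤ n := by exact_mod_cast Nat.sub_le n 1
      gcongr
    linarith

lemma hasDerivWithinAt_of_taylor {f : ℝ → ℝ} {f' C z : ℝ} {s : Set ℝ}
    (h : ∀ᶠ u in 𝓝[s] z, |f u - f z - (u - z) * f'| ≤ C * (u - z) ^ 2) :
    HasDerivWithinAt f f' s z := by
  rw [hasDerivWithinAt_iff_isLittleO]
  have hO : (fun u => f u - f z - (u - z) • f') =O[𝓝[s] z] fun u => (u - z) ^ 2 := by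
    refine Asymptotics.IsBigO.of_bound C (h.mono fun u hu => ?_)
    rwa [smul_eq_mul, Real.norm_of_nonneg (sq_nonneg (u - z))]
  have h1 : Tendsto (fun u => u - z) (𝓝[s] z) (𝓝 0) := by
    have : Tendsto (fun u => u - z) (𝓝 z) (𝓝 (z - z)) := tendsto_id.sub_const z
    rw [sub_self] at this
    exact this.mono_left nhdsWithin_le_nhds
  exact hO.trans_isLittleO ((Asymptotics.isLittleO_pow_id one_lt_two).comp_tendsto h1)

/-- Termwise differentiation of a series with a summable quadratic Taylor remainder. -/
lemma hasDerivWithinAt_tsum_of_taylor {ι : Type*} {φ : ℝ → ι → ℝ} {d k : ι → ℝ} {s : Set ℝ}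
    {x : ℝ} (hx : x ∈ s) (hφ : ∀ u ∈ s, Summable (φ u)) (hd : Summable d) (hk : Summable k)
    (h : ∀ u ∈ s, ∀ i, |φ u i - φ x i - (u - x) * d i| ≤ k i * (u - x) ^ 2) :
    HasDerivWithinAt (fun u => ∑' i, φ u i) (∑' i, d i) s x := by
  refine hasDerivWithinAt_of_taylor (C := ∑' i, k i) ?_
  filter_upwards [self_mem_nhdsWithin] with u hu
  rw [← tsum_mul_left, ← (hφ u hu).tsum_sub (hφ x hx),
    ← ((hφ u hu).sub (hφ x hx)).tsum_sub (hd.mul_left _), ← tsum_mul_right, ← Real.norm_eq_abs]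
  exact tsum_of_norm_bounded (hk.mul_right _).hasSum fun i => h u hu i

/-- The weight `u(a) v(b) z^m`. -/
noncomputable def mono (u v : ℕ → ℝ) (z : ℝ) (p : PType) : ℝ := u p.1 * v p.2.1 * z ^ (p.2.2 : ℕ)

lemma summable_mul_of_abs_le {c f g : PType → ℝ} (hc : ∀ p, 0 ≤ c p)
    (hg : Summable fun p => c p * g p) (h : ∀ p, |f p| ≤ g p) : Summable fun p => c p * f p :=
  Summable.of_norm_bounded hg fun p => by
    rw [norm_mul, Real.norm_of_nonneg (hc p)]
    exact mul_le_mul_of_nonneg_left (h p) (hc p)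

lemma mono_nonneg {u v : ℕ → ℝ} {z : ℝ} (hu : ∀ n, 0 ≤ u n) (hv : ∀ n, 0 ≤ v n) (hz : 0 ≤ z)
    (p : PType) : 0 ≤ mono u v z p :=
  mul_nonneg (mul_nonneg (hu _) (hv _)) (pow_nonneg hz _)

/-- Masses are at least 1, so `z ^ m ≤ z`. The gained factor `z` later places the fixed points in
`[0, z]²`. -/
lemma mono_le_mul {u v u' v' : ℕ → ℝ} {z : ℝ} (hu : ∀ n, 0 ≤ u n) (hv : ∀ n, 0 ≤ v n)
    (hu' : ∀ n, u n ≤ u' n) (hv' : ∀ n, v n ≤ v' n) (hz : z ∈ Icc (0 : ℝ) 1) (p : PType) :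
    mono u v z p ≤ z * (u' p.1 * v' p.2.1) := by
  have h1 : z ^ (p.2.2 : ℕ) ≤ z := pow_le_of_le_one hz.1 hz.2 p.2.2.pos.ne'
  rw [mono, mul_comm]
  exact mul_le_mul h1 (mul_le_mul (hu' _) (hv' _) (hv _) ((hu _).trans (hu' _)))
    (mul_nonneg (hu _) (hv _)) hz.1

lemma mono_le {u v u' v' : ℕ → ℝ} {z : ℝ} (hu : ∀ n, 0 ≤ u n) (hv : ∀ n, 0 ≤ v n)
    (hu' : ∀ n, u n ≤ u' n) (hv' : ∀ n, v n ≤ v' n) (hz : z ∈ Icc (0 : ℝ) 1) (p : PType) :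
    mono u v z p ≤ u' p.1 * v' p.2.1 := by
  refine (mono_le_mul hu hv hu' hv' hz p).trans ?_
  exact mul_le_of_le_one_left (mul_nonneg ((hu _).trans (hu' _)) ((hv _).trans (hv' _))) hz.2

section Initial

variable {c₀ : PType → ℝ}

/-- The series for `∂g₀/∂x`. -/
noncomputable def serX (c₀ : PType → ℝ) (x y z : ℝ) : ℝ :=
  ∑' p, c₀ p * mono (dpow x) (y ^ ·) z p

/-- The series for `∂g₀/∂y`. -/
noncomputable def serY (c₀ : PType → ℝ) (x y z : ℝ) : ℝ :=
  ∑' p, c₀ p * mono (x ^ ·) (dpow y) z p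

lemma genFun_eq (c₀ : PType → ℝ) (x y z : ℝ) :
    genFun c₀ x y z = ∑' p, c₀ p * mono (x ^ ·) (y ^ ·) z p := rfl

lemma IsInitial.summable_mono (h0 : IsInitial c₀) {x y z : ℝ} (hx : x ∈ Icc (0 : ℝ) 1)
    (hy : y ∈ Icc (0 : ℝ) 1) (hz : z ∈ Icc (0 : ℝ) 1) :
    Summable fun p => c₀ p * mono (x ^ ·) (y ^ ·) z p :=
  summable_mul_of_abs_le (g := fun _ => 1) h0.nonneg (by simpa using h0.summable) fun p => by
    rw [abs_of_nonneg (mono_nonneg (pow_nonneg hx.1) (pow_nonneg hy.1) hz.1 p)]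
    simpa using mono_le (u' := fun _ => 1) (v' := fun _ => 1) (pow_nonneg hx.1) (pow_nonneg hy.1)
      (fun n => pow_le_one₀ hx.1 hx.2) (fun n => pow_le_one₀ hy.1 hy.2) hz p

lemma mono_dpow_left_le {x y z : ℝ} (hx : x ∈ Icc (0 : ℝ) 1)
    (hy : y ∈ Icc (0 : ℝ) 1) (hz : z ∈ Icc (0 : ℝ) 1) (p : PType) :
    mono (dpow x) (y ^ ·) z p ≤ z * male p := by
  simpa [male] using mono_le_mul (u' := fun n => n) (v' := fun _ => 1) (dpow_nonneg hx.1)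
    (pow_nonneg hy.1) (fun n => (dpow_mono hx.1 hx.2 n).trans (dpow_one n).le)
    (fun n => pow_le_one₀ hy.1 hy.2) hz p

lemma mono_dpow_right_le {x y z : ℝ} (hx : x ∈ Icc (0 : ℝ) 1)
    (hy : y ∈ Icc (0 : ℝ) 1) (hz : z ∈ Icc (0 : ℝ) 1) (p : PType) :
    mono (x ^ ·) (dpow y) z p ≤ z * female p := by
  simpa [female] using mono_le_mul (u' := fun _ => 1) (v' := fun n => n) (pow_nonneg hx.1)
    (dpow_nonneg hy.1) (fun n => pow_le_one₀ hx.1 hx.2)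
    (fun n => (dpow_mono hy.1 hy.2 n).trans (dpow_one n).le) hz p

lemma IsInitial.summable_serX (h0 : IsInitial c₀) {x y z : ℝ} (hx : x ∈ Icc (0 : ℝ) 1)
    (hy : y ∈ Icc (0 : ℝ) 1) (hz : z ∈ Icc (0 : ℝ) 1) :
    Summable fun p => c₀ p * mono (dpow x) (y ^ ·) z p :=
  summable_mul_of_abs_le (g := male) h0.nonneg h0.male_one.summable fun p => by
    rw [abs_of_nonneg (mono_nonneg (dpow_nonneg hx.1) (pow_nonneg hy.1) hz.1 p)]
    exact (mono_dpow_left_le hx hy hz p).trans (mul_le_of_le_one_left (male_nonneg p) hz.2)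

lemma IsInitial.summable_serY (h0 : IsInitial c₀) {x y z : ℝ} (hx : x ∈ Icc (0 : ℝ) 1)
    (hy : y ∈ Icc (0 : ℝ) 1) (hz : z ∈ Icc (0 : ℝ) 1) :
    Summable fun p => c₀ p * mono (x ^ ·) (dpow y) z p :=
  summable_mul_of_abs_le (g := female) h0.nonneg h0.female_one.summable fun p => by
    rw [abs_of_nonneg (mono_nonneg (pow_nonneg hx.1) (dpow_nonneg hy.1) hz.1 p)]
    exact (mono_dpow_right_le hx hy hz p).trans (mul_le_of_le_one_left (female_nonneg p) hz.2)

lemma IsInitial.serX_mem (h0 : IsInitial c₀) {x y z : ℝ} (hx : x ∈ Icc (0 : ℝ) 1)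
    (hy : y ∈ Icc (0 : ℝ) 1) (hz : z ∈ Icc (0 : ℝ) 1) : serX c₀ x y z ∈ Icc 0 z := by
  refine ⟨tsum_nonneg fun p => mul_nonneg (h0.nonneg p)
    (mono_nonneg (dpow_nonneg hx.1) (pow_nonneg hy.1) hz.1 p), ?_⟩
  have := hasSum_le (fun p => ?_) (h0.summable_serX hx hy hz).hasSum (h0.male_one.mul_left z)
  · rwa [mul_one] at this
  · have := mul_le_mul_of_nonneg_left (mono_dpow_left_le hx hy hz p) (h0.nonneg p)
    linarith

lemma IsInitial.serY_mem (h0 : IsInitial c₀) {x y z : ℝ} (hx : x ∈ Icc (0 : ℝ) 1)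
    (hy : y ∈ Icc (0 : ℝ) 1) (hz : z ∈ Icc (0 : ℝ) 1) : serY c₀ x y z ∈ Icc 0 z := by
  refine ⟨tsum_nonneg fun p => mul_nonneg (h0.nonneg p)
    (mono_nonneg (pow_nonneg hx.1) (dpow_nonneg hy.1) hz.1 p), ?_⟩
  have := hasSum_le (fun p => ?_) (h0.summable_serY hx hy hz).hasSum (h0.female_one.mul_left z)
  · rwa [mul_one] at this
  · have := mul_le_mul_of_nonneg_left (mono_dpow_right_le hx hy hz p) (h0.nonneg p)
    linarith

/-- The finite second moment makes the quadratic Taylor remainders summable, so termwise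
differentiation is valid up to the endpoint 1. -/
lemma IsInitial.genFunX_eq (h0 : IsInitial c₀) {x y z : ℝ} (hx : x ∈ Icc (0 : ℝ) 1)
    (hy : y ∈ Icc (0 : ℝ) 1) (hz : z ∈ Icc (0 : ℝ) 1) : genFunX c₀ x y z = serX c₀ x y z := by
  refine HasDerivWithinAt.derivWithin ?_ (uniqueDiffOn_Icc zero_lt_one x hx)
  refine hasDerivWithinAt_tsum_of_taylor (φ := fun u p => c₀ p * mono (u ^ ·) (y ^ ·) z p)
    (k := fun p => c₀ p * (male p ^ 2 - male p)) hx (fun u hu => h0.summable_mono hu hy hz)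
    (h0.summable_serX hx hy hz) h0.summable_male_sq_sub fun u hu p => ?_
  have h1 := abs_pow_taylor_le hu hx p.1
  rw [ddpow_one] at h1
  have hw : |y ^ p.2.1 * z ^ (p.2.2 : ℕ)| ≤ 1 := by
    rw [abs_of_nonneg (mul_nonneg (pow_nonneg hy.1 _) (pow_nonneg hz.1 _))]
    exact mul_le_one₀ (pow_le_one₀ hy.1 hy.2) (pow_nonneg hz.1 _) (pow_le_one₀ hz.1 hz.2)
  rw [show c₀ p * mono (u ^ ·) (y ^ ·) z p - c₀ p * mono (x ^ ·) (y ^ ·) z p -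
      (u - x) * (c₀ p * mono (dpow x) (y ^ ·) z p) =
      c₀ p * ((u ^ p.1 - x ^ p.1 - (u - x) * dpow x p.1) * (y ^ p.2.1 * z ^ (p.2.2 : ℕ))) by
    simp only [mono]; ring, abs_mul, abs_mul, abs_of_nonneg (h0.nonneg p), mul_assoc]
  exact mul_le_mul_of_nonneg_left ((mul_le_of_le_one_right (abs_nonneg _) hw).trans h1)
    (h0.nonneg p)

lemma IsInitial.genFunY_eq (h0 : IsInitial c₀) {x y z : ℝ} (hx : x ∈ Icc (0 : ℝ) 1)
    (hy : y ∈ Icc (0 : ℝ) 1) (hz : z ∈ Icc (0 : ℝ) 1) : genFunY c₀ x y z = serY c₀ x y z := by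
  refine HasDerivWithinAt.derivWithin ?_ (uniqueDiffOn_Icc zero_lt_one y hy)
  refine hasDerivWithinAt_tsum_of_taylor (φ := fun u p => c₀ p * mono (x ^ ·) (u ^ ·) z p)
    (k := fun p => c₀ p * (female p ^ 2 - female p)) hy (fun u hu => h0.summable_mono hx hu hz)
    (h0.summable_serY hx hy hz) h0.summable_female_sq_sub fun u hu p => ?_
  have h1 := abs_pow_taylor_le hu hy p.2.1
  rw [ddpow_one] at h1
  have hw : |x ^ p.1 * z ^ (p.2.2 : ℕ)| ≤ 1 := by
    rw [abs_of_nonneg (mul_nonneg (pow_nonneg hx.1 _) (pow_nonneg hz.1 _))]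
    exact mul_le_one₀ (pow_le_one₀ hx.1 hx.2) (pow_nonneg hz.1 _) (pow_le_one₀ hz.1 hz.2)
  rw [show c₀ p * mono (x ^ ·) (u ^ ·) z p - c₀ p * mono (x ^ ·) (y ^ ·) z p -
      (u - y) * (c₀ p * mono (x ^ ·) (dpow y) z p) =
      c₀ p * ((u ^ p.2.1 - y ^ p.2.1 - (u - y) * dpow y p.2.1) * (x ^ p.1 * z ^ (p.2.2 : ℕ))) by
    simp only [mono]; ring, abs_mul, abs_mul, abs_of_nonneg (h0.nonneg p), mul_assoc]
  exact mul_le_mul_of_nonneg_left ((mul_le_of_le_one_right (abs_nonneg _) hw).trans h1)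
    (h0.nonneg p)

/-- The series for `∂g₀/∂z`. -/
noncomputable def serZ (c₀ : PType → ℝ) (x y z : ℝ) : ℝ :=
  ∑' p : PType, c₀ p * (x ^ p.1 * y ^ p.2.1 * dpow z p.2.2)

lemma IsInitial.summable_mul_of_bounded (h0 : IsInitial c₀) {f : PType → ℝ} {C : ℝ}
    (h : ∀ p, |f p| ≤ C) : Summable fun p => c₀ p * f p :=
  summable_mul_of_abs_le (g := fun _ => C) h0.nonneg (h0.summable.mul_right C) h

lemma abs_pow_mul_pow_le_one {x y : ℝ} (hx : x ∈ Icc (0 : ℝ) 1) (hy : y ∈ Icc (0 : ℝ) 1)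
    (m n : ℕ) : |x ^ m * y ^ n| ≤ 1 := by
  rw [abs_of_nonneg (mul_nonneg (pow_nonneg hx.1 _) (pow_nonneg hy.1 _))]
  exact mul_le_one₀ (pow_le_one₀ hx.1 hx.2) (pow_nonneg hy.1 _) (pow_le_one₀ hy.1 hy.2)

lemma IsInitial.summable_serZ (h0 : IsInitial c₀) {x y z : ℝ} (hx : x ∈ Icc (0 : ℝ) 1)
    (hy : y ∈ Icc (0 : ℝ) 1) (hz : z ∈ Ico (0 : ℝ) 1) :
    Summable fun p : PType => c₀ p * (x ^ p.1 * y ^ p.2.1 * dpow z p.2.2) := by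
  obtain ⟨C, -, hC⟩ := exists_dpow_bound (r := (1 + z) / 2) (by linarith [hz.1])
    (by linarith [hz.2])
  refine h0.summable_mul_of_bounded (C := C) fun p => ?_
  rw [abs_mul, abs_of_nonneg (dpow_nonneg hz.1 _)]
  exact (mul_le_of_le_one_left (dpow_nonneg hz.1 _) (abs_pow_mul_pow_le_one hx hy _ _)).trans
    ((dpow_mono hz.1 (by linarith [hz.2]) _).trans (hC _).1)

lemma IsInitial.genFunZ_taylor (h0 : IsInitial c₀) {r : ℝ} (hr0 : 0 < r) (hr1 : r < 1) :
    ∃ C, 0 ≤ C ∧ ∀ x ∈ Icc (0 : ℝ) 1, ∀ y ∈ Icc (0 : ℝ) 1, ∀ z ∈ Icc 0 r, ∀ u ∈ Icc 0 r,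
      |genFun c₀ x y u - genFun c₀ x y z - (u - z) * serZ c₀ x y z| ≤ C * (u - z) ^ 2 := by
  obtain ⟨C, hC1, hC⟩ := exists_dpow_bound hr0 hr1
  refine ⟨(∑' p, c₀ p) * C, mul_nonneg (tsum_nonneg h0.nonneg) (by linarith), ?_⟩
  intro x hx y hy z hz u hu
  have hz1 : z ∈ Icc (0 : ℝ) 1 := ⟨hz.1, hz.2.trans hr1.le⟩
  have hu1 : u ∈ Icc (0 : ℝ) 1 := ⟨hu.1, hu.2.trans hr1.le⟩
  have s1 := h0.summable_mono hx hy hz1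
  have s2 := h0.summable_mono hx hy hu1
  have s3 := h0.summable_serZ hx hy ⟨hz.1, hz.2.trans_lt hr1⟩
  rw [genFun_eq, genFun_eq, serZ, ← tsum_mul_left, ← s2.tsum_sub s1,
    ← (s2.sub s1).tsum_sub (s3.mul_left _), ← tsum_mul_right, ← tsum_mul_right, ← Real.norm_eq_abs]
  refine tsum_of_norm_bounded ((h0.summable.mul_right _).mul_right _).hasSum fun p => ?_
  have h1 := abs_pow_taylor_le hu hz p.2.2
  rw [show c₀ p * mono (x ^ ·) (y ^ ·) u p - c₀ p * mono (x ^ ·) (y ^ ·) z p -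
      (u - z) * (c₀ p * (x ^ p.1 * y ^ p.2.1 * dpow z p.2.2)) =
      c₀ p * ((u ^ (p.2.2 : ℕ) - z ^ (p.2.2 : ℕ) - (u - z) * dpow z p.2.2) *
        (x ^ p.1 * y ^ p.2.1)) by
    simp only [mono]; ring, norm_mul, norm_mul, Real.norm_of_nonneg (h0.nonneg p), mul_assoc]
  refine mul_le_mul_of_nonneg_left (((mul_le_of_le_one_right (norm_nonneg _)
    (abs_pow_mul_pow_le_one hx hy _ _)).trans h1).trans ?_) (h0.nonneg p)
  exact mul_le_mul_of_nonneg_right (hC _).2 (sq_nonneg _)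

lemma IsInitial.genFunZ_eq (h0 : IsInitial c₀) {x y z : ℝ} (hx : x ∈ Icc (0 : ℝ) 1)
    (hy : y ∈ Icc (0 : ℝ) 1) (hz : z ∈ Ico (0 : ℝ) 1) : genFunZ c₀ x y z = serZ c₀ x y z := by
  refine HasDerivWithinAt.derivWithin ?_ (uniqueDiffOn_Icc zero_lt_one z (Ico_subset_Icc_self hz))
  have hzr : z < (1 + z) / 2 := by linarith [hz.2]
  obtain ⟨C, -, hC⟩ := h0.genFunZ_taylor (r := (1 + z) / 2) (by linarith [hz.1])
    (by linarith [hz.2])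
  refine hasDerivWithinAt_of_taylor (C := C) ?_
  filter_upwards [self_mem_nhdsWithin, mem_nhdsWithin_of_mem_nhds (Iio_mem_nhds hzr)] with u hu hur
  exact hC x hx y hy z ⟨hz.1, hzr.le⟩ u ⟨hu.1, (le_of_lt hur)⟩

end Initial

end

/-! ### The fixed point equation and the envelope formula -/

section

variable {c₀ : PType → ℝ}

lemma pow_le_self_of_mem {z : ℝ} (hz : z ∈ Icc (0 : ℝ) 1) (m : ℕ+) : z ^ (m : ℕ) ≤ z :=
  pow_le_of_le_one hz.1 hz.2 m.pos.ne'

lemma abs_pow_mul_dpow_sub_le {x y x' y' : ℝ} (hx : x ∈ Icc (0 : ℝ) 1) (hy : y ∈ Icc (0 : ℝ) 1)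
    (hx' : x' ∈ Icc (0 : ℝ) 1) (hy' : y' ∈ Icc (0 : ℝ) 1) (a b : ℕ) :
    |x ^ a * dpow y b - x' ^ a * dpow y' b| ≤
      a * b * |x - x'| + ((b : ℝ) ^ 2 - b) * |y - y'| := by
  rw [show x ^ a * dpow y b - x' ^ a * dpow y' b =
    (x ^ a - x' ^ a) * dpow y b + x' ^ a * (dpow y b - dpow y' b) by ring]
  refine (abs_add_le _ _).trans ?_
  have h1 := abs_pow_sub_pow_le hx hx' a
  have h2 := abs_dpow_sub_le hy hy' b
  have h3 := (dpow_mono hy.1 hy.2 b).trans (dpow_one b).le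
  rw [dpow_one] at h1
  rw [ddpow_one] at h2
  rw [abs_mul, abs_mul, abs_of_nonneg (dpow_nonneg hy.1 b), abs_of_nonneg (pow_nonneg hx'.1 a)]
  have h4 := mul_le_mul h1 h3 (dpow_nonneg hy.1 b) (by positivity)
  have h5 := mul_le_of_le_one_left (abs_nonneg (dpow y b - dpow y' b))
    (pow_le_one₀ hx'.1 hx'.2 : x' ^ a ≤ 1)
  linarith

/-- With its companion for `serX`, this bounds the fixed point map by `z` times the nonnegative
matrix whose spectral radius is `critM c₀`. -/
lemma IsInitial.abs_serY_sub_le (h0 : IsInitial c₀) {x y x' y' z : ℝ} (hx : x ∈ Icc (0 : ℝ) 1)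
    (hy : y ∈ Icc (0 : ℝ) 1) (hx' : x' ∈ Icc (0 : ℝ) 1) (hy' : y' ∈ Icc (0 : ℝ) 1)
    (hz : z ∈ Icc (0 : ℝ) 1) : |serY c₀ x y z - serY c₀ x' y' z| ≤
      z * (bracket c₀ (fun p => male p * female p) * |x - x'| +
        bracket c₀ (fun p => female p ^ 2 - female p) * |y - y'|) := by
  rw [serY, serY, ← (h0.summable_serY hx hy hz).tsum_sub (h0.summable_serY hx' hy' hz),
    ← Real.norm_eq_abs]
  refine tsum_of_norm_bounded (((h0.summable_mixed.hasSum.mul_right _).add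
    (h0.summable_female_sq_sub.hasSum.mul_right _)).mul_left z) fun p => ?_
  have h1 := abs_pow_mul_dpow_sub_le hx hy hx' hy' p.1 p.2.1
  have h2 := pow_le_self_of_mem hz p.2.2
  rw [show c₀ p * mono (x ^ ·) (dpow y) z p - c₀ p * mono (x' ^ ·) (dpow y') z p =
    c₀ p * (z ^ (p.2.2 : ℕ) * (x ^ p.1 * dpow y p.2.1 - x' ^ p.1 * dpow y' p.2.1)) by
      simp only [mono]; ring, norm_mul, norm_mul, Real.norm_of_nonneg (h0.nonneg p),
    Real.norm_of_nonneg (pow_nonneg hz.1 _), Real.norm_eq_abs]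
  have h3 := mul_le_mul_of_nonneg_left (mul_le_mul h2 h1 (abs_nonneg _) hz.1) (h0.nonneg p)
  refine h3.trans (le_of_eq ?_)
  simp only [male, female]; ring

lemma IsInitial.abs_serX_sub_le (h0 : IsInitial c₀) {x y x' y' z : ℝ} (hx : x ∈ Icc (0 : ℝ) 1)
    (hy : y ∈ Icc (0 : ℝ) 1) (hx' : x' ∈ Icc (0 : ℝ) 1) (hy' : y' ∈ Icc (0 : ℝ) 1)
    (hz : z ∈ Icc (0 : ℝ) 1) : |serX c₀ x y z - serX c₀ x' y' z| ≤
      z * (bracket c₀ (fun p => male p * female p) * |y - y'| +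
        bracket c₀ (fun p => male p ^ 2 - male p) * |x - x'|) := by
  rw [serX, serX, ← (h0.summable_serX hx hy hz).tsum_sub (h0.summable_serX hx' hy' hz),
    ← Real.norm_eq_abs]
  refine tsum_of_norm_bounded (((h0.summable_mixed.hasSum.mul_right _).add
    (h0.summable_male_sq_sub.hasSum.mul_right _)).mul_left z) fun p => ?_
  have h1 := abs_pow_mul_dpow_sub_le hy hx hy' hx' p.2.1 p.1
  have h2 := pow_le_self_of_mem hz p.2.2
  rw [show c₀ p * mono (dpow x) (y ^ ·) z p - c₀ p * mono (dpow x') (y' ^ ·) z p =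
    c₀ p * (z ^ (p.2.2 : ℕ) * (y ^ p.2.1 * dpow x p.1 - y' ^ p.2.1 * dpow x' p.1)) by
      simp only [mono]; ring, norm_mul, norm_mul, Real.norm_of_nonneg (h0.nonneg p),
    Real.norm_of_nonneg (pow_nonneg hz.1 _), Real.norm_eq_abs]
  have h3 := mul_le_mul_of_nonneg_left (mul_le_mul h2 h1 (abs_nonneg _) hz.1) (h0.nonneg p)
  refine h3.trans (le_of_eq ?_)
  simp only [male, female]; ring

lemma IsInitial.exists_ser_lipschitz (h0 : IsInitial c₀) {r : ℝ} (hr0 : 0 < r) (hr1 : r < 1) :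
    ∃ C, 0 ≤ C ∧ ∀ x ∈ Icc (0 : ℝ) 1, ∀ y ∈ Icc (0 : ℝ) 1, ∀ z ∈ Icc 0 r, ∀ z' ∈ Icc 0 r,
      |serX c₀ x y z - serX c₀ x y z'| ≤ C * |z - z'| ∧
      |serY c₀ x y z - serY c₀ x y z'| ≤ C * |z - z'| := by
  obtain ⟨C, hC1, hC⟩ := exists_dpow_bound hr0 hr1
  refine ⟨C, by linarith, ?_⟩
  intro x hx y hy z hz z' hz'
  have hz1 : z ∈ Icc (0 : ℝ) 1 := ⟨hz.1, hz.2.trans hr1.le⟩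
  have hz1' : z' ∈ Icc (0 : ℝ) 1 := ⟨hz'.1, hz'.2.trans hr1.le⟩
  have key : ∀ n : ℕ, |z ^ n - z' ^ n| ≤ C * |z - z'| := fun n =>
    (abs_pow_sub_pow_le hz hz' n).trans (mul_le_mul_of_nonneg_right (hC n).1 (abs_nonneg _))
  have hd : ∀ x ∈ Icc (0 : ℝ) 1, ∀ y ∈ Icc (0 : ℝ) 1, ∀ a b : ℕ, |dpow x a * y ^ b| ≤ a := by
    intro x hx y hy a b
    rw [abs_mul, abs_of_nonneg (dpow_nonneg hx.1 a), abs_of_nonneg (pow_nonneg hy.1 b)]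
    exact (mul_le_of_le_one_right (dpow_nonneg hx.1 a) (pow_le_one₀ hy.1 hy.2)).trans
      ((dpow_mono hx.1 hx.2 a).trans (dpow_one a).le)
  constructor
  · rw [serX, serX, ← (h0.summable_serX hx hy hz1).tsum_sub (h0.summable_serX hx hy hz1'),
      ← Real.norm_eq_abs, ← one_mul (C * _)]
    refine tsum_of_norm_bounded (h0.male_one.mul_right _) fun p => ?_
    rw [show c₀ p * mono (dpow x) (y ^ ·) z p - c₀ p * mono (dpow x) (y ^ ·) z' p =
      c₀ p * ((dpow x p.1 * y ^ p.2.1) * (z ^ (p.2.2 : ℕ) - z' ^ (p.2.2 : ℕ))) by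
        simp only [mono]; ring, norm_mul, norm_mul, Real.norm_of_nonneg (h0.nonneg p), mul_assoc]
    exact mul_le_mul_of_nonneg_left (mul_le_mul (hd x hx y hy _ _) (key _) (abs_nonneg _)
      (male_nonneg p)) (h0.nonneg p)
  · rw [serY, serY, ← (h0.summable_serY hx hy hz1).tsum_sub (h0.summable_serY hx hy hz1'),
      ← Real.norm_eq_abs, ← one_mul (C * _)]
    refine tsum_of_norm_bounded (h0.female_one.mul_right _) fun p => ?_
    rw [show c₀ p * mono (x ^ ·) (dpow y) z p - c₀ p * mono (x ^ ·) (dpow y) z' p =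
      c₀ p * ((dpow y p.2.1 * x ^ p.1) * (z ^ (p.2.2 : ℕ) - z' ^ (p.2.2 : ℕ))) by
        simp only [mono]; ring, norm_mul, norm_mul, Real.norm_of_nonneg (h0.nonneg p), mul_assoc]
    exact mul_le_mul_of_nonneg_left (mul_le_mul (hd y hy x hx _ _) (key _) (abs_nonneg _)
      (female_nonneg p)) (h0.nonneg p)

lemma IsInitial.genFun_taylor (h0 : IsInitial c₀) :
    ∃ C, 0 ≤ C ∧ ∀ x ∈ Icc (0 : ℝ) 1, ∀ y ∈ Icc (0 : ℝ) 1, ∀ x' ∈ Icc (0 : ℝ) 1,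
      ∀ y' ∈ Icc (0 : ℝ) 1, ∀ z ∈ Icc (0 : ℝ) 1,
      |genFun c₀ x y z - genFun c₀ x' y' z - (x - x') * serX c₀ x' y' z -
        (y - y') * serY c₀ x' y' z| ≤ C * (|x - x'| + |y - y'|) ^ 2 := by
  have sK := (h0.summable_mixed.add h0.summable_female_sq_sub).add h0.summable_male_sq_sub
  refine ⟨∑' p, (c₀ p * (male p * female p) + c₀ p * (female p ^ 2 - female p) +
      c₀ p * (male p ^ 2 - male p)), tsum_nonneg fun p => ?_, ?_⟩
  · have := male_sq_sub_nonneg p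
    have := female_sq_sub_nonneg p
    have := male_nonneg p
    have := female_nonneg p
    have := h0.nonneg p
    positivity
  intro x hx y hy x' hx' y' hy' z hz
  have s1 := h0.summable_mono hx hy hz
  have s2 := h0.summable_mono hx' hy' hz
  have s3 := (h0.summable_serX hx' hy' hz).mul_left (x - x')
  have s4 := (h0.summable_serY hx' hy' hz).mul_left (y - y')
  rw [genFun_eq, genFun_eq, serX, serY, ← tsum_mul_left, ← tsum_mul_left, ← s1.tsum_sub s2,
    ← (s1.sub s2).tsum_sub s3, ← ((s1.sub s2).sub s3).tsum_sub s4, ← Real.norm_eq_abs]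
  refine tsum_of_norm_bounded (sK.hasSum.mul_right _) fun p => ?_
  have ex := abs_pow_taylor_le hx hx' p.1
  have ey := abs_pow_taylor_le hy hy' p.2.1
  have dx := abs_pow_sub_pow_le hx hx' p.1
  have dy := abs_pow_sub_pow_le hy hy' p.2.1
  rw [ddpow_one] at ex ey
  rw [dpow_one] at dx dy
  have hx1 : x' ^ p.1 ≤ 1 := pow_le_one₀ hx'.1 hx'.2
  have hy1 : y' ^ p.2.1 ≤ 1 := pow_le_one₀ hy'.1 hy'.2
  have hz1 : z ^ (p.2.2 : ℕ) ≤ 1 := pow_le_one₀ hz.1 hz.2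
  have e1 := mul_le_mul dx dy (abs_nonneg _) (by positivity)
  have e2 := (mul_le_of_le_one_right (abs_nonneg _) hy1).trans ex
  have e3 := (mul_le_of_le_one_right (abs_nonneg _) hx1).trans ey
  have hX := male_sq_sub_nonneg p
  have hY := female_sq_sub_nonneg p
  have hZ := mul_nonneg (male_nonneg p) (female_nonneg p)
  -- Exact splitting of the two-variable remainder: a product of increments plus the two
  -- one-variable remainders. The three second moments bound the three terms.
  have habs : |(x ^ p.1 - x' ^ p.1) * (y ^ p.2.1 - y' ^ p.2.1) +
      (x ^ p.1 - x' ^ p.1 - (x - x') * dpow x' p.1) * y' ^ p.2.1 +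
      (y ^ p.2.1 - y' ^ p.2.1 - (y - y') * dpow y' p.2.1) * x' ^ p.1| ≤
      (male p * female p + (female p ^ 2 - female p) + (male p ^ 2 - male p)) *
        (|x - x'| + |y - y'|) ^ 2 := by
    refine (abs_add_le _ _).trans ((add_le_add_left (abs_add_le _ _) _).trans ?_)
    rw [abs_mul, abs_mul, abs_mul, abs_of_nonneg (pow_nonneg hx'.1 p.1),
      abs_of_nonneg (pow_nonneg hy'.1 p.2.1)]
    rw [← sq_abs (x - x')] at e2
    rw [← sq_abs (y - y')] at e3
    simp only [male, female] at *
    have d1 := abs_nonneg (x - x')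
    have d2 := abs_nonneg (y - y')
    generalize |x - x'| = X at *
    generalize |y - y'| = Y at *
    have m1 := mul_le_mul_of_nonneg_left (by nlinarith : X * Y ≤ (X + Y) ^ 2) hZ
    have m2 := mul_le_mul_of_nonneg_left (by nlinarith : X ^ 2 ≤ (X + Y) ^ 2) hX
    have m3 := mul_le_mul_of_nonneg_left (by nlinarith : Y ^ 2 ≤ (X + Y) ^ 2) hY
    linarith
  rw [show c₀ p * mono (x ^ ·) (y ^ ·) z p - c₀ p * mono (x' ^ ·) (y' ^ ·) z p -
      (x - x') * (c₀ p * mono (dpow x') (y' ^ ·) z p) -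
      (y - y') * (c₀ p * mono (x' ^ ·) (dpow y') z p) =
      c₀ p * (((x ^ p.1 - x' ^ p.1) * (y ^ p.2.1 - y' ^ p.2.1) +
      (x ^ p.1 - x' ^ p.1 - (x - x') * dpow x' p.1) * y' ^ p.2.1 +
      (y ^ p.2.1 - y' ^ p.2.1 - (y - y') * dpow y' p.2.1) * x' ^ p.1) * z ^ (p.2.2 : ℕ)) by
    simp only [mono]; ring, norm_mul, norm_mul, Real.norm_of_nonneg (h0.nonneg p),
    Real.norm_of_nonneg (pow_nonneg hz.1 _), Real.norm_eq_abs, ← mul_add, ← mul_add, mul_assoc]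
  exact mul_le_mul_of_nonneg_left
    ((mul_le_of_le_one_right (abs_nonneg _) hz1).trans habs) (h0.nonneg p)

lemma IsInitial.isFixedPt_iff (h0 : IsInitial c₀) {z : ℝ} (hz : z ∈ Icc (0 : ℝ) 1) {h : ℝ × ℝ} :
    IsFixedPt c₀ z h ↔ h.1 ∈ Icc (0 : ℝ) 1 ∧ h.2 ∈ Icc (0 : ℝ) 1 ∧
      h.1 = serY c₀ h.1 h.2 z ∧ h.2 = serX c₀ h.1 h.2 z := by
  refine and_congr_right fun h1 => and_congr_right fun h2 => ?_
  rw [h0.genFunX_eq h1 h2 hz, h0.genFunY_eq h1 h2 hz]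

/-- All coefficients are nonnegative, so the map is monotone on the complete lattice `[0, 1]²`, and
Knaster–Tarski provides a least fixed point. -/
lemma IsInitial.exists_isFixedPt (h0 : IsInitial c₀) {z : ℝ} (hz : z ∈ Icc (0 : ℝ) 1) :
    ∃ h, IsFixedPt c₀ z h := by
  let Φ : (Icc (0 : ℝ) 1 × Icc (0 : ℝ) 1) →o (Icc (0 : ℝ) 1 × Icc (0 : ℝ) 1) :=
    { toFun := fun w =>
        (⟨serY c₀ w.1 w.2 z, Icc_subset_Icc_right hz.2 (h0.serY_mem w.1.2 w.2.2 hz)⟩,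
          ⟨serX c₀ w.1 w.2 z, Icc_subset_Icc_right hz.2 (h0.serX_mem w.1.2 w.2.2 hz)⟩)
      monotone' := by
        intro v w hvw
        have h1 : (v.1 : ℝ) ≤ w.1 := hvw.1
        have h2 : (v.2 : ℝ) ≤ w.2 := hvw.2
        constructor
        · refine (h0.summable_serY v.1.2 v.2.2 hz).tsum_le_tsum (fun p => ?_)
            (h0.summable_serY w.1.2 w.2.2 hz)
          refine mul_le_mul_of_nonneg_left (mul_le_mul_of_nonneg_right (mul_le_mul
            (pow_le_pow_left₀ v.1.2.1 h1 _) (dpow_mono v.2.2.1 h2 _) (dpow_nonneg v.2.2.1 _)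
            (pow_nonneg w.1.2.1 _)) (pow_nonneg hz.1 _)) (h0.nonneg p)
        · refine (h0.summable_serX v.1.2 v.2.2 hz).tsum_le_tsum (fun p => ?_)
            (h0.summable_serX w.1.2 w.2.2 hz)
          refine mul_le_mul_of_nonneg_left (mul_le_mul_of_nonneg_right (mul_le_mul
            (dpow_mono v.1.2.1 h1 _) (pow_le_pow_left₀ v.2.2.1 h2 _) (pow_nonneg v.2.2.1 _)
            (dpow_nonneg w.1.2.1 _)) (pow_nonneg hz.1 _)) (h0.nonneg p) }
  have hfix := Φ.map_lfp
  refine ⟨(Φ.lfp.1, Φ.lfp.2), (h0.isFixedPt_iff hz).2 ⟨Φ.lfp.1.2, Φ.lfp.2.2, ?_, ?_⟩⟩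
  · exact (congrArg (fun w => ((w.1 : Icc (0 : ℝ) 1) : ℝ)) hfix).symm
  · exact (congrArg (fun w => ((w.2 : Icc (0 : ℝ) 1) : ℝ)) hfix).symm

/-- Below `z = 1` the fixed points depend on `z` in a Lipschitz way; in particular they are
unique. -/
lemma IsInitial.exists_fixedPt_lipschitz (h0 : IsInitial c₀) (hM : critM c₀ ≤ 1) {r : ℝ}
    (hr0 : 0 < r) (hr1 : r < 1) :
    ∃ L, 0 ≤ L ∧ ∀ z ∈ Icc 0 r, ∀ z' ∈ Icc 0 r, ∀ h h' : ℝ × ℝ, IsFixedPt c₀ z h →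
      IsFixedPt c₀ z' h' → |h.1 - h'.1| + |h.2 - h'.2| ≤ L * |z - z'| := by
  obtain ⟨C, hC0, hC⟩ := h0.exists_ser_lipschitz hr0 hr1
  -- With slack `1 - r`, the map contracts the weighted norm `u + l v` by the factor `r (2 - r) = 1
  -- - (1 - r)² < 1`. This is where the denominator `(1 - r)²` comes from.
  obtain ⟨l, hl, hl1, hl2⟩ := h0.exists_weight hM (sub_pos.2 hr1)
  have hl0 : 0 < l⁻¹ := inv_pos.2 hl
  have hl' : l * l⁻¹ = 1 := mul_inv_cancel₀ hl.ne'
  set Z := bracket c₀ fun p => male p * female p with hZ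
  set X := bracket c₀ fun p => male p ^ 2 - male p with hX
  set Y := bracket c₀ fun p => female p ^ 2 - female p with hY
  have hX0 : 0 ≤ X := tsum_nonneg fun p => mul_nonneg (h0.nonneg p) (male_sq_sub_nonneg p)
  have hY0 : 0 ≤ Y := tsum_nonneg fun p => mul_nonneg (h0.nonneg p) (female_sq_sub_nonneg p)
  have hZ0 : 0 ≤ Z := tsum_nonneg fun p =>
    mul_nonneg (h0.nonneg p) (mul_nonneg (male_nonneg p) (female_nonneg p))
  refine ⟨(1 + l⁻¹) * (C * (1 + l) / (1 - r) ^ 2), by positivity, ?_⟩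
  intro z hz z' hz' h h' hh hh'
  have hz1 : z ∈ Icc (0 : ℝ) 1 := ⟨hz.1, hz.2.trans hr1.le⟩
  have hz1' : z' ∈ Icc (0 : ℝ) 1 := ⟨hz'.1, hz'.2.trans hr1.le⟩
  obtain ⟨a1, a2, a3, a4⟩ := (h0.isFixedPt_iff hz1).1 hh
  obtain ⟨b1, b2, b3, b4⟩ := (h0.isFixedPt_iff hz1').1 hh'
  have e1 := h0.abs_serY_sub_le a1 a2 b1 b2 hz1
  have e2 := h0.abs_serX_sub_le a1 a2 b1 b2 hz1
  obtain ⟨f2, f1⟩ := hC h'.1 b1 h'.2 b2 z hz z' hz'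
  rw [← a3] at e1
  rw [← a4] at e2
  rw [← b3] at f1
  rw [← b4] at f2
  have g1 := (abs_sub_le h.1 (serY c₀ h'.1 h'.2 z) h'.1).trans (add_le_add e1 f1)
  have g2 := (abs_sub_le h.2 (serX c₀ h'.1 h'.2 z) h'.2).trans (add_le_add e2 f2)
  rw [← hZ, ← hY] at g1
  rw [← hZ, ← hX] at g2
  have d1 := abs_nonneg (h.1 - h'.1)
  have d2 := abs_nonneg (h.2 - h'.2)
  have d3 := abs_nonneg (z - z')
  generalize |h.1 - h'.1| = u at *
  generalize |h.2 - h'.2| = v at *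
  generalize |z - z'| = w at *
  have k1 : u ≤ r * (Z * u + Y * v) + C * w :=
    g1.trans (add_le_add_left (mul_le_mul_of_nonneg_right hz.2 (by positivity)) _)
  have k2 : v ≤ r * (Z * v + X * u) + C * w :=
    g2.trans (add_le_add_left (mul_le_mul_of_nonneg_right hz.2 (by positivity)) _)
  have k3 : l * (l⁻¹ * Y) = Y := by rw [← mul_assoc, hl', one_mul]
  have k4 : (Z * u + Y * v) + l * (Z * v + X * u) ≤ (1 + (1 - r)) * (u + l * v) := by
    have q1 := mul_le_mul_of_nonneg_right hl1 d1
    have q2 := mul_le_mul_of_nonneg_right hl2 (mul_nonneg hl.le d2)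
    have q3 : (Z + l⁻¹ * Y) * (l * v) = l * (Z * v) + Y * v := by
      linear_combination v * k3
    rw [q3] at q2
    linarith
  have k5 : u + l * v ≤ r * ((1 + (1 - r)) * (u + l * v)) + C * (1 + l) * w := by
    have q1 := mul_le_mul_of_nonneg_left k4 hr0.le
    have q2 := mul_le_mul_of_nonneg_left k2 hl.le
    linarith
  have k6 : (u + l * v) ≤ C * (1 + l) / (1 - r) ^ 2 * w := by
    have hpos : 0 < (1 - r) ^ 2 := by have := sub_pos.2 hr1; positivity
    rw [div_mul_eq_mul_div, le_div_iff₀ hpos]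
    linarith
  have k7 : u + v ≤ (1 + l⁻¹) * (u + l * v) := by
    have : l⁻¹ * (l * v) = v := by rw [← mul_assoc, mul_comm l⁻¹, hl', one_mul]
    have := mul_nonneg hl0.le d1
    have := mul_nonneg hl.le d2
    linarith
  have := mul_le_mul_of_nonneg_left k6 (by positivity : 0 ≤ 1 + l⁻¹)
  linarith

lemma IsInitial.existsUnique_isFixedPt (h0 : IsInitial c₀) (hM : critM c₀ ≤ 1) {z : ℝ}
    (hz : z ∈ Ico (0 : ℝ) 1) : ∃! h, IsFixedPt c₀ z h := by
  obtain ⟨h, hh⟩ := h0.exists_isFixedPt (Ico_subset_Icc_self hz)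
  refine ⟨h, hh, fun h' hh' => ?_⟩
  obtain ⟨L, -, hL⟩ := h0.exists_fixedPt_lipschitz hM (r := (1 + z) / 2) (by linarith [hz.1])
    (by linarith [hz.2])
  have hzr : z ∈ Icc 0 ((1 + z) / 2) := ⟨hz.1, by linarith [hz.2]⟩
  have := hL z hzr z hzr h' h hh' hh
  rw [sub_self, abs_zero, mul_zero] at this
  have h1 := abs_nonneg (h'.1 - h.1)
  have h2 := abs_nonneg (h'.2 - h.2)
  exact Prod.ext (sub_eq_zero.1 (abs_eq_zero.1 (by linarith)))
    (sub_eq_zero.1 (abs_eq_zero.1 (by linarith)))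

/-- The envelope formula: `z ↦ g₀(h(z), z) - h₁(z) h₂(z)` has derivative `∂g₀/∂z (h(z), z)`. -/
lemma IsInitial.hasDerivWithinAt_envelope (h0 : IsInitial c₀) (hM : critM c₀ ≤ 1)
    {h : ℝ → ℝ × ℝ} (hh : ∀ z ∈ Ico (0 : ℝ) 1, IsFixedPt c₀ z (h z)) {z : ℝ}
    (hz : z ∈ Ico (0 : ℝ) 1) :
    HasDerivWithinAt (fun z => genFun c₀ (h z).1 (h z).2 z - (h z).1 * (h z).2)
      (genFunZ c₀ (h z).1 (h z).2 z) (Ico 0 1) z := by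
  have hr0 : 0 < (1 + z) / 2 := by linarith [hz.1]
  have hr1 : (1 + z) / 2 < 1 := by linarith [hz.2]
  have hzr : z < (1 + z) / 2 := by linarith [hz.2]
  obtain ⟨L, hL0, hL⟩ := h0.exists_fixedPt_lipschitz hM hr0 hr1
  obtain ⟨C, hC0, hC⟩ := h0.genFunZ_taylor hr0 hr1
  obtain ⟨D, hD0, hD⟩ := h0.genFun_taylor
  obtain ⟨a1, a2, -, -⟩ := (h0.isFixedPt_iff (Ico_subset_Icc_self hz)).1 (hh z hz)
  rw [h0.genFunZ_eq a1 a2 hz]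
  refine hasDerivWithinAt_of_taylor (C := C + (D + 1) * L ^ 2) ?_
  filter_upwards [self_mem_nhdsWithin, mem_nhdsWithin_of_mem_nhds (Iio_mem_nhds hzr)] with u hu hur
  have hur' : u ∈ Icc 0 ((1 + z) / 2) := ⟨hu.1, le_of_lt hur⟩
  have hzr' : z ∈ Icc 0 ((1 + z) / 2) := ⟨hz.1, hzr.le⟩
  obtain ⟨b1, b2, b3, b4⟩ := (h0.isFixedPt_iff (Ico_subset_Icc_self hu)).1 (hh u hu)
  have e1 := hC _ a1 _ a2 z hzr' u hur'
  -- Expanding about `h u` makes the gradient equal to `((h u).2, (h u).1)` by the fixed point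
  -- equation. Its linear terms cancel those of the product `h₁ h₂`, leaving only terms quadratic in
  -- the increment of `h`; Lipschitz dependence on `z` is then enough, without differentiability of
  -- `h`.
  have e2 := hD _ a1 _ a2 _ b1 _ b2 u (Ico_subset_Icc_self hu)
  have e3 := hL z hzr' u hur' _ _ (hh z hz) (hh u hu)
  rw [← b3, ← b4] at e2
  have e4 : (|(h z).1 - (h u).1| + |(h z).2 - (h u).2|) ^ 2 ≤ L ^ 2 * (u - z) ^ 2 := by
    rw [← mul_pow, ← sq_abs (L * (u - z)), abs_mul, abs_of_nonneg hL0, abs_sub_comm u z]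
    exact pow_le_pow_left₀ (by positivity) e3 2
  have e5 : |((h z).1 - (h u).1) * ((h z).2 - (h u).2)| ≤
      (|(h z).1 - (h u).1| + |(h z).2 - (h u).2|) ^ 2 := by
    rw [abs_mul]
    nlinarith [abs_nonneg ((h z).1 - (h u).1), abs_nonneg ((h z).2 - (h u).2)]
  have e6 := mul_le_mul_of_nonneg_left e4 (by linarith : 0 ≤ D + 1)
  rw [abs_le] at *
  constructor <;> linarith [e1.1, e1.2, e2.1, e2.2, e5.1, e5.2]

end

/-! ### The generating function along a stationary characteristic -/

section Static

variable (x y z : ℝ) (p q : PType)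

/-- The arm counts supply the factors from differentiation and the merger removes one arm of each
sex, so the gain term factorises as `∂g/∂x · ∂g/∂y`. -/
lemma mono_merge : male p * female q * mono (x ^ ·) (y ^ ·) z (merge p q) =
    mono (dpow x) (y ^ ·) z p * mono (x ^ ·) (dpow y) z q := by
  have h1 := mul_pow_merge x p.1 q.1
  have h2 := mul_pow_merge y q.2.1 p.2.1
  simp only [mono, merge, male, female, PNat.add_coe, pow_add]
  rw [add_comm p.2.1 q.2.1]
  linear_combination (q.2.1 * y ^ (q.2.1 + p.2.1 - 1) * z ^ (p.2.2 : ℕ) * z ^ (q.2.2 : ℕ)) * h1 +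
    (dpow x p.1 * x ^ q.1 * z ^ (p.2.2 : ℕ) * z ^ (q.2.2 : ℕ)) * h2

lemma mono_dpow_left_merge : male p * female q * mono (dpow x) (y ^ ·) z (merge p q) =
    mono (ddpow x) (y ^ ·) z p * mono (x ^ ·) (dpow y) z q +
      mono (dpow x) (y ^ ·) z p * mono (dpow x) (dpow y) z q := by
  have h1 := mul_dpow_merge x p.1 q.1
  have h2 := mul_pow_merge y q.2.1 p.2.1
  simp only [mono, merge, male, female, PNat.add_coe, pow_add]
  rw [add_comm p.2.1 q.2.1]
  linear_combination (q.2.1 * y ^ (q.2.1 + p.2.1 - 1) * z ^ (p.2.2 : ℕ) * z ^ (q.2.2 : ℕ)) * h1 +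
    ((ddpow x p.1 * x ^ q.1 + dpow x p.1 * dpow x q.1) * z ^ (p.2.2 : ℕ) * z ^ (q.2.2 : ℕ)) * h2

lemma mono_dpow_right_merge : male p * female q * mono (x ^ ·) (dpow y) z (merge p q) =
    mono (dpow x) (y ^ ·) z p * mono (x ^ ·) (ddpow y) z q +
      mono (dpow x) (dpow y) z p * mono (x ^ ·) (dpow y) z q := by
  have h1 := mul_pow_merge x p.1 q.1
  have h2 := mul_dpow_merge y q.2.1 p.2.1
  simp only [mono, merge, male, female, PNat.add_coe, pow_add]
  rw [add_comm p.2.1 q.2.1]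
  linear_combination (q.2.1 * dpow y (q.2.1 + p.2.1 - 1) * z ^ (p.2.2 : ℕ) * z ^ (q.2.2 : ℕ)) * h1 +
    (dpow x p.1 * x ^ q.1 * z ^ (p.2.2 : ℕ) * z ^ (q.2.2 : ℕ)) * h2

lemma male_mul_mono (v : ℕ → ℝ) : male p * mono (x ^ ·) v z p = x * mono (dpow x) v z p := by
  simp only [mono, male]
  linear_combination (v p.2.1 * z ^ (p.2.2 : ℕ)) * mul_pow_eq_dpow x p.1

lemma female_mul_mono (u : ℕ → ℝ) : female p * mono u (y ^ ·) z p = y * mono u (dpow y) z p := by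
  simp only [mono, female]
  linear_combination (u p.1 * z ^ (p.2.2 : ℕ)) * mul_pow_eq_dpow y p.2.1

lemma male_mul_mono_dpow (v : ℕ → ℝ) :
    male p * mono (dpow x) v z p = x * mono (ddpow x) v z p + mono (dpow x) v z p := by
  simp only [mono, male]
  linear_combination (v p.2.1 * z ^ (p.2.2 : ℕ)) * mul_dpow_eq x p.1

lemma female_mul_mono_dpow (u : ℕ → ℝ) :
    female p * mono u (dpow y) z p = y * mono u (ddpow y) z p + mono u (dpow y) z p := by
  simp only [mono, female]
  linear_combination (u p.1 * z ^ (p.2.2 : ℕ)) * mul_dpow_eq y p.2.1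

variable {x y z} {c : PType → ℝ} {A B P Q P₁₁ P₁₂ P₂₂ : ℝ}

/-- This is the right-hand side of the partial differential equation for the generating function.
The next two lemmas are its derivatives in `x` and `y`. -/
lemma hasSum_weak_mono (hA : HasSum (fun p => c p * male p) A)
    (hB : HasSum (fun p => c p * female p) B)
    (hP : HasSum (fun p => c p * mono (dpow x) (y ^ ·) z p) P)
    (hQ : HasSum (fun p => c p * mono (x ^ ·) (dpow y) z p) Q) :
    HasSum (fun w : PType × PType => pairWeight c w * (mono (x ^ ·) (y ^ ·) z (merge w.1 w.2) -
      mono (x ^ ·) (y ^ ·) z w.1 - mono (x ^ ·) (y ^ ·) z w.2))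
      (P * Q - x * (P * B) - y * (A * Q)) := by
  refine HasSum.of_eq (((hasSum_pair hP hQ).sub ((hasSum_pair hP hB).mul_left x)).sub
    ((hasSum_pair hA hQ).mul_left y)) fun w => ?_
  have h1 := mono_merge x y z w.1 w.2
  have h2 := male_mul_mono x z w.1 (y ^ ·)
  have h3 := female_mul_mono y z w.2 (x ^ ·)
  simp only [pairWeight]
  linear_combination (c w.1 * c w.2) * h1 - (c w.1 * c w.2 * female w.2) * h2 -
    (c w.1 * male w.1 * c w.2) * h3

lemma hasSum_weak_mono_dpow_left (hA : HasSum (fun p => c p * male p) A)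
    (hB : HasSum (fun p => c p * female p) B)
    (hP : HasSum (fun p => c p * mono (dpow x) (y ^ ·) z p) P)
    (hQ : HasSum (fun p => c p * mono (x ^ ·) (dpow y) z p) Q)
    (h11 : HasSum (fun p => c p * mono (ddpow x) (y ^ ·) z p) P₁₁)
    (h12 : HasSum (fun p => c p * mono (dpow x) (dpow y) z p) P₁₂) :
    HasSum (fun w : PType × PType => pairWeight c w *
      (mono (dpow x) (y ^ ·) z (merge w.1 w.2) - mono (dpow x) (y ^ ·) z w.1 -
        mono (dpow x) (y ^ ·) z w.2))
      (P₁₁ * Q + P * P₁₂ - (x * (P₁₁ * B) + P * B) - y * (A * P₁₂)) := by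
  refine HasSum.of_eq ((((hasSum_pair h11 hQ).add (hasSum_pair hP h12)).sub
    (((hasSum_pair h11 hB).mul_left x).add (hasSum_pair hP hB))).sub
    ((hasSum_pair hA h12).mul_left y)) fun w => ?_
  have h1 := mono_dpow_left_merge x y z w.1 w.2
  have h2 := male_mul_mono_dpow x z w.1 (y ^ ·)
  have h3 := female_mul_mono y z w.2 (dpow x)
  simp only [pairWeight]
  linear_combination (c w.1 * c w.2) * h1 - (c w.1 * c w.2 * female w.2) * h2 -
    (c w.1 * male w.1 * c w.2) * h3

lemma hasSum_weak_mono_dpow_right (hA : HasSum (fun p => c p * male p) A)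
    (hB : HasSum (fun p => c p * female p) B)
    (hP : HasSum (fun p => c p * mono (dpow x) (y ^ ·) z p) P)
    (hQ : HasSum (fun p => c p * mono (x ^ ·) (dpow y) z p) Q)
    (h12 : HasSum (fun p => c p * mono (dpow x) (dpow y) z p) P₁₂)
    (h22 : HasSum (fun p => c p * mono (x ^ ·) (ddpow y) z p) P₂₂) :
    HasSum (fun w : PType × PType => pairWeight c w *
      (mono (x ^ ·) (dpow y) z (merge w.1 w.2) - mono (x ^ ·) (dpow y) z w.1 -
        mono (x ^ ·) (dpow y) z w.2))
      (P * P₂₂ + P₁₂ * Q - x * (P₁₂ * B) - (y * (A * P₂₂) + A * Q)) := by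
  refine HasSum.of_eq ((((hasSum_pair hP h22).add (hasSum_pair h12 hQ)).sub
    ((hasSum_pair h12 hB).mul_left x)).sub
    (((hasSum_pair hA h22).mul_left y).add (hasSum_pair hA hQ))) fun w => ?_
  have h1 := mono_dpow_right_merge x y z w.1 w.2
  have h2 := male_mul_mono x z w.1 (dpow y)
  have h3 := female_mul_mono_dpow y z w.2 (x ^ ·)
  simp only [pairWeight]
  linear_combination (c w.1 * c w.2) * h1 - (c w.1 * c w.2 * female w.2) * h2 -
    (c w.1 * male w.1 * c w.2) * h3

end Static

/-- A homogeneous two-dimensional linear system with bounded coefficients and zero initial value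
has only the zero solution. -/
lemma eq_zero_of_linear_system {ξ η α β γ δ : ℝ → ℝ} {T K : ℝ}
    (hα : ∀ t ∈ Icc 0 T, |α t| ≤ K) (hβ : ∀ t ∈ Icc 0 T, |β t| ≤ K)
    (hγ : ∀ t ∈ Icc 0 T, |γ t| ≤ K) (hδ : ∀ t ∈ Icc 0 T, |δ t| ≤ K)
    (hξ : ∀ t ∈ Icc 0 T, HasDerivWithinAt ξ (α t * ξ t + β t * η t) (Icc 0 T) t)
    (hη : ∀ t ∈ Icc 0 T, HasDerivWithinAt η (γ t * ξ t + δ t * η t) (Icc 0 T) t)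
    (h1 : ξ 0 = 0) (h2 : η 0 = 0) {t : ℝ} (ht : t ∈ Icc 0 T) : ξ t = 0 ∧ η t = 0 := by
  -- Gronwall for `ξ² + η²`, whose derivative is at most `4 K (ξ² + η²)`: the diagonal terms and the
  -- cross terms account for `2 K` each.
  have hd : ∀ t ∈ Icc 0 T, HasDerivWithinAt
      (fun t => -(Real.exp (-(4 * K) * t) * (ξ t ^ 2 + η t ^ 2)))
      (-(Real.exp (-(4 * K) * t) * (-(4 * K)) * (ξ t ^ 2 + η t ^ 2) + Real.exp (-(4 * K) * t) *
        (2 * ξ t * (α t * ξ t + β t * η t) + 2 * η t * (γ t * ξ t + δ t * η t)))) (Icc 0 T) t := by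
    intro t ht
    have he : HasDerivWithinAt (fun t => Real.exp (-(4 * K) * t))
        (Real.exp (-(4 * K) * t) * (-(4 * K))) (Icc 0 T) t := by
      simpa using ((hasDerivWithinAt_id t (Icc 0 T)).const_mul (-(4 * K))).exp
    have hs := ((hξ t ht).fun_pow 2).fun_add ((hη t ht).fun_pow 2)
    simpa using (he.fun_mul hs).fun_neg
  have hm := monotoneOn_of_hasDerivWithinAt hd (fun t ht => ?_) ⟨le_rfl, ht.1.trans ht.2⟩ ht ht.1
  · simp only [h1, h2] at hm
    have hE := Real.exp_pos (-(4 * K) * t)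
    have h3 : ξ t ^ 2 + η t ^ 2 ≤ 0 := by
      by_contra! h
      have := mul_pos hE h
      rw [zero_pow two_ne_zero, add_zero, mul_zero, neg_zero] at hm
      linarith
    exact ⟨by nlinarith [sq_nonneg (ξ t), sq_nonneg (η t)],
      by nlinarith [sq_nonneg (ξ t), sq_nonneg (η t)]⟩
  · have hE := Real.exp_pos (-(4 * K) * t)
    have a := abs_le.1 (hα t ht)
    have b := abs_le.1 (hβ t ht)
    have g := abs_le.1 (hγ t ht)
    have d := abs_le.1 (hδ t ht)
    have key : 2 * ξ t * (α t * ξ t + β t * η t) + 2 * η t * (γ t * ξ t + δ t * η t) ≤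
        4 * K * (ξ t ^ 2 + η t ^ 2) := by
      have e1 : α t * ξ t ^ 2 ≤ K * ξ t ^ 2 := mul_le_mul_of_nonneg_right a.2 (sq_nonneg _)
      have e2 : δ t * η t ^ 2 ≤ K * η t ^ 2 := mul_le_mul_of_nonneg_right d.2 (sq_nonneg _)
      have e3 : (β t + γ t) * (2 * (ξ t * η t)) ≤ (2 * K) * (ξ t ^ 2 + η t ^ 2) := by
        have h4 : |β t + γ t| ≤ 2 * K := abs_le.2 ⟨by linarith, by linarith⟩
        have h5 : |2 * (ξ t * η t)| ≤ ξ t ^ 2 + η t ^ 2 := abs_le.2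
          ⟨by nlinarith [sq_nonneg (ξ t + η t)], by nlinarith [sq_nonneg (ξ t - η t)]⟩
        calc _ ≤ |(β t + γ t) * (2 * (ξ t * η t))| := le_abs_self _
          _ = |β t + γ t| * |2 * (ξ t * η t)| := abs_mul _ _
          _ ≤ _ := mul_le_mul h4 h5 (abs_nonneg _) ((abs_nonneg _).trans h4)
      linarith
    have := mul_le_mul_of_nonneg_left key hE.le
    linarith

variable {c : ℝ → PType → ℝ}

lemma abs_mono_le {u v : ℕ → ℝ} {C z : ℝ} (hu : ∀ n, 0 ≤ u n ∧ u n ≤ C)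
    (hv : ∀ n, 0 ≤ v n ∧ v n ≤ C) (hz : z ∈ Icc (0 : ℝ) 1) (p : PType) :
    |mono u v z p| ≤ C * C := by
  rw [abs_of_nonneg (mono_nonneg (fun n => (hu n).1) (fun n => (hv n).1) hz.1 p)]
  exact (mono_le (fun n => (hu n).1) (fun n => (hv n).1) (fun n => (hu n).2) (fun n => (hv n).2)
    hz p)

/-- The generating function evaluated at the fixed point, at any time. -/
lemma IsSolution.genFun_fixedPt (hc : IsSolution ⊤ c) (h0 : IsInitial (c 0))
    (hM : critM (c 0) ≤ 1) {z : ℝ} (hz : z ∈ Ico (0 : ℝ) 1) {h : ℝ × ℝ}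
    (hh : IsFixedPt (c 0) z h) {T : ℝ} (hT : 0 ≤ T) :
    genFun (c T) h.1 h.2 z = genFun (c 0) h.1 h.2 z - h.1 * h.2 * (1 - (1 + T)⁻¹) := by
  obtain ⟨x, y⟩ := h
  have hz1 := Ico_subset_Icc_self hz
  obtain ⟨hx, hy, hxe, hye⟩ := (h0.isFixedPt_iff hz1).1 hh
  simp only at hx hy hxe hye ⊢
  -- A fixed point lies in `[0, z]²`, away from 1, so all second-order weights evaluated at it are
  -- bounded functions of the particle type.
  have hxz : x ≤ z := hxe ▸ (h0.serY_mem hx hy hz1).2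
  have hyz : y ≤ z := hye ▸ (h0.serX_mem hx hy hz1).2
  obtain ⟨C, hC1, hC⟩ := exists_dpow_bound (r := (1 + z) / 2) (by linarith [hz.1])
    (by linarith [hz.2])
  obtain ⟨K, hK⟩ := (hc.arms_eq_and_momentBound h0 hM hT).2
  have harms : ∀ t ∈ Icc 0 T, maleSum c t = (1 + t)⁻¹ ∧ femaleSum c t = (1 + t)⁻¹ := fun t ht =>
    (hc.arms_eq_and_momentBound h0 hM ht.1).1
  have bpow : ∀ {x : ℝ}, x ∈ Icc (0 : ℝ) 1 → ∀ n : ℕ, 0 ≤ x ^ n ∧ x ^ n ≤ C := fun hx n =>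
    ⟨pow_nonneg hx.1 n, (pow_le_one₀ hx.1 hx.2).trans hC1⟩
  have bd : ∀ {x : ℝ}, 0 ≤ x → x ≤ z → ∀ n : ℕ, 0 ≤ dpow x n ∧ dpow x n ≤ C := fun hx hxz n =>
    ⟨dpow_nonneg hx n, (dpow_mono hx (by linarith [hz.2]) n).trans (hC n).1⟩
  have bdd : ∀ {x : ℝ}, 0 ≤ x → x ≤ z → ∀ n : ℕ, 0 ≤ ddpow x n ∧ ddpow x n ≤ C := fun hx hxz n =>
    ⟨ddpow_nonneg hx n, (ddpow_mono hx (by linarith [hz.2]) n).trans (hC n).2⟩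
  have b0 := abs_mono_le (bpow hx) (bpow hy) hz1
  have b1 := abs_mono_le (bd hx.1 hxz) (bpow hy) hz1
  have b2 := abs_mono_le (bpow hx) (bd hy.1 hyz) hz1
  have b11 := abs_mono_le (bdd hx.1 hxz) (bpow hy) hz1
  have b12 := abs_mono_le (bd hx.1 hxz) (bd hy.1 hyz) hz1
  have b22 := abs_mono_le (bpow hx) (bdd hy.1 hyz) hz1
  have hCC : 0 ≤ C * C := by positivity
  have lin : ∀ {f : PType → ℝ}, (∀ p, |f p| ≤ C * C) → ∀ p, |f p| ≤ C * C * (1 + arms p) :=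
    fun hf p => (hf p).trans (le_mul_of_one_le_right hCC (by linarith [arms_nonneg p]))
  have hsum : ∀ {f : PType → ℝ}, (∀ p, |f p| ≤ C * C) → ∀ t ∈ Icc 0 T,
      HasSum (fun p => c t p * f p) (∑' p, c t p * f p) := fun hf t ht =>
    (hc.summable_mul h0 (lin hf) ht.1).hasSum
  have hcont : ∀ {f : PType → ℝ}, (∀ p, |f p| ≤ C * C) →
      ContinuousOn (fun t => ∑' p, c t p * f p) (Icc 0 T) := fun hf =>
    hc.continuousOn_tsum h0 hT hK hCC (lin hf)
  have hbd : ∀ {f : PType → ℝ}, (∀ p, |f p| ≤ C * C) → ∀ t ∈ Icc 0 T,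
      |∑' p, c t p * f p| ≤ (∑' p, c 0 p) * (C * C) := fun {f} hf t ht => by
    have hs := hc.summable h0 ht.1
    rw [← Real.norm_eq_abs]
    refine le_trans (tsum_of_norm_bounded (hs.1.hasSum.mul_right (C * C)) fun p => ?_)
      (mul_le_mul_of_nonneg_right hs.2 hCC)
    rw [norm_mul, Real.norm_of_nonneg (hc.nonneg h0 ht.1 p)]
    exact mul_le_mul_of_nonneg_left (hf p) (hc.nonneg h0 ht.1 p)
  have cs : ContinuousOn (fun t : ℝ => (1 + t)⁻¹) (Icc 0 T) :=
    (continuousOn_const.add continuousOn_id : ContinuousOn (fun t : ℝ => 1 + t) _).inv₀ fun t ht => by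
      have := ht.1
      change 1 + t ≠ 0
      positivity
  have ds : ∀ t ∈ Icc 0 T, HasDerivWithinAt (fun t : ℝ => (1 + t)⁻¹) (-((1 + t)⁻¹ * (1 + t)⁻¹))
      (Icc 0 T) t := fun t ht => by
    have h1 : 1 + t ≠ 0 := by have := ht.1; positivity
    have := ((hasDerivWithinAt_id t (Icc 0 T)).const_add 1).fun_inv h1
    refine this.congr_deriv ?_
    rw [id, neg_div, ← mul_inv, ← sq, one_div]
  have hA : ∀ t ∈ Icc 0 T, HasSum (fun p => c t p * male p) (1 + t)⁻¹ := fun t ht =>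
    (harms t ht).1 ▸ hc.hasSum_male ht.1
  have hB : ∀ t ∈ Icc 0 T, HasSum (fun p => c t p * female p) (1 + t)⁻¹ := fun t ht =>
    (harms t ht).2 ▸ hc.hasSum_female ht.1
  set P : ℝ → ℝ := fun t => ∑' p, c t p * mono (dpow x) (y ^ ·) z p with hP
  set Q : ℝ → ℝ := fun t => ∑' p, c t p * mono (x ^ ·) (dpow y) z p with hQ
  set P₁₁ : ℝ → ℝ := fun t => ∑' p, c t p * mono (ddpow x) (y ^ ·) z p with hP11
  set P₁₂ : ℝ → ℝ := fun t => ∑' p, c t p * mono (dpow x) (dpow y) z p with hP12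
  set P₂₂ : ℝ → ℝ := fun t => ∑' p, c t p * mono (x ^ ·) (ddpow y) z p with hP22
  have cP : ContinuousOn P (Icc 0 T) := hcont b1
  have cQ : ContinuousOn Q (Icc 0 T) := hcont b2
  have cP11 : ContinuousOn P₁₁ (Icc 0 T) := hcont b11
  have cP12 : ContinuousOn P₁₂ (Icc 0 T) := hcont b12
  have cP22 : ContinuousOn P₂₂ (Icc 0 T) := hcont b22
  have dP : ∀ t ∈ Icc 0 T, HasDerivWithinAt P _ (Icc 0 T) t := fun t ht =>
    hc.hasDeriv_tsum (Λ := fun t => P₁₁ t * Q t + P t * P₁₂ t -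
        (x * (P₁₁ t * (1 + t)⁻¹) + P t * (1 + t)⁻¹) - y * ((1 + t)⁻¹ * P₁₂ t)) h0 hT hK hCC (lin b1)
      ((((cP11.mul cQ).add (cP.mul cP12)).sub ((continuousOn_const.mul (cP11.mul cs)).add
        (cP.mul cs))).sub (continuousOn_const.mul (cs.mul cP12)))
      (fun t ht => (hasSum_weak_mono_dpow_left (hA t ht) (hB t ht) (hsum b1 t ht) (hsum b2 t ht)
        (hsum b11 t ht) (hsum b12 t ht)).tsum_eq) ht
  have dQ : ∀ t ∈ Icc 0 T, HasDerivWithinAt Q _ (Icc 0 T) t := fun t ht =>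
    hc.hasDeriv_tsum (Λ := fun t => P t * P₂₂ t + P₁₂ t * Q t - x * (P₁₂ t * (1 + t)⁻¹) -
        (y * ((1 + t)⁻¹ * P₂₂ t) + (1 + t)⁻¹ * Q t)) h0 hT hK hCC (lin b2)
      ((((cP.mul cP22).add (cP12.mul cQ)).sub (continuousOn_const.mul (cP12.mul cs))).sub
        ((continuousOn_const.mul (cs.mul cP22)).add (cs.mul cQ)))
      (fun t ht => (hasSum_weak_mono_dpow_right (hA t ht) (hB t ht) (hsum b1 t ht) (hsum b2 t ht)
        (hsum b12 t ht) (hsum b22 t ht)).tsum_eq) ht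
  set N := (∑' p, c 0 p) * (C * C) + 1 with hN
  have hs1 : ∀ t ∈ Icc 0 T, |(1 + t)⁻¹| ≤ 1 := fun t ht => by
    have := ht.1
    rw [abs_of_nonneg (by positivity)]
    exact inv_le_one_of_one_le₀ (by linarith)
  -- The deviations from the predicted gradient solve a homogeneous linear system whose coefficients
  -- are second derivatives of the generating function; they vanish at time 0 by the fixed point
  -- equation.
  have hzero : ∀ t ∈ Icc 0 T, Q t - x * (1 + t)⁻¹ = 0 ∧ P t - y * (1 + t)⁻¹ = 0 := fun t ht =>
    eq_zero_of_linear_system (K := N) (α := fun t => P₁₂ t - (1 + t)⁻¹) (β := P₂₂) (γ := P₁₁)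
      (δ := fun t => P₁₂ t - (1 + t)⁻¹) (ξ := fun t => Q t - x * (1 + t)⁻¹)
      (η := fun t => P t - y * (1 + t)⁻¹)
      (fun t ht => (abs_sub _ _).trans (add_le_add (hbd b12 t ht) (hs1 t ht)))
      (fun t ht => (hbd b22 t ht).trans (by linarith))
      (fun t ht => (hbd b11 t ht).trans (by linarith))
      (fun t ht => (abs_sub _ _).trans (add_le_add (hbd b12 t ht) (hs1 t ht)))
      (fun t ht => by
        refine ((dQ t ht).fun_sub ((ds t ht).const_mul x)).congr_deriv ?_
        ring)
      (fun t ht => by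
        refine ((dP t ht).fun_sub ((ds t ht).const_mul y)).congr_deriv ?_
        ring)
      (by rw [add_zero, inv_one, mul_one, sub_eq_zero]; exact hxe.symm)
      (by rw [add_zero, inv_one, mul_one, sub_eq_zero]; exact hye.symm) ht
  have dG : ∀ t ∈ Icc 0 T, HasDerivWithinAt (fun t => genFun (c t) x y z)
      (-(x * y * ((1 + t)⁻¹ * (1 + t)⁻¹))) (Icc 0 T) t := fun t ht =>
    hc.hasDeriv_tsum (Λ := fun t => -(x * y * ((1 + t)⁻¹ * (1 + t)⁻¹))) h0 hT hK hCC (lin b0)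
      (continuousOn_const.mul (cs.mul cs)).neg
      (fun t ht => by
        rw [(hasSum_weak_mono (hA t ht) (hB t ht) (hsum b1 t ht) (hsum b2 t ht)).tsum_eq]
        obtain ⟨e1, e2⟩ := hzero t ht
        simp only [hP, hQ] at e1 e2
        rw [sub_eq_zero.1 e1, sub_eq_zero.1 e2]
        ring) ht
  refine eq_of_hasDerivWithinAt_eq (A := fun t => genFun (c t) x y z)
    (B := fun t => genFun (c 0) x y z - x * y * (1 - (1 + t)⁻¹)) (by simp) dG (fun t ht => ?_)
    (⟨hT, le_rfl⟩ : T ∈ Icc 0 T)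
  refine ((((ds t ht).const_sub 1).const_mul (x * y)).const_sub (genFun (c 0) x y z)).congr_deriv ?_
  ring

lemma genFun_armless {u : ℕ+ → ℝ} (x y z : ℝ) :
    ∑' p, armless u p * mono (x ^ ·) (y ^ ·) z p = limitGenFun u z := by
  rw [limitGenFun, ← bare_injective.tsum_eq (f := fun p => armless u p * mono (x ^ ·) (y ^ ·) z p)]
  · exact tsum_congr fun m => by rw [armless_bare]; simp [mono, bare]
  · intro p hp
    by_contra h
    exact hp (by simp only [armless_of_notMem_range u h, zero_mul])

/-- The weights at a fixed point are bounded by 1, so ℓ¹ convergence passes to the generating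
function. The armless limit does not depend on `(x, y)`, and `1 / (1 + t)` disappears from the
explicit formula. -/
lemma IsSolution.limitGenFun_eq (hc : IsSolution ⊤ c) (h0 : IsInitial (c 0))
    (hM : critM (c 0) ≤ 1) {u : ℕ+ → ℝ} (hu : Summable u)
    (hlim : Tendsto (fun t => ∑' p, |c t p - armless u p|) atTop (𝓝 0))
    {z : ℝ} (hz : z ∈ Ico (0 : ℝ) 1) {h : ℝ × ℝ} (hh : IsFixedPt (c 0) z h) :
    limitGenFun u z = genFun (c 0) h.1 h.2 z - h.1 * h.2 := by
  have hz1 := Ico_subset_Icc_self hz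
  obtain ⟨hx, hy, -, -⟩ := (h0.isFixedPt_iff hz1).1 hh
  have hm : ∀ p, |mono (h.1 ^ ·) (h.2 ^ ·) z p| ≤ 1 := fun p => by
    simpa using abs_mono_le (C := 1) (fun n => ⟨pow_nonneg hx.1 n, pow_le_one₀ hx.1 hx.2⟩)
      (fun n => ⟨pow_nonneg hy.1 n, pow_le_one₀ hy.1 hy.2⟩) hz1 p
  have hsa : Summable fun p => armless u p * mono (h.1 ^ ·) (h.2 ^ ·) z p :=
    Summable.of_norm_bounded (summable_armless hu).norm fun p => by
      rw [norm_mul]; exact mul_le_of_le_one_right (norm_nonneg _) (hm p)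
  have h1 : Tendsto (fun t => genFun (c t) h.1 h.2 z) atTop (𝓝 (limitGenFun u z)) := by
    rw [tendsto_iff_norm_sub_tendsto_zero]
    refine squeeze_zero' (Eventually.of_forall fun t => norm_nonneg _) ?_ hlim
    filter_upwards [eventually_ge_atTop 0] with t ht
    have hs := (hc.summable h0 ht).1
    have hst : Summable fun p => c t p * mono (h.1 ^ ·) (h.2 ^ ·) z p :=
      Summable.of_norm_bounded hs.norm fun p => by
        rw [norm_mul]; exact mul_le_of_le_one_right (norm_nonneg _) (hm p)
    rw [genFun_eq, ← genFun_armless h.1 h.2 z, ← hst.tsum_sub hsa]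
    refine tsum_of_norm_bounded (hs.sub (summable_armless hu)).abs.hasSum fun p => ?_
    rw [← sub_mul, norm_mul]
    exact mul_le_of_le_one_right (norm_nonneg _) (hm p)
  have h2 : Tendsto (fun t : ℝ => genFun (c 0) h.1 h.2 z - h.1 * h.2 * (1 - (1 + t)⁻¹)) atTop
      (𝓝 (genFun (c 0) h.1 h.2 z - h.1 * h.2 * (1 - 0))) :=
    (((tendsto_inv_atTop_zero.comp
      (tendsto_atTop_add_const_left _ _ tendsto_id)).const_sub 1).const_mul _).const_sub _
  rw [sub_zero, mul_one] at h2
  refine tendsto_nhds_unique h1 (h2.congr' ?_)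
  filter_upwards [eventually_ge_atTop 0] with t ht
  exact (hc.genFun_fixedPt h0 hM hz hh ht).symm

end SexedSmoluchowski

open SexedSmoluchowski in
theorem mainTheorem2
    (c₀ : PType → ℝ) (hc₀ : IsInitial c₀)
    (hT : criticalTime c₀ = ⊤)
    (c : ℝ → PType → ℝ) (hc : IsSolution (criticalTime c₀) c) (hinit : c 0 = c₀) :
    ∃ cInf : ℕ+ → ℝ,
      -- convergence in `ℓ¹` to `c_∞(m) 1_{a = b = 0}`
      (Summable fun m => |cInf m|) ∧
      (∀ t : ℝ, 0 ≤ t → Summable fun p => |c t p|) ∧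
      Tendsto (fun t : ℝ => ∑' p : PType, |c t p - armless cInf p|) atTop (𝓝 0) ∧
      -- `h_∞(z)` is characterised by the fixed point equation
      (∀ z ∈ Ico (0 : ℝ) 1, ∃! h : ℝ × ℝ, IsFixedPt c₀ z h) ∧
      -- `g_∞` is the antiderivative vanishing at `0` of `∂g₀/∂z (h_∞(z), z)` on `[0, 1)`
      (∀ hInf : ℝ → ℝ × ℝ, (∀ z ∈ Ico (0 : ℝ) 1, IsFixedPt c₀ z (hInf z)) →
        limitGenFun cInf 0 = 0 ∧
        ∀ z ∈ Ico (0 : ℝ) 1,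
          HasDerivWithinAt (limitGenFun cInf)
            (genFunZ c₀ (hInf z).1 (hInf z).2 z) (Ico 0 1) z) := by
  subst hinit
  have hM := critM_le_one hT
  rw [hT] at hc
  obtain ⟨u, hu, hle, hlim⟩ := hc.exists_tendsto_bare hc₀
  have htend := hc.tendsto_armless hc₀ hM hu hle hlim
  refine ⟨u, hu.abs, fun t ht => (hc.summable hc₀ ht).1.abs, htend,
    fun z hz => hc₀.existsUnique_isFixedPt hM hz, fun h hh => ⟨?_, fun z hz => ?_⟩⟩
  · simp [limitGenFun]
  · exact (hc₀.hasDerivWithinAt_envelope hM hh hz).congr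
      (fun w hw => hc.limitGenFun_eq hc₀ hM hu htend hw (hh w hw))
      (hc.limitGenFun_eq hc₀ hM hu htend hz (hh z hz))
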